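/- Let $A$ be an abelian group and $R$ a commutative ring. For a finite group $G$, an *$A$-fibered $G$-set* is a $G\times A$-set $X$ on which $A$ acts freely with finitely many orbits. For $x\in X$ let $G_x\le G$ be the stabilizer of the $A$-orbit of $x$ and let $\phi_x:G_x\to A$ be the homomorphism with $gx=\phi_x(g)x$; $(G_x,\phi_x)$ is the *stabilizing pair* of $x$. An *$A$-fibered $(G,H)$-biset* is an $A$-fibered $G\times H$-set, with $guh=(g,h^{-1})u$. Let $\mathcal M(\Gamma)$ be the set of pairs $(U,\phi)$ with $U\le \Gamma$, $\phi\in\mathrm{Hom}(U,A)$, and let $[\Gamma/(U,\phi)]$ be the class of the transitive $A$-fibered $\Gamma$-set with stabilizing pair $(U,\phi)$. For finite groups $G,H$ let $B^A(G,H)$ be the Grothendieck group of isomorphism classes of $A$-fibered $(G,H)$-bisets with respect to disjoint union, $B^A_R(G,H)=R\otimes_{\mathbb Z}B^A(G,H)$. For an $A$-fibered $(G,H)$-biset $U$ and an $A$-fibered $H$-set (or $(H,K)$-biset) $X$, let $U\otimes_{AH}X$ be the set of those $H\times A$-orbits $u\otimes x$ of $U\times X$ under $(h,a)(u,x)=(u(ha)^{-1},hax)$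 on which $A$, acting by $b(u\otimes x)=bu\otimes x$, acts freely; it is an $A$-fibered $G$-set (or $(G,K)$-biset), and it induces the composition $B^A_R(G,H)\times B^A_R(H,K)\to B^A_R(G,K)$. For $(U,\phi)\in\mathcal M(G\times H)$, $(V,\psi)\in\mathcal M(H\times K)$ with $\phi(1,h)\psi(h,1)=1$ whenever $(1,h)\in U$ and $(h,1)\in V$, put $(U,\phi)*(V,\psi)=(U*V,\phi*\psi)$, where $U*V=\{(g,k)\mid (g,h)\in U,\ (h,k)\in V\text{ for some }h\}$ and $(\phi*\psi)(g,k)=\phi(g,h)\psi(h,k)$. For $K\le H$ put $U*K=\{g\mid (g,k)\in U \text{ for some } k\in K\}$, and let $\Delta(K)=\{(k,k)\mid k\in K\}$. Let $\mathcal G$ be a class of finite groups and, for $G,H\in\mathcal G$, let $\mathcal S(G,H)\subseteq\mathcal M(G\times H)$, such that for all $G,H,K\in\mathcal G$: (i) $(\Delta(G),1)\in\mathcal S(G,G)$; (ii) $\mathcal S(G,H)$ is closed under $G\times H$-conjugation; (iii) if $(U,\phi)\in\mathcal S(G,H)$, $(V,\psi)\in\mathcal S(H,K)$ and $(U,\phi)*(V,\psi)$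 is defined, then it lies in $\mathcal S(G,K)$; (iv) if $(U,\phi)\in\mathcal S(G,H)$ and $L\le H$ with $L\in\mathcal G$, then $U*L\in\mathcal G$ and $(U,\phi)*(\Delta(L),1)\in\mathcal S(U*L,L)$. For data $(\mathcal G,\mathcal S)$ satisfying (i)–(iii) let $\mathcal C(\mathcal G,\mathcal S)$ be the $R$-linear category with set of objects $\mathcal G$, in which the morphisms from $H$ to $G$ are the $R$-span in $B^A_R(G,H)$ of the classes $[G\times H/(U,\phi)]$ with $(U,\phi)\in\mathcal S(G,H)$, with composition induced by $\otimes_{A H}$. Let $\mathcal S_+(G,H)$ be the set of $(U,\phi)\in\mathcal M(G\times H)$ such that the projection $p_1(U)\le G$ is in $\mathcal G$ and $(U,\phi)\in\mathcal S(p_1(U),H)$. Then $(\mathcal G,\mathcal S_+)$ satisfies (i)–(iii); put $\mathcal D=\mathcal C(\mathcal G,\mathcal S)$ and $\mathcal D_+=\mathcal C(\mathcal G,\mathcal S_+)$. For $\mathcal E\in\{\mathcal D,\mathcal D_+\}$ let $\mathcal F^A_{\mathcal E,R}$ be the category of $R$-linear functors from $\mathcal E$ to $R$-modules. Let $F\in\mathcal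 F^A_{\mathcal D,R}$ and $G\in\mathcal G$. Let $\Gamma_F(G)$ be the category whose objects are the pairs $(X,s)$, where $X$ is an $A$-fibered $G$-set with $G_x\in\mathcal G$ for all $x\in X$ and $s$ is a $(G,A)$-invariant section of $F$ over $X$, that is, a family of elements $s(x)\in F(G_x)$ ($x\in X$) with $s(gax)=F\big([G_{gx}\times G_x/(\{(gyg^{-1},y)\mid y\in G_x\},1)]\big)(s(x))$ for all $g\in G$, $a\in A$, and whose arrows $(X,s)\to(Y,t)$ are the $G\times A$-equivariant maps $\alpha:X\to Y$ with $G_x=G_{\alpha(x)}$ and $t(\alpha(x))=s(x)$ for all $x$. For fixed $X$ the invariant sections form an $R$-module under pointwise operations. Let $F_+(G)$ be the free abelian group on the isomorphism classes $\{X,s\}$ of objects of $\Gamma_F(G)$ modulo the subgroup generated by all $\{X\sqcup Y,s\sqcup t\}-\{X,s\}-\{Y,t\}$ and all $\{X,s+r\}-\{X,s\}-\{X,r\}$. It is an $R$-module with $r[X,s]=[X,rs]$, where $[X,s]$ denotes the class of $\{X,s\}$. If $G,H\in\mathcal G$ and $U$ is an $A$-fibered $(G,H)$-biset all of whose stabilizing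 pairs $((G\times H)_u,\phi_u)$ lie in $\mathcal S_+(G,H)$, there is a functor $\Gamma_F(U):\Gamma_F(H)\to\Gamma_F(G)$, $(X,s)\mapsto(U\otimes_{AH}X,U(s))$, $\alpha\mapsto U\otimes\alpha$, where $$U(s)(u\otimes x)=F\left(\left[\frac{G_{u\otimes x}\times H_x}{((G\times H)_u,\phi_u)*(\Delta(H_x),1)}\right]\right)(s(x)).$$ **Theorem.** (a) For each $F\in\mathcal F^A_{\mathcal D,R}$, the assignment sending $G\in\mathcal G$ to the $R$-module $F_+(G)$, and $[U]$, for an $A$-fibered $(G,H)$-biset $U$ all of whose stabilizing pairs lie in $\mathcal S_+(G,H)$, to the $R$-linear map $F_+([U]):F_+(H)\to F_+(G)$, $[X,s]\mapsto[U\otimes_{AH}X,U(s)]$, induced by $\Gamma_F(U)$, defines a functor $F_+\in\mathcal F^A_{\mathcal D_+,R}$. (b) The assignment $F\mapsto F_+$, which sends a morphism $\varphi:F\to F'$ to the morphism $\varphi_+:F_+\to F'_+$ with $(\varphi_+)_G([X,s])=[X,\varphi(s)]$, $\varphi(s)(x)=\varphi_{G_x}(s(x))$, defines an $R$-linear functor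 $\mathcal F^A_{\mathcal D,R}\to\mathcal F^A_{\mathcal D_+,R}$. -/

import Mathlib

open CategoryTheory

universe u v w

namespace FiberedBiset

/-! ### Finite groups, subgroups -/

/-- A finite group in the set-theoretic sense: a subset of an ambient type `Ω` with a group
structure.  With this convention a subgroup of a subgroup of `G` is (literally) a subgroup of `G`,
the full subgroup of `G` is `G`, and two groups may share a subgroup, as the notion of a class of
finite groups presupposes. -/
structure FinGroup (Ω : Type u) where
  carrier : Set Ω
  [group : Group carrier]
  [finite : Finite carrier]

attribute [instance] FinGroup.group FinGroup.finite

instance {Ω : Type u} : CoeSort (FinGroup Ω) (Type u) := ⟨fun G => G.carrier⟩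

section Groups

variable {Ω : Type u}

/-- The underlying set of a subgroup of `G`, as a subset of the ambient type. -/
def FinGroup.subSet (G : FinGroup Ω) (P : Subgroup G) : Set Ω :=
  {x | ∃ h : x ∈ G.carrier, (⟨x, h⟩ : G) ∈ P}

def FinGroup.subEquiv (G : FinGroup Ω) (P : Subgroup G) : G.subSet P ≃ P where
  toFun x := ⟨⟨x.1, x.2.1⟩, x.2.2⟩
  invFun x := ⟨x.1.1, x.1.2, x.2⟩
  left_inv _ := rfl
  right_inv _ := rfl

/-- A subgroup `P` of `G`, regarded as a finite group in its own right. -/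
def FinGroup.sub (G : FinGroup Ω) (P : Subgroup G) : FinGroup Ω where
  carrier := G.subSet P
  group := (G.subEquiv P).group
  finite := Finite.of_equiv P (G.subEquiv P).symm

/-- The inclusion of a subgroup. -/
def FinGroup.incl (G : FinGroup Ω) (P : Subgroup G) : G.sub P →* G where
  toFun x := ⟨x.1, x.2.1⟩
  map_one' := rfl
  map_mul' _ _ := rfl

theorem FinGroup.incl_val (G : FinGroup Ω) (P : Subgroup G) (x : G.sub P) :
    (G.incl P x : Ω) = x := rfl

theorem FinGroup.incl_mem (G : FinGroup Ω) (P : Subgroup G) (x : G.sub P) : G.incl P x ∈ P := x.2.2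

theorem FinGroup.incl_injective (G : FinGroup Ω) (P : Subgroup G) :
    Function.Injective (G.incl P) := fun x y h => by
  apply Subtype.ext
  exact congrArg (fun z : G => (z : Ω)) h

/-- An element of `P`, as an element of the group `G.sub P`. -/
def FinGroup.toSub (G : FinGroup Ω) {P : Subgroup G} (x : G) (h : x ∈ P) : G.sub P :=
  ⟨x.1, x.2, h⟩

@[simp] theorem FinGroup.incl_toSub (G : FinGroup Ω) {P : Subgroup G} (x : G) (h : x ∈ P) :
    G.incl P (G.toSub x h) = x := rfl

theorem FinGroup.eq_of_mul_eq {L L' : FinGroup Ω} (m : Ω → Ω → Ω)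
    (hL : ∀ x y : L, ((x * y : L) : Ω) = m x y) (hL' : ∀ x y : L', ((x * y : L') : Ω) = m x y)
    (h : L.carrier = L'.carrier) : L = L' := by
  obtain @⟨c, g, fi⟩ := L
  obtain @⟨c', g', fi'⟩ := L'
  obtain rfl : c = c' := h
  have : g = g' := by
    apply Group.ext
    funext x y
    exact Subtype.ext ((hL x y).trans (hL' x y).symm)
  subst this
  rfl

/-- Two groups which are subgroups of the same group and have the same underlying set agree. -/
theorem FinGroup.eq_of_carrier_eq {L L' G : FinGroup Ω} (f : L →* G) (f' : L' →* G)
    (hf : ∀ x, (f x : Ω) = x) (hf' : ∀ x, (f' x : Ω) = x) (h : L.carrier = L'.carrier) :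
    L = L' := by
  classical
  let m : Ω → Ω → Ω := fun a b =>
    if h : a ∈ G.carrier ∧ b ∈ G.carrier then ((⟨a, h.1⟩ * ⟨b, h.2⟩ : G) : Ω) else a
  have key : ∀ {M : FinGroup Ω} (k : M →* G), (∀ x, (k x : Ω) = x) →
      ∀ x y : M, ((x * y : M) : Ω) = m x y := by
    intro M k hk x y
    have hx : (x : Ω) ∈ G.carrier := by rw [← hk x]; exact (k x).2
    have hy : (y : Ω) ∈ G.carrier := by rw [← hk y]; exact (k y).2
    have e1 : (⟨x, hx⟩ : G) = k x := Subtype.ext (hk x).symm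
    have e2 : (⟨y, hy⟩ : G) = k y := Subtype.ext (hk y).symm
    simp only [m, hx, hy, and_self, dite_true]
    rw [e1, e2, ← map_mul, hk]
  exact FinGroup.eq_of_mul_eq m (key f hf) (key f' hf') h

end Groups

/-! ### Pairs `(U, φ)` with `U` a subgroup and `φ : U → A` a homomorphism -/

/-- The set `M^A(Γ)` of pairs `(U, φ)` with `U ≤ Γ` and `φ ∈ Hom(U, A)`. -/
structure FibPair (A Γ : Type u) [CommGroup A] [Group Γ] where
  sub : Subgroup Γ
  chr : sub →* A

namespace FibPair

variable {A Γ Δ G H K L M : Type u} [CommGroup A] [Group Γ] [Group Δ] [Group G] [Group H] [Group K]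
  [Group L] [Group M]

/-- `p.Rel x a`: `x` lies in the subgroup of `p` and its value under the character is `a`. -/
def Rel (p : FibPair A Γ) (x : Γ) (a : A) : Prop := ∃ h : x ∈ p.sub, p.chr ⟨x, h⟩ = a

theorem rel_chr (p : FibPair A Γ) {x : Γ} (h : x ∈ p.sub) : p.Rel x (p.chr ⟨x, h⟩) := ⟨h, rfl⟩

theorem Rel.unique {p : FibPair A Γ} {x : Γ} {a b : A} (h : p.Rel x a) (h' : p.Rel x b) :
    a = b := by
  obtain ⟨h1, rfl⟩ := h
  obtain ⟨h2, rfl⟩ := h'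
  rfl

theorem Rel.mul {p : FibPair A Γ} {x y : Γ} {a b : A} (h : p.Rel x a) (h' : p.Rel y b) :
    p.Rel (x * y) (a * b) := by
  obtain ⟨h1, rfl⟩ := h
  obtain ⟨h2, rfl⟩ := h'
  exact ⟨p.sub.mul_mem h1 h2, p.chr.map_mul ⟨x, h1⟩ ⟨y, h2⟩⟩

theorem Rel.inv {p : FibPair A Γ} {x : Γ} {a : A} (h : p.Rel x a) : p.Rel x⁻¹ a⁻¹ := by
  obtain ⟨h1, rfl⟩ := h
  exact ⟨p.sub.inv_mem h1, p.chr.map_inv ⟨x, h1⟩⟩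

theorem ext_rel {p q : FibPair A Γ} (h : ∀ x a, p.Rel x a ↔ q.Rel x a) : p = q := by
  obtain ⟨U, φ⟩ := p
  obtain ⟨V, ψ⟩ := q
  obtain rfl : U = V := by
    ext x
    constructor
    · intro hx
      exact ((h x _).1 ⟨hx, rfl⟩).1
    · intro hx
      exact ((h x _).2 ⟨hx, rfl⟩).1
  have : φ = ψ := by
    ext ⟨x, hx⟩
    obtain ⟨h1, h2⟩ := (h x _).1 ⟨hx, rfl⟩
    exact h2.symm
  rw [this]

/-- Pull-back of a pair along a homomorphism. For an inclusion this is restriction. -/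
def comap (f : Δ →* Γ) (p : FibPair A Γ) : FibPair A Δ where
  sub := p.sub.comap f
  chr := p.chr.comp (f.subgroupComap p.sub)

theorem rel_comap (f : Δ →* Γ) (p : FibPair A Γ) (x : Δ) (a : A) :
    (p.comap f).Rel x a ↔ p.Rel (f x) a := Iff.rfl

/-- The conjugate pair `^γ(U, φ) = (γUγ⁻¹, φ(γ⁻¹ · γ))`. -/
def conj (γ : Γ) (p : FibPair A Γ) : FibPair A Γ := p.comap (MulAut.conj γ⁻¹).toMonoidHom

theorem rel_conj (γ : Γ) (p : FibPair A Γ) (x : Γ) (a : A) :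
    (p.conj γ).Rel x a ↔ p.Rel (γ⁻¹ * x * γ) a := by
  rw [conj, rel_comap]; simp

/-- The pair `({(f h, h) | h ∈ H}, 1)`; for `f` an inclusion this is `(Δ(H), 1)`. -/
def graph (f : H →* G) : FibPair A (G × H) where
  sub := (f.prod (MonoidHom.id H)).range
  chr := 1

theorem rel_graph (f : H →* G) (x : G × H) (a : A) :
    (graph f).Rel x a ↔ f x.2 = x.1 ∧ a = 1 := by
  constructor
  · rintro ⟨⟨y, rfl⟩, rfl⟩
    exact ⟨rfl, rfl⟩
  · rintro ⟨h, rfl⟩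
    exact ⟨⟨x.2, Prod.ext h rfl⟩, rfl⟩

/-- The pair `(Δ(G), 1)`. -/
def diag (A G : Type u) [CommGroup A] [Group G] : FibPair A (G × G) := graph (MonoidHom.id G)

/-- The projection `p₁(U)`. -/
def p₁ (p : FibPair A (G × H)) : Subgroup G := p.sub.map (MonoidHom.fst G H)

/-- `U * K = {g | (g, k) ∈ U for some k ∈ K}` for a subgroup `K ≤ H`. -/
def starSubgroup (p : FibPair A (G × H)) (K : Subgroup H) : Subgroup G :=
  (p.sub ⊓ K.comap (MonoidHom.snd G H)).map (MonoidHom.fst G H)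

theorem mem_p₁ (p : FibPair A (G × H)) (g : G) : g ∈ p.p₁ ↔ ∃ h, (g, h) ∈ p.sub := by
  constructor
  · rintro ⟨⟨g', h⟩, hh, rfl⟩
    exact ⟨h, hh⟩
  · rintro ⟨h, hh⟩
    exact ⟨(g, h), hh, rfl⟩

theorem mem_starSubgroup (p : FibPair A (G × H)) (K : Subgroup H) (g : G) :
    g ∈ p.starSubgroup K ↔ ∃ k ∈ K, (g, k) ∈ p.sub := by
  constructor
  · rintro ⟨⟨g', h⟩, hh, rfl⟩
    exact ⟨h, hh.2, hh.1⟩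
  · rintro ⟨h, hK, hh⟩
    exact ⟨(g, h), ⟨hh, hK⟩, rfl⟩

/-- The condition `φ₂ = ψ₁` on `k₂(U) ∩ k₁(V)`, where `φ₂ h = φ(1, h)⁻¹` and `ψ₁ h = ψ(h, 1)`. -/
def Compat (p : FibPair A (G × H)) (q : FibPair A (H × K)) : Prop :=
  ∀ (h : H) (h₂ : ((1 : G), h) ∈ p.sub) (h₁ : (h, (1 : K)) ∈ q.sub),
    (p.chr ⟨(1, h), h₂⟩)⁻¹ = q.chr ⟨(h, 1), h₁⟩

theorem compat_iff (p : FibPair A (G × H)) (q : FibPair A (H × K)) :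
    Compat p q ↔ ∀ h a b, p.Rel (1, h) a → q.Rel (h, 1) b → a * b = 1 := by
  constructor
  · rintro hc h a b ⟨h1, rfl⟩ ⟨h2, rfl⟩
    rw [← hc h h1 h2]; simp
  · intro hc h h2 h1
    exact inv_eq_of_mul_eq_one_right (hc h _ _ (p.rel_chr h2) (q.rel_chr h1))

theorem compat_graph (p : FibPair A (G × H)) (f : K →* H) : Compat p (graph f) := by
  rw [compat_iff]
  rintro h a b h1 h2
  rw [rel_graph] at h2
  obtain ⟨h2, rfl⟩ := h2
  simp only [map_one] at h2
  subst h2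
  have := h1.unique ⟨p.sub.one_mem, p.chr.map_one⟩
  simpa using this

/-- The subgroup `U * V = {(g, k) | (g, h) ∈ U and (h, k) ∈ V for some h}`. -/
def starSub (U : Subgroup (G × H)) (V : Subgroup (H × K)) : Subgroup (G × K) where
  carrier := {x | ∃ h, (x.1, h) ∈ U ∧ (h, x.2) ∈ V}
  one_mem' := ⟨1, U.one_mem, V.one_mem⟩
  mul_mem' := by
    rintro x y ⟨h, h1, h2⟩ ⟨h', h1', h2'⟩
    exact ⟨h * h', U.mul_mem h1 h1', V.mul_mem h2 h2'⟩
  inv_mem' := by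
    rintro x ⟨h, h1, h2⟩
    exact ⟨h⁻¹, U.inv_mem h1, V.inv_mem h2⟩

theorem Compat.value_eq {p : FibPair A (G × H)} {q : FibPair A (H × K)} (hc : Compat p q)
    {g : G} {k : K} {h h' : H} {a b a' b' : A} (h1 : p.Rel (g, h) a) (h2 : q.Rel (h, k) b)
    (h1' : p.Rel (g, h') a') (h2' : q.Rel (h', k) b') : a * b = a' * b' := by
  have e1 := h1'.inv.mul h1
  have e2 := h2'.inv.mul h2
  simp only [Prod.inv_mk, Prod.mk_mul_mk, inv_mul_cancel] at e1 e2
  have := (compat_iff p q).1 hc _ _ _ e1 e2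
  have h3 : (a' * b')⁻¹ * (a * b) = 1 := by rw [← this]; rw [mul_inv]; exact mul_mul_mul_comm _ _ _ _
  exact (inv_mul_eq_one.1 h3).symm

/-- The pair `(U * V, φ * ψ)` with `(φ * ψ)(g, k) = φ(g, h) ψ(h, k)`, where `h` is chosen with
`(g, h) ∈ U` and `(h, k) ∈ V`. -/
noncomputable def star (p : FibPair A (G × H)) (q : FibPair A (H × K)) (hc : Compat p q) :
    FibPair A (G × K) where
  sub := starSub p.sub q.sub
  chr := MonoidHom.mk' (fun x => p.chr ⟨(x.1.1, x.2.choose), x.2.choose_spec.1⟩ *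
      q.chr ⟨(x.2.choose, x.1.2), x.2.choose_spec.2⟩) fun x y => by
    have hx1 := p.rel_chr x.2.choose_spec.1
    have hx2 := q.rel_chr x.2.choose_spec.2
    have hy1 := p.rel_chr y.2.choose_spec.1
    have hy2 := q.rel_chr y.2.choose_spec.2
    rw [mul_mul_mul_comm]
    exact hc.value_eq (p.rel_chr (x * y).2.choose_spec.1) (q.rel_chr (x * y).2.choose_spec.2)
      (hx1.mul hy1) (hx2.mul hy2)

theorem rel_star (p : FibPair A (G × H)) (q : FibPair A (H × K)) (hc : Compat p q) (x : G × K)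
    (a : A) :
    (p.star q hc).Rel x a ↔ ∃ h b c, p.Rel (x.1, h) b ∧ q.Rel (h, x.2) c ∧ a = b * c := by
  constructor
  · rintro ⟨h1, rfl⟩
    exact ⟨h1.choose, _, _, p.rel_chr h1.choose_spec.1, q.rel_chr h1.choose_spec.2, rfl⟩
  · rintro ⟨h, b, c, hb, hc', rfl⟩
    have hx : x ∈ (p.star q hc).sub := ⟨h, hb.1, hc'.1⟩
    exact ⟨hx, hc.value_eq (p.rel_chr hx.choose_spec.1) (q.rel_chr hx.choose_spec.2) hb hc'⟩

end FibPair

section Pairs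

variable {Ω A : Type u} [CommGroup A]

/-- The pair `(Δ(K), 1) ∈ M(H × K)` for a subgroup `K ≤ H`. -/
def FibPair.diagSub (A : Type u) [CommGroup A] (H : FinGroup Ω) (K : Subgroup H) :
    FibPair A (H × H.sub K) := FibPair.graph (H.incl K)

theorem FibPair.compat_diagSub {G : Type u} [Group G] {H : FinGroup Ω} (p : FibPair A (G × H))
    (K : Subgroup H) : FibPair.Compat p (FibPair.diagSub A H K) := FibPair.compat_graph p _

/-- A pair in `M(G × H)`, restricted to `M(P × H)` for a subgroup `P ≤ G`.  If `P` contains the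
projection of the pair, this is the same pair, regarded as an element of `M(P × H)`. -/
def FibPair.restrictLeft {G H : FinGroup Ω} (p : FibPair A (G × H)) (P : Subgroup G) :
    FibPair A (G.sub P × H) := p.comap ((G.incl P).prodMap (MonoidHom.id H))

theorem FibPair.rel_restrictLeft {G H : FinGroup Ω} (p : FibPair A (G × H)) (P : Subgroup G)
    (x : G.sub P × H) (a : A) : (p.restrictLeft P).Rel x a ↔ p.Rel (G.incl P x.1, x.2) a := Iff.rfl

/-- The pair `(U, φ) * (Δ(K), 1) ∈ M(G × K)` for a subgroup `K ≤ H`. -/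
noncomputable def FibPair.starDiag {G H : FinGroup Ω} (p : FibPair A (G × H)) (K : Subgroup H) :
    FibPair A (G × H.sub K) := p.star (FibPair.diagSub A H K) (FibPair.compat_diagSub p K)

theorem FibPair.rel_starDiag {G H : FinGroup Ω} (p : FibPair A (G × H)) (K : Subgroup H)
    (x : G × H.sub K) (a : A) : (p.starDiag K).Rel x a ↔ p.Rel (x.1, H.incl K x.2) a := by
  rw [starDiag, rel_star]
  constructor
  · rintro ⟨h, b, c, h1, h2, rfl⟩
    obtain ⟨h3, rfl⟩ := (rel_graph _ _ _).1 h2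
    simp only at h3
    subst h3
    simpa using h1
  · intro h
    exact ⟨_, a, 1, h, (rel_graph _ _ _).2 ⟨rfl, rfl⟩, by simp⟩

/-! ### The data `(𝒢, 𝒮)` -/

/-- Data `(𝒢, 𝒮)`: a class `𝒢` of finite groups and subsets `𝒮(G, H) ⊆ M(G × H)`.  Only the sets
`𝒮(G, H)` with `G, H ∈ 𝒢` are ever used. -/
structure Datum (Ω A : Type u) [CommGroup A] where
  𝒢 : FinGroup Ω → Prop
  𝒮 : ∀ G H : FinGroup Ω, Set (FibPair A (G × H))

/-- The axioms under which `(𝒢, 𝒮)` defines a category: `(Δ(G), 1) ∈ 𝒮(G, G)`, each `𝒮(G, H)` is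
closed under conjugation, and `(U, φ) * (V, ψ) ∈ 𝒮(G, K)` for all `(U, φ) ∈ 𝒮(G, H)` and
`(V, ψ) ∈ 𝒮(H, K)` for which this product is defined. -/
class Datum.IsCategorical (D : Datum Ω A) : Prop where
  diag_mem : ∀ G, D.𝒢 G → FibPair.diag A G ∈ D.𝒮 G G
  conj_mem : ∀ G H, D.𝒢 G → D.𝒢 H → ∀ p ∈ D.𝒮 G H, ∀ x : G × H, p.conj x ∈ D.𝒮 G H
  star_mem : ∀ G H K, D.𝒢 G → D.𝒢 H → D.𝒢 K → ∀ p ∈ D.𝒮 G H, ∀ q ∈ D.𝒮 H K,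
    ∀ hc : FibPair.Compat p q, p.star q hc ∈ D.𝒮 G K

/-- The additional axiom for the lower plus construction: for all `(U, φ) ∈ 𝒮(G, H)` and all
subgroups `K` of `H` that belong to `𝒢`, the group `U * K` belongs to `𝒢` and
`(U, φ) * (Δ(K), 1)`, regarded as an element of `M((U * K) × K)`, is in `𝒮(U * K, K)`. -/
class Datum.IsPlusCategorical (D : Datum Ω A) : Prop extends D.IsCategorical where
  restrict_mem : ∀ G H, D.𝒢 G → D.𝒢 H → ∀ p ∈ D.𝒮 G H, ∀ K : Subgroup H, D.𝒢 (H.sub K) →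
    D.𝒢 (G.sub (p.starSubgroup K)) ∧
      (p.starDiag K).restrictLeft (p.starSubgroup K) ∈
        D.𝒮 (G.sub (p.starSubgroup K)) (H.sub K)

/-- The data `(𝒢, 𝒮₊)`: a pair `(U, φ) ∈ M(G × H)` lies in `𝒮₊(G, H)` iff `p₁(U) ∈ 𝒢` and
`(U, φ) ∈ 𝒮(p₁(U), H)`. -/
def Datum.plus (D : Datum Ω A) : Datum Ω A where
  𝒢 := D.𝒢
  𝒮 G H := {p | D.𝒢 (G.sub p.p₁) ∧ p.restrictLeft p.p₁ ∈ D.𝒮 (G.sub p.p₁) H}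

/-- Transport of membership along an equality of subgroups of a fixed group. -/
theorem Datum.mem_of_eq (D : Datum Ω A) {L L' M G : FinGroup Ω} (f : L →* G) (f' : L' →* G)
    (hf : ∀ x, (f x : Ω) = x) (hf' : ∀ x, (f' x : Ω) = x) (h : L.carrier = L'.carrier)
    (hL : D.𝒢 L) (p : FibPair A (L × M)) (hp : p ∈ D.𝒮 L M) (p' : FibPair A (L' × M))
    (hpp : ∀ (x : L) (x' : L') (y : M) (a : A), (x : Ω) = x' → (p.Rel (x, y) a ↔ p'.Rel (x', y) a)) :
    D.𝒢 L' ∧ p' ∈ D.𝒮 L' M := by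
  obtain rfl := FinGroup.eq_of_carrier_eq f f' hf hf' h
  obtain rfl : p = p' := FibPair.ext_rel fun x a => hpp x.1 x.1 x.2 a rfl
  exact ⟨hL, hp⟩

/-- For a group `G` in `𝒢` and a subgroup `P ∈ 𝒢` of `G`, the conjugate of `P` by `g` is in `𝒢`, and
conjugation by `g` gives an element of `𝒮`. -/
theorem Datum.IsPlusCategorical.conjIso_mem {D : Datum Ω A} (hD : D.IsPlusCategorical)
    {G : FinGroup Ω} (hG : D.𝒢 G) (P Q : Subgroup G) (hP : D.𝒢 (G.sub P)) (g : G)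
    (hQ : ∀ x, x ∈ Q ↔ g⁻¹ * x * g ∈ P) (p : FibPair A (G.sub Q × G.sub P))
    (hp : ∀ x a, p.Rel x a ↔ (g⁻¹ * G.incl Q x.1 * g = G.incl P x.2) ∧ a = 1) :
    D.𝒢 (G.sub Q) ∧ p ∈ D.𝒮 (G.sub Q) (G.sub P) := by
  have h1 := hD.conj_mem G G hG hG _ (hD.diag_mem G hG) (g, 1)
  have h2 := hD.restrict_mem G G hG hG _ h1 P hP
  have key : ∀ (x y : G) (a : A), ((FibPair.diag A G).conj (g, 1)).Rel (x, y) a ↔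
      g⁻¹ * x * g = y ∧ a = 1 := by
    intro x y a
    rw [FibPair.rel_conj, FibPair.diag, FibPair.rel_graph]
    simp only [Prod.inv_mk, Prod.mk_mul_mk, inv_one, one_mul, mul_one, MonoidHom.id_apply]
    rw [eq_comm]
  refine D.mem_of_eq (G.incl _) (G.incl Q) (G.incl_val _) (G.incl_val _) ?_ h2.1 _ h2.2 p ?_
  · have : ((FibPair.diag A G).conj (g, 1)).starSubgroup P = Q := by
      ext x
      rw [FibPair.mem_starSubgroup, hQ]
      constructor
      · rintro ⟨k, hk, hx⟩
        rw [((key x k _).1 ⟨hx, rfl⟩).1]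
        exact hk
      · intro hx
        exact ⟨_, hx, ((key x _ 1).2 ⟨rfl, rfl⟩).1⟩
    rw [this]
  · intro x x' y a hxx
    rw [FibPair.rel_restrictLeft, FibPair.rel_starDiag, hp, key]
    have : G.incl (((FibPair.diag A G).conj (g, 1)).starSubgroup P) x = G.incl Q x' :=
      Subtype.ext hxx
    rw [this]

instance Datum.IsPlusCategorical.plus {D : Datum Ω A} [hD : D.IsPlusCategorical] :
    D.plus.IsCategorical where
  diag_mem G hG := by
    have h := hD.diag_mem G hG
    refine D.mem_of_eq (MonoidHom.id G) (G.incl _) (fun _ => rfl) (G.incl_val _) ?_ hG _ h _ ?_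
    · ext x
      constructor
      · intro hx
        exact ⟨hx, (FibPair.mem_p₁ _ _).2 ⟨⟨x, hx⟩, ⟨⟨x, hx⟩, rfl⟩⟩⟩
      · rintro ⟨hx, _⟩
        exact hx
    · intro x x' y a hxx
      rw [FibPair.rel_restrictLeft]
      have : G.incl (FibPair.diag A G).p₁ x' = x := Subtype.ext hxx.symm
      rw [this]
  conj_mem := by
    rintro G H hG hH p ⟨hp1, hp2⟩ ⟨g, h⟩
    have h1 := hD.conj_mem _ _ hp1 hH _ hp2 (1, h)
    have hQ : ∀ x, x ∈ (p.conj (g, h)).p₁ ↔ g⁻¹ * x * g ∈ p.p₁ := by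
      intro x
      rw [FibPair.mem_p₁, FibPair.mem_p₁]
      constructor
      · rintro ⟨y, hy⟩
        have := ((FibPair.rel_conj _ _ _ _).1 ((p.conj (g, h)).rel_chr hy)).1
        exact ⟨_, this⟩
      · rintro ⟨y, hy⟩
        refine ⟨h * y * h⁻¹, ((FibPair.rel_conj _ _ _ (p.chr ⟨_, hy⟩)).2 ⟨?_, ?_⟩).1⟩
        · simp only [Prod.inv_mk, Prod.mk_mul_mk]
          convert! hy using 2
          group
        · congr 2
          simp only [Prod.inv_mk, Prod.mk_mul_mk]
          congr 1
          group
    let c : FibPair A (G.sub (p.conj (g, h)).p₁ × G.sub p.p₁) :=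
      (((FibPair.diag A G).conj (g, 1)).comap ((G.incl _).prodMap (G.incl _)))
    have hc : ∀ x a, c.Rel x a ↔ (g⁻¹ * G.incl _ x.1 * g = G.incl _ x.2) ∧ a = 1 := by
      intro x a
      rw [FibPair.rel_comap, FibPair.rel_conj, FibPair.diag, FibPair.rel_graph]
      simp only [MonoidHom.prodMap_def, MonoidHom.prod_apply, MonoidHom.comp_apply,
        MonoidHom.coe_fst, MonoidHom.coe_snd, Prod.inv_mk, Prod.mk_mul_mk, inv_one, one_mul,
        mul_one, MonoidHom.id_apply]
      generalize G.incl _ x.1 = a1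
      generalize G.incl _ x.2 = a2
      constructor
      · rintro ⟨h, rfl⟩
        exact ⟨by rw [← h], rfl⟩
      · rintro ⟨rfl, rfl⟩
        exact ⟨by group, rfl⟩
    obtain ⟨h2, h3⟩ := hD.conjIso_mem hG p.p₁ (p.conj (g, h)).p₁ hp1 g hQ c hc
    refine ⟨h2, ?_⟩
    have hcomp : FibPair.Compat c ((p.restrictLeft p.p₁).conj (1, h)) := by
      rw [FibPair.compat_iff]
      intro y a b ha hb
      obtain ⟨e1, rfl⟩ := (hc _ _).1 ha
      have : y = 1 := by
        apply G.incl_injective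
        rw [← e1]
        simp
      subst this
      have := hb.unique ⟨one_mem _, map_one _⟩
      simpa using this
    have h4 := hD.star_mem _ _ _ h2 hp1 hH _ h3 _ h1 hcomp
    convert! h4 using 1
    apply FibPair.ext_rel
    rintro ⟨x, y⟩ a
    rw [FibPair.rel_star, FibPair.rel_restrictLeft, FibPair.rel_conj]
    constructor
    · intro hr
      have hm : g⁻¹ * G.incl _ x * g ∈ p.p₁ := (hQ _).1 (G.incl_mem _ x)
      refine ⟨G.toSub _ hm, 1, a, (hc _ _).2 ⟨rfl, rfl⟩, ?_, by simp⟩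
      rw [FibPair.rel_conj, FibPair.rel_restrictLeft]
      simpa using hr
    · rintro ⟨z, b, d, h5, h6, rfl⟩
      obtain ⟨e1, rfl⟩ := (hc _ _).1 h5
      rw [FibPair.rel_conj, FibPair.rel_restrictLeft] at h6
      simp only [Prod.inv_mk, Prod.mk_mul_mk, inv_one, one_mul, mul_one] at h6 ⊢ e1
      rw [e1]
      exact h6
  star_mem := by
    rintro G H K hG hH hK p ⟨hp1, hp2⟩ q ⟨hq1, hq2⟩ hc
    obtain ⟨h1, h2⟩ := hD.restrict_mem _ _ hp1 hH _ hp2 q.p₁ hq1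
    have hcomp : FibPair.Compat (((p.restrictLeft p.p₁).starDiag q.p₁).restrictLeft
        ((p.restrictLeft p.p₁).starSubgroup q.p₁)) (q.restrictLeft q.p₁) := by
      rw [FibPair.compat_iff]
      intro y a b ha hb
      rw [FibPair.rel_restrictLeft, FibPair.rel_starDiag, FibPair.rel_restrictLeft] at ha
      rw [FibPair.rel_restrictLeft] at hb
      exact (FibPair.compat_iff _ _).1 hc _ _ _ ha hb
    have h3 := hD.star_mem _ _ _ h1 hq1 hK _ h2 _ hq2 hcomp
    refine D.mem_of_eq ((G.incl _).comp ((G.sub p.p₁).incl _)) (G.incl (p.star q hc).p₁)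
      (fun _ => rfl) (fun _ => rfl) ?_ h1 _ h3 _ ?_
    · ext x
      constructor
      · rintro ⟨⟨hx, hx1⟩, hx2⟩
        refine ⟨hx, ?_⟩
        rw [FibPair.mem_starSubgroup] at hx2
        obtain ⟨k, hk, hx2⟩ := hx2
        rw [FibPair.mem_p₁] at hk ⊢
        obtain ⟨l, hl⟩ := hk
        exact ⟨l, k, hx2, hl⟩
      · rintro ⟨hx, hx1⟩
        rw [FibPair.mem_p₁] at hx1
        obtain ⟨l, k, hk, hl⟩ := hx1
        refine ⟨⟨hx, (FibPair.mem_p₁ _ _).2 ⟨k, hk⟩⟩, ?_⟩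
        rw [FibPair.mem_starSubgroup]
        exact ⟨k, (FibPair.mem_p₁ _ _).2 ⟨l, hl⟩, hk⟩
    · intro x x' y a hxx
      have e : G.incl p.p₁ ((G.sub p.p₁).incl _ x) = G.incl (p.star q hc).p₁ x' := Subtype.ext hxx
      rw [FibPair.rel_restrictLeft, FibPair.rel_star, FibPair.rel_star]
      constructor
      · rintro ⟨z, b, c, hb, hc, rfl⟩
        rw [FibPair.rel_restrictLeft, FibPair.rel_starDiag, FibPair.rel_restrictLeft] at hb
        rw [FibPair.rel_restrictLeft] at hc
        refine ⟨_, b, c, ?_, hc, rfl⟩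
        rw [← e]
        exact hb
      · rintro ⟨z, b, c, hb, hc, rfl⟩
        have hz : z ∈ q.p₁ := (FibPair.mem_p₁ _ _).2 ⟨y, hc.1⟩
        refine ⟨H.toSub z hz, b, c, ?_, hc, rfl⟩
        rw [FibPair.rel_restrictLeft, FibPair.rel_starDiag, FibPair.rel_restrictLeft]
        simp only [FinGroup.incl_toSub]
        rw [e]
        exact hb

end Pairs
/-! ### `A`-fibered `Γ`-sets -/

/-- An `A`-fibered `Γ`-set: a set with commuting actions of `Γ` and `A` (that is, a
`Γ × A`-set) on which `A` acts freely with finitely many orbits.  An `A`-fibered `(G, H)`-biset is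
an `A`-fibered `G × H`-set, where `g u h := (g, h⁻¹) • u`. -/
structure FSet (A Γ : Type u) [CommGroup A] [Group Γ] where
  carrier : Type u
  [actΓ : MulAction Γ carrier]
  [actA : MulAction A carrier]
  [comm : SMulCommClass Γ A carrier]
  [fin : Finite (MulAction.orbitRel.Quotient A carrier)]
  free : ∀ (a b : A) (x : carrier), a • x = b • x → a = b

attribute [instance] FSet.actΓ FSet.actA FSet.comm FSet.fin

instance {A Γ : Type u} [CommGroup A] [Group Γ] : CoeSort (FSet A Γ) (Type u) :=
  ⟨fun X => X.carrier⟩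

namespace FSet

section Basic

variable {A Γ : Type u} [CommGroup A] [Group Γ]

/-- Morphisms of `A`-fibered `Γ`-sets: equivariant maps. -/
@[ext] structure Hom (X Y : FSet A Γ) where
  toFun : X → Y
  map_smul : ∀ (γ : Γ) (x : X), toFun (γ • x) = γ • toFun x
  map_smulA : ∀ (a : A) (x : X), toFun (a • x) = a • toFun x

instance : Category (FSet A Γ) where
  Hom := Hom
  id X := ⟨id, fun _ _ => rfl, fun _ _ => rfl⟩
  comp f g := ⟨g.toFun ∘ f.toFun, fun γ x => by simp [f.map_smul, g.map_smul],
    fun a x => by simp [f.map_smulA, g.map_smulA]⟩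

/-- An equivariant bijection is an isomorphism. -/
def isoOf {X Y : FSet A Γ} (e : X ≃ Y) (h : ∀ (γ : Γ) (x : X), e (γ • x) = γ • e x)
    (h' : ∀ (a : A) (x : X), e (a • x) = a • e x) : X ≅ Y where
  hom := ⟨e, h, h'⟩
  inv := ⟨e.symm, fun γ y => e.injective (by simp [h]), fun a y => e.injective (by simp [h'])⟩
  hom_inv_id := Hom.ext (by funext x; exact e.symm_apply_apply x)
  inv_hom_id := Hom.ext (by funext x; exact e.apply_symm_apply x)

theorem nonempty_iso_of_bijective {X Y : FSet A Γ} (f : X → Y) (hf : Function.Bijective f)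
    (h : ∀ (γ : Γ) (x : X), f (γ • x) = γ • f x) (h' : ∀ (a : A) (x : X), f (a • x) = a • f x) :
    Nonempty (X ≅ Y) := ⟨isoOf (Equiv.ofBijective f hf) h h'⟩

def isoEquiv {X Y : FSet A Γ} (e : X ≅ Y) : X ≃ Y where
  toFun := e.hom.toFun
  invFun := e.inv.toFun
  left_inv x := congrFun (congrArg Hom.toFun e.hom_inv_id) x
  right_inv x := congrFun (congrArg Hom.toFun e.inv_hom_id) x

theorem smul_commA (X : FSet A Γ) (γ : Γ) (a : A) (x : X) : γ • a • x = a • γ • x :=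
  smul_comm γ a x

/-- The stabilizing pair `(Γ_x, φ_x)` of `x`: `Γ_x` is the stabilizer of the `A`-orbit of `x`, and
`γ x = φ_x(γ) x` for `γ ∈ Γ_x`. -/
noncomputable def stab (X : FSet A Γ) (x : X) : FibPair A Γ where
  sub :=
    { carrier := {γ | ∃ a : A, γ • x = a • x}
      one_mem' := ⟨1, by simp⟩
      mul_mem' := by
        rintro γ δ ⟨a, ha⟩ ⟨b, hb⟩
        exact ⟨b * a, by rw [mul_smul, hb, smul_comm, ha, mul_smul]⟩
      inv_mem' := by
        rintro γ ⟨a, ha⟩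
        refine ⟨a⁻¹, ?_⟩
        rw [inv_smul_eq_iff, smul_comm, ha, inv_smul_smul] }
  chr := MonoidHom.mk' (fun γ => γ.2.choose) fun γ δ => by
    apply X.free _ _ x
    rw [← (γ * δ).2.choose_spec, mul_comm, mul_smul, ← γ.2.choose_spec, Subgroup.coe_mul, mul_smul,
      ← smul_comm (γ : Γ), ← δ.2.choose_spec]

theorem rel_stab (X : FSet A Γ) (x : X) (γ : Γ) (a : A) : (X.stab x).Rel γ a ↔ γ • x = a • x := by
  constructor
  · rintro ⟨h, rfl⟩
    exact h.choose_spec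
  · intro h
    have hγ : γ ∈ (X.stab x).sub := ⟨a, h⟩
    exact ⟨hγ, X.free _ _ x (by rw [← h]; exact hγ.choose_spec.symm)⟩

theorem mem_stab (X : FSet A Γ) (x : X) (γ : Γ) : γ ∈ (X.stab x).sub ↔ ∃ a : A, γ • x = a • x :=
  Iff.rfl

/-- The stabilizer `Γ_x` of the `A`-orbit of `x`. -/
noncomputable abbrev stabilizer (X : FSet A Γ) (x : X) : Subgroup Γ := (X.stab x).sub

theorem mem_stabilizer_smul (X : FSet A Γ) (x : X) (γ : Γ) (a : A) (δ : Γ) :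
    δ ∈ X.stabilizer (γ • a • x) ↔ γ⁻¹ * δ * γ ∈ X.stabilizer x := by
  rw [mem_stab, mem_stab]
  refine exists_congr fun b => ?_
  rw [mul_smul, mul_smul, inv_smul_eq_iff, smul_comm γ a x, smul_comm δ a, smul_comm b a,
    smul_comm γ b]
  exact (MulAction.injective a).eq_iff

/-- The disjoint union. -/
def sum (X Y : FSet A Γ) : FSet A Γ where
  carrier := X.carrier ⊕ Y.carrier
  fin := Finite.of_surjective
    (Sum.elim
      (Quotient.map (sa := MulAction.orbitRel A X) (sb := MulAction.orbitRel A (X.carrier ⊕ Y.carrier))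
        Sum.inl (by rintro _ x ⟨a, rfl⟩; exact ⟨a, rfl⟩))
      (Quotient.map (sa := MulAction.orbitRel A Y) (sb := MulAction.orbitRel A (X.carrier ⊕ Y.carrier))
        Sum.inr (by rintro _ x ⟨a, rfl⟩; exact ⟨a, rfl⟩)))
    (by
      rintro ⟨x | y⟩
      · exact ⟨Sum.inl (Quotient.mk _ x), rfl⟩
      · exact ⟨Sum.inr (Quotient.mk _ y), rfl⟩)
  free := by
    rintro a b (x | y) h
    · exact X.free a b x (Sum.inl_injective h)
    · exact Y.free a b y (Sum.inr_injective h)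

/-- The inclusion of the left summand. -/
def inl (X Y : FSet A Γ) (x : X) : X.sum Y := show X.carrier ⊕ Y.carrier from Sum.inl x

/-- The inclusion of the right summand. -/
def inr (X Y : FSet A Γ) (y : Y) : X.sum Y := show X.carrier ⊕ Y.carrier from Sum.inr y

theorem inl_injective (X Y : FSet A Γ) : Function.Injective (inl X Y) := Sum.inl_injective

theorem inr_injective (X Y : FSet A Γ) : Function.Injective (inr X Y) := Sum.inr_injective

theorem inl_ne_inr (X Y : FSet A Γ) (x : X) (y : Y) : inl X Y x ≠ inr X Y y := Sum.inl_ne_inr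

theorem sum_cases (X Y : FSet A Γ) (z : X.sum Y) : (∃ x, z = inl X Y x) ∨ ∃ y, z = inr X Y y := by
  rcases z with x | y
  · exact Or.inl ⟨x, rfl⟩
  · exact Or.inr ⟨y, rfl⟩

theorem smul_inl (X Y : FSet A Γ) (γ : Γ) (x : X) : γ • inl X Y x = inl X Y (γ • x) := rfl
theorem smul_inr (X Y : FSet A Γ) (γ : Γ) (x : Y) : γ • inr X Y x = inr X Y (γ • x) := rfl
theorem smulA_inl (X Y : FSet A Γ) (a : A) (x : X) : a • inl X Y x = inl X Y (a • x) := rfl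
theorem smulA_inr (X Y : FSet A Γ) (a : A) (x : Y) : a • inr X Y x = inr X Y (a • x) := rfl

theorem stab_inl (X Y : FSet A Γ) (x : X) : (X.sum Y).stab (inl X Y x) = X.stab x := by
  apply FibPair.ext_rel
  intro γ a
  rw [rel_stab, rel_stab, smul_inl, smulA_inl, (inl_injective X Y).eq_iff]

theorem stab_inr (X Y : FSet A Γ) (y : Y) : (X.sum Y).stab (inr X Y y) = Y.stab y := by
  apply FibPair.ext_rel
  intro γ a
  rw [rel_stab, rel_stab, smul_inr, smulA_inr, (inr_injective X Y).eq_iff]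

/-- The empty `A`-fibered `Γ`-set. -/
def empty (A Γ : Type u) [CommGroup A] [Group Γ] : FSet A Γ where
  carrier := PEmpty
  actΓ := { smul := fun _ => id, one_smul := fun _ => rfl, mul_smul := fun _ _ _ => rfl }
  actA := { smul := fun _ => id, one_smul := fun _ => rfl, mul_smul := fun _ _ _ => rfl }
  comm := @SMulCommClass.mk _ _ _ (_) (_) fun _ _ x => x.elim
  fin := Finite.of_surjective (Quotient.mk _) Quotient.mk_surjective
  free := fun _ _ x => x.elim

def sumCongr {X X' Y Y' : FSet A Γ} (e : X ≅ X') (f : Y ≅ Y') : X.sum Y ≅ X'.sum Y' :=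
  isoOf (Equiv.sumCongr (isoEquiv e) (isoEquiv f))
    (by
      rintro γ (x | y)
      · exact congrArg Sum.inl (e.hom.map_smul γ x)
      · exact congrArg Sum.inr (f.hom.map_smul γ y))
    (by
      rintro γ (x | y)
      · exact congrArg Sum.inl (e.hom.map_smulA γ x)
      · exact congrArg Sum.inr (f.hom.map_smulA γ y))

theorem orbit_finite_of_invariant (X : FSet A Γ) (O : Set X) (hA : ∀ (a : A) x, x ∈ O → a • x ∈ O) :
    letI : MulAction A O :=
      { smul := fun a x => ⟨a • x.1, hA a x.1 x.2⟩
        one_smul := fun _ => Subtype.ext (one_smul _ _)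
        mul_smul := fun _ _ _ => Subtype.ext (mul_smul _ _ _) }
    Finite (MulAction.orbitRel.Quotient A O) := by
  let _ : MulAction A O :=
      { smul := fun a x => ⟨a • x.1, hA a x.1 x.2⟩
        one_smul := fun _ => Subtype.ext (one_smul _ _)
        mul_smul := fun _ _ _ => Subtype.ext (mul_smul _ _ _) }
  refine Finite.of_injective (β := MulAction.orbitRel.Quotient A X)
    (Quotient.map (sa := MulAction.orbitRel A O) (sb := MulAction.orbitRel A X)
        Subtype.val (by rintro _ x ⟨a, rfl⟩; exact ⟨a, rfl⟩)) ?_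
  rintro ⟨x⟩ ⟨y⟩ h
  obtain ⟨a, ha⟩ := Quotient.exact h
  exact Quotient.sound ⟨a, Subtype.ext ha⟩

/-- The restriction to an invariant subset. -/
def subset (X : FSet A Γ) (O : Set X) (hΓ : ∀ (γ : Γ) x, x ∈ O → γ • x ∈ O)
    (hA : ∀ (a : A) x, x ∈ O → a • x ∈ O) : FSet A Γ where
  carrier := O
  actΓ :=
    { smul := fun a x => ⟨a • x.1, hΓ a x.1 x.2⟩
      one_smul := fun _ => Subtype.ext (one_smul _ _)
      mul_smul := fun _ _ _ => Subtype.ext (mul_smul _ _ _) }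
  actA :=
    { smul := fun a x => ⟨a • x.1, hA a x.1 x.2⟩
      one_smul := fun _ => Subtype.ext (one_smul _ _)
      mul_smul := fun _ _ _ => Subtype.ext (mul_smul _ _ _) }
  comm := @SMulCommClass.mk _ _ _ (_) (_) fun _ _ _ => Subtype.ext (smul_comm _ _ _)
  fin := X.orbit_finite_of_invariant O hA
  free := fun a b x h => X.free a b x.1 (congrArg Subtype.val h)

/-- The subgroup `{(k, φ(k)⁻¹) | k ∈ U}` of `Γ × A`. -/
def _root_.FiberedBiset.FibPair.antigraph (p : FibPair A Γ) : Subgroup (Γ × A) where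
  carrier := {x | p.Rel x.1 x.2⁻¹}
  one_mem' := by simpa using ⟨p.sub.one_mem, p.chr.map_one⟩
  mul_mem' := by
    intro x y hx hy
    have := FibPair.Rel.mul hx hy
    rwa [← mul_inv] at this
  inv_mem' := by
    intro x hx
    exact FibPair.Rel.inv hx

theorem _root_.FiberedBiset.FibPair.mem_antigraph (p : FibPair A Γ) (x : Γ × A) :
    x ∈ p.antigraph ↔ p.Rel x.1 x.2⁻¹ := Iff.rfl

/-- The transitive `A`-fibered `Γ`-set `Γ / (U, φ) = (Γ × A) / {(k, φ(k)⁻¹) | k ∈ U}`. -/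
def transitive [Finite Γ] (p : FibPair A Γ) : FSet A Γ where
  carrier := (Γ × A) ⧸ p.antigraph
  actΓ := MulAction.compHom _ (MonoidHom.inl Γ A)
  actA := MulAction.compHom _ (MonoidHom.inr Γ A)
  comm := @SMulCommClass.mk _ _ _ (_) (_) <| by
    rintro γ a ⟨x⟩
    change (((γ, 1) * ((1, a) * x) : Γ × A) : (Γ × A) ⧸ p.antigraph) =
      (((1, a) * ((γ, 1) * x) : Γ × A) : (Γ × A) ⧸ p.antigraph)
    congr 1
    rw [← mul_assoc, ← mul_assoc]
    simp
  fin := by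
    let _ : MulAction A ((Γ × A) ⧸ p.antigraph) := MulAction.compHom _ (MonoidHom.inr Γ A)
    refine Finite.of_surjective (fun γ : Γ => (Quotient.mk (MulAction.orbitRel A _)
      (((γ, 1) : Γ × A) : (Γ × A) ⧸ p.antigraph))) ?_
    rintro ⟨⟨γ, a⟩⟩
    refine ⟨γ, Quotient.sound ⟨a⁻¹, ?_⟩⟩
    change (((1, a⁻¹) * (γ, a) : Γ × A) : (Γ × A) ⧸ p.antigraph) = _
    simp
  free := by
    rintro a b ⟨x⟩ h
    have h1 := QuotientGroup.eq.1 (show (((1, a) * x : Γ × A) : (Γ × A) ⧸ p.antigraph) =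
      (((1, b) * x : Γ × A) : (Γ × A) ⧸ p.antigraph) from h)
    rw [FibPair.mem_antigraph] at h1
    have h2 : p.Rel 1 1 := ⟨p.sub.one_mem, p.chr.map_one⟩
    have h3 := h1.unique (a := _) (b := 1) (by simpa using h2)
    simp only [mul_inv_rev, Prod.inv_mk, Prod.snd_mul, Prod.snd_inv] at h3
    have : b⁻¹ * a = 1 := by
      rw [← h3]
      rw [inv_inv, inv_inv, mul_comm a, mul_comm x.2⁻¹, mul_assoc, inv_mul_cancel_left]
    exact (inv_mul_eq_one.1 this).symm

/-- The coset of the element `(γ, a)`. -/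
def tmk [Finite Γ] (p : FibPair A Γ) (γ : Γ) (a : A) : transitive p :=
  show (Γ × A) ⧸ p.antigraph from QuotientGroup.mk (γ, a)

theorem smul_tmk [Finite Γ] (p : FibPair A Γ) (γ δ : Γ) (a : A) :
    γ • tmk p δ a = tmk p (γ * δ) a := by
  change (((γ, 1) * (δ, a) : Γ × A) : (Γ × A) ⧸ p.antigraph) = _
  simp; rfl

theorem smulA_tmk [Finite Γ] (p : FibPair A Γ) (δ : Γ) (a b : A) :
    b • tmk p δ a = tmk p δ (b * a) := by
  change (((1, b) * (δ, a) : Γ × A) : (Γ × A) ⧸ p.antigraph) = _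
  simp; rfl

theorem tmk_eq_iff [Finite Γ] (p : FibPair A Γ) (γ δ : Γ) (a b : A) :
    tmk p γ a = tmk p δ b ↔ p.Rel (γ⁻¹ * δ) (a * b⁻¹) := by
  refine (QuotientGroup.eq (s := p.antigraph) (a := (γ, a)) (b := (δ, b))).trans ?_
  rw [FibPair.mem_antigraph]
  simp [mul_comm]

theorem exists_tmk [Finite Γ] (p : FibPair A Γ) (z : transitive p) : ∃ γ a, z = tmk p γ a := by
  obtain ⟨⟨γ, a⟩⟩ := z
  exact ⟨γ, a, rfl⟩

theorem stab_tmk [Finite Γ] (p : FibPair A Γ) (γ : Γ) (a : A) :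
    (transitive p).stab (tmk p γ a) = p.conj γ := by
  apply FibPair.ext_rel
  intro x b
  rw [rel_stab, smul_tmk, smulA_tmk, tmk_eq_iff, FibPair.rel_conj]
  have : ∀ c d, p.Rel c d ↔ p.Rel c⁻¹ d⁻¹ := fun c d =>
    ⟨FibPair.Rel.inv, fun h => by simpa using h.inv⟩
  rw [this]
  simp [mul_assoc]

/-- A fibered set on which `Γ × A` acts transitively is isomorphic to `Γ / (Γ_x, φ_x)`. -/
theorem nonempty_iso_transitive [Finite Γ] (X : FSet A Γ) (x : X)
    (h : ∀ y : X, ∃ (γ : Γ) (a : A), y = γ • a • x) :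
    Nonempty (transitive (X.stab x) ≅ X) := by
  let f : transitive (X.stab x) → X := Quotient.lift (fun z : Γ × A => z.1 • z.2 • x) (by
    rintro ⟨γ, a⟩ ⟨δ, b⟩ hz
    have h1 := (tmk_eq_iff (X.stab x) γ δ a b).1 (Quotient.sound hz)
    rw [rel_stab] at h1
    rw [mul_smul, inv_smul_eq_iff, mul_comm, mul_smul] at h1
    change γ • a • x = δ • b • x
    have h2 := congrArg (b • ·) h1
    simp only [smul_comm γ, smul_inv_smul] at h2
    rw [smul_comm γ, smul_comm δ, ← h2])
  have hf : ∀ γ a, f (tmk _ γ a) = γ • a • x := fun _ _ => rfl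
  refine nonempty_iso_of_bijective f ⟨?_, ?_⟩ ?_ ?_
  · intro y z hyz
    obtain ⟨γ, a, rfl⟩ := exists_tmk _ y
    obtain ⟨δ, b, rfl⟩ := exists_tmk _ z
    rw [hf, hf] at hyz
    rw [tmk_eq_iff, rel_stab, mul_smul, inv_smul_eq_iff, mul_comm a, mul_smul, smul_comm γ, hyz,
      smul_comm δ b, inv_smul_smul]
  · intro y
    obtain ⟨γ, a, rfl⟩ := h y
    exact ⟨tmk _ γ a, rfl⟩
  · intro γ y
    obtain ⟨δ, b, rfl⟩ := exists_tmk _ y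
    rw [smul_tmk, hf, hf, mul_smul]
  · intro a y
    obtain ⟨δ, b, rfl⟩ := exists_tmk _ y
    rw [smulA_tmk, hf, hf, mul_smul, ← smul_comm δ a]

end Basic

end FSet

/-! ### Isomorphism classes and the Grothendieck group -/

/-- Isomorphism classes of `A`-fibered `Γ`-sets. -/
def FClass (A Γ : Type u) [CommGroup A] [Group Γ] : Type (u + 1) :=
  Quotient (isIsomorphicSetoid (FSet A Γ))

section Classes

variable {A Γ : Type u} [CommGroup A] [Group Γ]

/-- The isomorphism class of `X`. -/
def FClass.mk (X : FSet A Γ) : FClass A Γ := Quotient.mk (isIsomorphicSetoid (FSet A Γ)) X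

theorem FClass.sound {X Y : FSet A Γ} (h : Nonempty (X ≅ Y)) : FClass.mk X = FClass.mk Y :=
  Quotient.sound h

theorem FClass.exists_mk (x : FClass A Γ) : ∃ X, x = FClass.mk X := by
  obtain ⟨X⟩ := x
  exact ⟨X, rfl⟩

/-- Addition is induced by disjoint union. -/
instance : Add (FClass A Γ) := ⟨Quotient.map₂ FSet.sum (by
  rintro X X' ⟨e⟩ Y Y' ⟨f⟩
  exact ⟨FSet.sumCongr e f⟩)⟩

instance : Zero (FClass A Γ) := ⟨FClass.mk (FSet.empty A Γ)⟩

theorem FClass.mk_add (X Y : FSet A Γ) : FClass.mk X + FClass.mk Y = FClass.mk (X.sum Y) := rfl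

theorem FClass.zero_def : (0 : FClass A Γ) = FClass.mk (FSet.empty A Γ) := rfl

instance : AddCommMonoid (FClass A Γ) where
  add_assoc x y z := by
    obtain ⟨X, rfl⟩ := x.exists_mk
    obtain ⟨Y, rfl⟩ := y.exists_mk
    obtain ⟨Z, rfl⟩ := z.exists_mk
    exact FClass.sound ⟨FSet.isoOf (Equiv.sumAssoc X Y Z)
      (by rintro γ ((x | y) | z) <;> rfl) (by rintro γ ((x | y) | z) <;> rfl)⟩
  zero_add x := by
    obtain ⟨X, rfl⟩ := x.exists_mk
    exact FClass.sound ⟨FSet.isoOf (Equiv.emptySum PEmpty X)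
      (by rintro γ (x | y); exact x.elim; rfl) (by rintro γ (x | y); exact x.elim; rfl)⟩
  add_zero x := by
    obtain ⟨X, rfl⟩ := x.exists_mk
    exact FClass.sound ⟨FSet.isoOf (Equiv.sumEmpty X PEmpty)
      (by rintro γ (x | y); rfl; exact y.elim) (by rintro γ (x | y); rfl; exact y.elim)⟩
  add_comm x y := by
    obtain ⟨X, rfl⟩ := x.exists_mk
    obtain ⟨Y, rfl⟩ := y.exists_mk
    exact FClass.sound ⟨FSet.isoOf (Equiv.sumComm X Y)
      (by rintro γ (x | y) <;> rfl) (by rintro γ (x | y) <;> rfl)⟩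
  nsmul := nsmulRec

/-- Decomposition into transitive fibered sets. -/
theorem FClass.mem_closure_transitive [Finite Γ] (S : Set (FibPair A Γ)) (X : FSet A Γ)
    (hX : ∀ x : X, X.stab x ∈ S) :
    FClass.mk X ∈ AddSubmonoid.closure {y | ∃ p ∈ S, y = FClass.mk (FSet.transitive p)} := by
  induction hn : Nat.card (MulAction.orbitRel.Quotient A X) using Nat.strong_induction_on
    generalizing X with
  | _ n ih =>
    by_cases hne : Nonempty X
    · obtain ⟨x⟩ := hne
      let O : Set X := {y | ∃ (γ : Γ) (a : A), y = γ • a • x}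
      have hO1 : ∀ (γ : Γ) y, y ∈ O → γ • y ∈ O := by
        rintro γ _ ⟨δ, a, rfl⟩
        exact ⟨γ * δ, a, by rw [mul_smul]⟩
      have hO2 : ∀ (b : A) y, y ∈ O → b • y ∈ O := by
        rintro b _ ⟨δ, a, rfl⟩
        exact ⟨δ, b * a, by rw [mul_smul, ← smul_comm δ b]⟩
      have hC1 : ∀ (γ : Γ) y, y ∈ Oᶜ → γ • y ∈ Oᶜ := by
        intro γ y hy h
        exact hy (by simpa using hO1 γ⁻¹ _ h)
      have hC2 : ∀ (b : A) y, y ∈ Oᶜ → b • y ∈ Oᶜ := by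
        intro γ y hy h
        exact hy (by simpa using hO2 γ⁻¹ _ h)
      let Y := X.subset O hO1 hO2
      let Z := X.subset Oᶜ hC1 hC2
      have e1 : FClass.mk X = FClass.mk Y + FClass.mk Z := by
        classical
        refine (FClass.sound (FSet.nonempty_iso_of_bijective
          (X := Y.sum Z) (Y := X) (Sum.elim Subtype.val Subtype.val) ?_ ?_ ?_)).symm
        · exact (Equiv.Set.sumCompl O).bijective
        · rintro γ (y | y) <;> rfl
        · rintro γ (y | y) <;> rfl
      let x0 : Y := ⟨x, 1, 1, by simp⟩
      have e2 : FClass.mk (FSet.transitive (X.stab x)) = FClass.mk Y := by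
        have hs : Y.stab x0 = X.stab x := by
          apply FibPair.ext_rel
          intro γ a
          rw [FSet.rel_stab, FSet.rel_stab]
          exact Subtype.ext_iff
        rw [← hs]
        refine FClass.sound (Y.nonempty_iso_transitive x0 ?_)
        rintro ⟨_, γ, a, rfl⟩
        exact ⟨γ, a, rfl⟩
      rw [e1, ← e2]
      refine add_mem (AddSubmonoid.subset_closure ⟨_, hX x, rfl⟩) ?_
      refine ih _ ?_ Z ?_ rfl
      · rw [← hn]
        let f : MulAction.orbitRel.Quotient A Z → MulAction.orbitRel.Quotient A X :=
          Quotient.map (sa := MulAction.orbitRel A Z) (sb := MulAction.orbitRel A X)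
            Subtype.val (by rintro _ x ⟨a, rfl⟩; exact ⟨a, rfl⟩)
        have hf : Function.Injective f := by
          rintro ⟨y⟩ ⟨z⟩ h
          obtain ⟨a, ha⟩ := Quotient.exact h
          exact Quotient.sound ⟨a, Subtype.ext ha⟩
        refine lt_of_le_of_ne (Nat.card_le_card_of_injective f hf) fun hc => ?_
        have hb := (Nat.bijective_iff_injective_and_card f).2 ⟨hf, hc⟩
        obtain ⟨⟨z⟩, hz⟩ := hb.2 (Quotient.mk _ x)
        obtain ⟨a, ha⟩ := Quotient.exact hz
        exact z.2 ⟨1, a, by simpa using ha.symm⟩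
      · intro z
        have : Z.stab z = X.stab z.1 := by
          apply FibPair.ext_rel
          intro γ a
          rw [FSet.rel_stab, FSet.rel_stab]
          exact Subtype.ext_iff
        rw [this]
        exact hX _
    · have : FClass.mk X = 0 := by
        rw [FClass.zero_def]
        have : IsEmpty X := not_nonempty_iff.1 hne
        exact FClass.sound ⟨FSet.isoOf (Equiv.equivOfIsEmpty X PEmpty) (fun _ x => isEmptyElim x)
          (fun _ x => isEmptyElim x)⟩
      rw [this]
      exact zero_mem _

end Classes
/-! ### Tensor products over `A × H` -/

namespace FSet

/-- A pair of surjections with the same fibres, compatible with the actions, yields an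
isomorphism. -/
theorem nonempty_iso_of_param {A Γ : Type u} [CommGroup A] [Group Γ] {X Y : FSet A Γ} {P : Type u}
    (f : P → X) (g : P → Y) (hf : Function.Surjective f) (hg : Function.Surjective g)
    (h : ∀ p q, f p = f q ↔ g p = g q)
    (hΓ : ∀ (γ : Γ) p, ∃ q, f q = γ • f p ∧ g q = γ • g p)
    (hA : ∀ (a : A) p, ∃ q, f q = a • f p ∧ g q = a • g p) : Nonempty (X ≅ Y) := by
  choose s hs using hf
  have key : ∀ p, g (s (f p)) = g p := fun p => (h _ _).1 (hs _)
  refine nonempty_iso_of_bijective (fun x => g (s x)) ⟨?_, ?_⟩ ?_ ?_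
  · intro x y hxy
    rw [← hs x, ← hs y]
    exact (h _ _).2 hxy
  · intro y
    obtain ⟨p, rfl⟩ := hg y
    exact ⟨f p, key p⟩
  · intro γ x
    obtain ⟨q, h1, h2⟩ := hΓ γ (s x)
    rw [hs] at h1
    rw [← h1, key, h2]
  · intro γ x
    obtain ⟨q, h1, h2⟩ := hA γ (s x)
    rw [hs] at h1
    rw [← h1, key, h2]

section Balanced

variable {A Γ Λ Δ H : Type u} [CommGroup A] [Group Γ] [Group Λ] [Group Δ] [Group H]
  (X : FSet A Γ) (Y : FSet A Λ) (i : H →* Γ) (j : H →* Λ)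

/-- The equivalence relation on `X × Y` whose classes are the orbits of `H × A` under
`(h, a)(x, y) = (x (ha)⁻¹, h a y)`.  Here `H` acts on `X` and `Y` through `i` and `j`, and
`x h⁻¹ = i(h) • x`. -/
def balSetoid : Setoid (X.carrier × Y.carrier) where
  r p q := ∃ (h : H) (a : A), q = (i h • a⁻¹ • p.1, j h • a • p.2)
  iseqv :=
    { refl := fun p => ⟨1, 1, by simp⟩
      symm := by
        rintro ⟨x, y⟩ _ ⟨h, a, rfl⟩
        refine ⟨h⁻¹, a⁻¹, ?_⟩
        simp [smul_commA]
      trans := by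
        rintro ⟨x, y⟩ _ _ ⟨h, a, rfl⟩ ⟨k, b, rfl⟩
        refine ⟨k * h, b * a, ?_⟩
        simp only [map_mul, mul_inv_rev, smul_commA, smul_smul, mul_comm] }

theorem bal_iff (x x' : X) (y y' : Y) : balSetoid X Y i j (x, y) (x', y') ↔
    ∃ (h : H) (a : A), x' = i h • a⁻¹ • x ∧ y' = j h • a • y :=
  exists_congr fun _ => exists_congr fun _ => Prod.ext_iff

/-- The `(H × A)`-orbit of `(x, y)` is `A`-free, for the action `b[x, y] = [b x, y]`. -/
def IsFree (x : X) (y : Y) : Prop :=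
  ∀ b : A, balSetoid X Y i j (b • x, y) (x, y) → b = 1

variable {X Y i j}

theorem isFree_iff {x : X} {y : Y} : IsFree X Y i j x y ↔
    ∀ h a b, (X.stab x).Rel (i h) a → (Y.stab y).Rel (j h) b → a * b = 1 := by
  simp only [rel_stab]
  constructor
  · intro hf h a b ha hb
    have := hf (a * b)⁻¹ ((bal_iff _ _ _ _ _ _ _ _).2 ⟨h, b⁻¹, ?_, ?_⟩)
    · exact inv_eq_one.1 this
    · simp [smul_commA, ha, smul_smul]
    · simp [smul_commA, hb, smul_smul]
  · rintro hf b hh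
    obtain ⟨h, a, h1, h2⟩ := (bal_iff _ _ _ _ _ _ _ _).1 hh
    rw [smul_commA, smul_commA, eq_inv_smul_iff] at h1
    rw [smul_commA, ← inv_smul_eq_iff] at h2
    rw [← inv_smul_eq_iff, smul_smul] at h1
    have := hf h _ _ h1.symm h2.symm
    rw [mul_inv_cancel_right] at this
    exact inv_eq_one.1 this

variable (X Y i j) in
/-- The set `X ⊗_{AH} Y` of the `A`-free `(H × A)`-orbits in `X × Y`. -/
def BalCarrier : Type u :=
  Quotient ((balSetoid X Y i j).comap
    (Subtype.val : {p : X.carrier × Y.carrier // IsFree X Y i j p.1 p.2} → _))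

/-- The orbit of `(x, y)`. -/
def bmk (x : X) (y : Y) (h : IsFree X Y i j x y) : BalCarrier X Y i j := Quotient.mk _ ⟨(x, y), h⟩

theorem bmk_eq_iff {x x' : X} {y y' : Y} (h : IsFree X Y i j x y) (h' : IsFree X Y i j x' y') :
    bmk x y h = bmk x' y' h' ↔ ∃ (h : H) (a : A), x' = i h • a⁻¹ • x ∧ y' = j h • a • y := by
  refine (Quotient.eq (r := (balSetoid X Y i j).comap
    (Subtype.val : {p : X.carrier × Y.carrier // IsFree X Y i j p.1 p.2} → _))).trans ?_
  exact bal_iff _ _ _ _ _ _ _ _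

theorem exists_bmk (z : BalCarrier X Y i j) : ∃ x y h, z = bmk x y h := by
  obtain ⟨⟨⟨x, y⟩, h⟩⟩ := z
  exact ⟨x, y, h, rfl⟩

theorem IsFree.smul {x : X} {y : Y} (hf : IsFree X Y i j x y) {γ : Γ} {l : Λ}
    (hp : ∀ h, γ * i h = i h * γ) (hq : ∀ h, l * j h = j h * l) :
    IsFree X Y i j (γ • x) (l • y) := by
  rw [isFree_iff] at hf ⊢
  intro h a b ha hb
  rw [rel_stab] at ha hb
  refine hf h a b ?_ ?_
  · rw [rel_stab]
    rw [smul_smul, ← hp, mul_smul, ← smul_commA] at ha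
    exact MulAction.injective _ ha
  · rw [rel_stab]
    rw [smul_smul, ← hq, mul_smul, ← smul_commA] at hb
    exact MulAction.injective _ hb

theorem IsFree.smulA {x : X} {y : Y} (hf : IsFree X Y i j x y) (a : A) :
    IsFree X Y i j (a • x) y := by
  rw [isFree_iff] at hf ⊢
  intro h b c hb hc
  refine hf h b c ?_ hc
  rw [rel_stab] at hb ⊢
  rw [smul_commA, smul_comm b] at hb
  exact MulAction.injective _ hb

variable (X Y i j)

/-- The action of `A` on `X ⊗_{AH} Y`, given by `a(x ⊗ y) = a x ⊗ y`. -/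
@[reducible] def balActA : MulAction A (BalCarrier X Y i j) where
  smul b := Quotient.map (fun z => ⟨(b • z.1.1, z.1.2), z.2.smulA b⟩) (by
    rintro ⟨⟨x, y⟩, hz⟩ ⟨⟨x', y'⟩, hz'⟩ h
    obtain ⟨k, a, rfl, rfl⟩ := (bal_iff _ _ _ _ _ _ _ _).1 h
    refine (bal_iff _ _ _ _ _ _ _ _).2 ⟨k, a, ?_, rfl⟩
    simp only [smul_commA, smul_smul, mul_comm])
  one_smul := by
    rintro ⟨z⟩
    refine congrArg (Quotient.mk _) (Subtype.ext ?_)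
    simp
  mul_smul := by
    rintro d e ⟨z⟩
    refine congrArg (Quotient.mk _) (Subtype.ext ?_)
    simp [mul_smul]

theorem bal_finite : letI := balActA X Y i j
    Finite (MulAction.orbitRel.Quotient A (BalCarrier X Y i j)) := by
  let s := balActA X Y i j
  have hex : ∀ z : MulAction.orbitRel.Quotient A (BalCarrier X Y i j), ∃ x y h,
      z = Quotient.mk (MulAction.orbitRel A _) (bmk x y h) := by
    rintro ⟨z⟩
    obtain ⟨x, y, h, rfl⟩ := exists_bmk z
    exact ⟨x, y, h, rfl⟩
  choose fx fy fh hh using hex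
  refine Finite.of_injective (β := MulAction.orbitRel.Quotient A X ×
    MulAction.orbitRel.Quotient A Y) (fun z => (Quotient.mk _ (fx z), Quotient.mk _ (fy z))) ?_
  intro z w hzw
  obtain ⟨h1, h2⟩ := Prod.ext_iff.1 hzw
  obtain ⟨a, ha⟩ := Quotient.exact h1
  obtain ⟨b, hb⟩ := Quotient.exact h2
  rw [hh z, hh w]
  refine Quotient.sound ⟨a * b, ?_⟩
  change bmk ((a * b) • fx w) (fy w) ((fh w).smulA _) = bmk (fx z) (fy z) (fh z)
  rw [bmk_eq_iff]
  refine ⟨1, b, ?_, ?_⟩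
  · rw [← ha, mul_comm, mul_smul]
    simp
  · rw [← hb]
    simp

/-- Let `Δ` act on `X` and `Y` through homomorphisms `p` and `q` whose images centralize those of
`i` and `j`.  Then `X ⊗_{AH} Y` is an `A`-fibered `Δ`-set via `d(x ⊗ y) = p(d)x ⊗ q(d)y`. -/
def balanced (p : Δ →* Γ) (q : Δ →* Λ) (hp : ∀ d h, p d * i h = i h * p d)
    (hq : ∀ d h, q d * j h = j h * q d) : FSet A Δ where
  carrier := BalCarrier X Y i j
  actΓ :=
    { smul := fun d => Quotient.map (fun z => ⟨(p d • z.1.1, q d • z.1.2),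
          z.2.smul (hp d) (hq d)⟩) (by
        rintro ⟨⟨x, y⟩, hz⟩ ⟨⟨x', y'⟩, hz'⟩ h
        obtain ⟨k, a, rfl, rfl⟩ := (bal_iff _ _ _ _ _ _ _ _).1 h
        refine (bal_iff _ _ _ _ _ _ _ _).2 ⟨k, a, ?_, ?_⟩
        · simp only [smul_commA, smul_smul, hp]
        · simp only [smul_commA, smul_smul, hq])
      one_smul := by
        rintro ⟨z⟩
        refine congrArg (Quotient.mk _) (Subtype.ext ?_)
        simp
      mul_smul := by
        rintro d e ⟨z⟩
        refine congrArg (Quotient.mk _) (Subtype.ext ?_)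
        simp [mul_smul] }
  actA := balActA X Y i j
  comm := @SMulCommClass.mk _ _ _ (_) (_) <| by
    rintro d b ⟨z⟩
    refine congrArg (Quotient.mk _) (Subtype.ext ?_)
    simp [smul_commA]
  fin := bal_finite X Y i j
  free := by
    intro a b z hz
    obtain ⟨x, y, h, rfl⟩ := exists_bmk z
    have h1 : bmk (a • x) y (h.smulA a) = bmk (b • x) y (h.smulA b) := hz
    have h2 := (bmk_eq_iff _ _).1 h1
    have h3 := h (b⁻¹ * a) ?_
    · exact (inv_mul_eq_one.1 h3).symm
    · obtain ⟨k, c, hx, hy⟩ := h2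
      refine (bal_iff _ _ _ _ _ _ _ _).2 ⟨k, c, ?_, hy⟩
      rw [mul_smul, smul_comm c⁻¹, smul_commA, ← hx, inv_smul_smul]

variable {X Y i j}

variable {p : Δ →* Γ} {q : Δ →* Λ} {hp : ∀ d h, p d * i h = i h * p d}
    {hq : ∀ d h, q d * j h = j h * q d}

/-- The element `x ⊗ y`. -/
def tmul (x : X) (y : Y) (h : IsFree X Y i j x y) : balanced X Y i j p q hp hq :=
  show BalCarrier X Y i j from bmk x y h

theorem tmul_eq_iff {x x' : X} {y y' : Y} (h : IsFree X Y i j x y) (h' : IsFree X Y i j x' y') :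
    (tmul x y h : balanced X Y i j p q hp hq) = tmul x' y' h' ↔
      ∃ (h : H) (a : A), x' = i h • a⁻¹ • x ∧ y' = j h • a • y := bmk_eq_iff h h'

theorem tmul_congr {x x' : X} {y y' : Y} (h : IsFree X Y i j x y) (hx : x = x') (hy : y = y') :
    (tmul x y h : balanced X Y i j p q hp hq) = tmul x' y' (hx ▸ hy ▸ h) := by
  subst hx hy
  rfl

theorem exists_tmul (z : balanced X Y i j p q hp hq) : ∃ x y h, z = tmul x y h := exists_bmk z

theorem smul_tmul (x : X) (y : Y) (h : IsFree X Y i j x y) (d : Δ) :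
    d • (tmul x y h : balanced X Y i j p q hp hq) =
      tmul (p d • x) (q d • y) (h.smul (hp d) (hq d)) := rfl

theorem smulA_tmul (x : X) (y : Y) (h : IsFree X Y i j x y) (b : A) :
    b • (tmul x y h : balanced X Y i j p q hp hq) = tmul (b • x) y (h.smulA b) := rfl

theorem rel_stab_tmul (x : X) (y : Y) (h : IsFree X Y i j x y) (d : Δ) (a : A) :
    ((balanced X Y i j p q hp hq).stab (tmul x y h)).Rel d a ↔
      ∃ h b c, (X.stab x).Rel (p d * i h) b ∧ (Y.stab y).Rel (j h * q d) c ∧ a = b * c := by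
  rw [rel_stab, smul_tmul, smulA_tmul, tmul_eq_iff]
  refine exists_congr fun k => ?_
  simp only [rel_stab]
  constructor
  · rintro ⟨b, h1, h2⟩
    refine ⟨b * a, b⁻¹, ?_, ?_, ?_⟩
    · rw [mul_smul, mul_smul, h1, smul_commA, smul_inv_smul, smul_smul, hp, mul_smul]
    · rw [eq_inv_smul_iff, mul_smul, ← smul_commA, ← h2]
    · rw [mul_comm b, mul_inv_cancel_right]
  · rintro ⟨b, c, h1, h2, rfl⟩
    refine ⟨c⁻¹, ?_, ?_⟩
    · rw [inv_inv, smul_commA, smul_smul (i k), ← hp, h1, smul_smul, mul_comm]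
    · rw [smul_commA, smul_smul, h2, inv_smul_smul]

theorem isoEquiv_smul {X X' : FSet A Γ} (e : X ≅ X') (γ : Γ) (x : X) :
    isoEquiv e (γ • x) = γ • isoEquiv e x := e.hom.map_smul γ x

theorem isoEquiv_smulA {X X' : FSet A Γ} (e : X ≅ X') (a : A) (x : X) :
    isoEquiv e (a • x) = a • isoEquiv e x := e.hom.map_smulA a x

theorem stab_isoEquiv {X X' : FSet A Γ} (e : X ≅ X') (x : X) :
    X'.stab (isoEquiv e x) = X.stab x := by
  apply FibPair.ext_rel
  intro γ a
  rw [rel_stab, rel_stab, ← isoEquiv_smul, ← isoEquiv_smulA, (isoEquiv e).injective.eq_iff]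

theorem balanced_congr {X' : FSet A Γ} {Y' : FSet A Λ} (e : X ≅ X') (f : Y ≅ Y') :
    Nonempty (balanced X Y i j p q hp hq ≅ balanced X' Y' i j p q hp hq) := by
  have hfree : ∀ x y, IsFree X Y i j x y ↔ IsFree X' Y' i j (isoEquiv e x) (isoEquiv f y) := by
    intro x y
    rw [isFree_iff, isFree_iff, stab_isoEquiv, stab_isoEquiv]
  refine nonempty_iso_of_param (P := {z : X.carrier × Y.carrier // IsFree X Y i j z.1 z.2})
    (fun z => tmul z.1.1 z.1.2 z.2)
    (fun z => tmul (isoEquiv e z.1.1) (isoEquiv f z.1.2) ((hfree _ _).1 z.2)) ?_ ?_ ?_ ?_ ?_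
  · intro z
    obtain ⟨x, y, h, rfl⟩ := exists_tmul z
    exact ⟨⟨(x, y), h⟩, rfl⟩
  · intro z
    obtain ⟨x, y, h, rfl⟩ := exists_tmul z
    obtain ⟨x, rfl⟩ := (isoEquiv e).surjective x
    obtain ⟨y, rfl⟩ := (isoEquiv f).surjective y
    exact ⟨⟨(x, y), (hfree _ _).2 h⟩, rfl⟩
  · rintro ⟨⟨x, y⟩, h⟩ ⟨⟨x', y'⟩, h'⟩
    rw [tmul_eq_iff, tmul_eq_iff]
    refine exists_congr fun k => exists_congr fun a => ?_
    rw [← (isoEquiv e).injective.eq_iff, ← (isoEquiv f).injective.eq_iff]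
    simp only [isoEquiv_smul, isoEquiv_smulA]
  · rintro d ⟨⟨x, y⟩, h⟩
    exact ⟨⟨(p d • x, q d • y), h.smul (hp d) (hq d)⟩, rfl,
      tmul_congr _ (isoEquiv_smul _ _ _) (isoEquiv_smul _ _ _)⟩
  · rintro a ⟨⟨x, y⟩, h⟩
    exact ⟨⟨(a • x, y), h.smulA a⟩, rfl, tmul_congr _ (isoEquiv_smulA _ _ _) rfl⟩

theorem balanced_sum_left (X X' : FSet A Γ) :
    Nonempty ((balanced X Y i j p q hp hq).sum (balanced X' Y i j p q hp hq) ≅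
      balanced (X.sum X') Y i j p q hp hq) := by
  have h1 : ∀ x y, IsFree (X.sum X') Y i j (inl X X' x) y ↔ IsFree X Y i j x y := by
    intro x y
    rw [isFree_iff, isFree_iff, stab_inl]
  have h2 : ∀ x y, IsFree (X.sum X') Y i j (inr X X' x) y ↔ IsFree X' Y i j x y := by
    intro x y
    rw [isFree_iff, isFree_iff, stab_inr]
  refine nonempty_iso_of_param (P := {z : X.carrier × Y.carrier // IsFree X Y i j z.1 z.2} ⊕
      {z : X'.carrier × Y.carrier // IsFree X' Y i j z.1 z.2})
    (Sum.elim (fun z => inl _ _ (tmul z.1.1 z.1.2 z.2)) (fun z => inr _ _ (tmul z.1.1 z.1.2 z.2)))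
    (Sum.elim (fun z => tmul (inl X X' z.1.1) z.1.2 ((h1 _ _).2 z.2))
      (fun z => tmul (inr X X' z.1.1) z.1.2 ((h2 _ _).2 z.2))) ?_ ?_ ?_ ?_ ?_
  · intro z
    obtain ⟨z, rfl⟩ | ⟨z, rfl⟩ := sum_cases _ _ z
    · obtain ⟨x, y, h, rfl⟩ := exists_tmul z
      exact ⟨Sum.inl ⟨(x, y), h⟩, rfl⟩
    · obtain ⟨x, y, h, rfl⟩ := exists_tmul z
      exact ⟨Sum.inr ⟨(x, y), h⟩, rfl⟩
  · intro z
    obtain ⟨x, y, h, rfl⟩ := exists_tmul z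
    obtain ⟨x, rfl⟩ | ⟨x, rfl⟩ := sum_cases _ _ x
    · exact ⟨Sum.inl ⟨(x, y), (h1 _ _).1 h⟩, rfl⟩
    · exact ⟨Sum.inr ⟨(x, y), (h2 _ _).1 h⟩, rfl⟩
  · rintro (⟨⟨x, y⟩, h⟩ | ⟨⟨x, y⟩, h⟩) (⟨⟨x', y'⟩, h'⟩ | ⟨⟨x', y'⟩, h'⟩)
    · simp only [Sum.elim_inl, (inl_injective _ _).eq_iff, tmul_eq_iff, smulA_inl, smul_inl]
    · simp only [Sum.elim_inl, Sum.elim_inr, tmul_eq_iff, smulA_inl, smul_inl, inl_ne_inr,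
        (inl_ne_inr _ _ _ _).symm, false_and, exists_false]
    · simp only [Sum.elim_inl, Sum.elim_inr, tmul_eq_iff, smulA_inr, smul_inr, inl_ne_inr,
        (inl_ne_inr _ _ _ _).symm, false_and, exists_false]
    · simp only [Sum.elim_inr, (inr_injective _ _).eq_iff, tmul_eq_iff, smulA_inr, smul_inr]
  · rintro d (⟨⟨x, y⟩, h⟩ | ⟨⟨x, y⟩, h⟩)
    · exact ⟨Sum.inl ⟨(p d • x, q d • y), h.smul (hp d) (hq d)⟩, rfl, rfl⟩
    · exact ⟨Sum.inr ⟨(p d • x, q d • y), h.smul (hp d) (hq d)⟩, rfl, rfl⟩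
  · rintro a (⟨⟨x, y⟩, h⟩ | ⟨⟨x, y⟩, h⟩)
    · exact ⟨Sum.inl ⟨(a • x, y), h.smulA a⟩, rfl, rfl⟩
    · exact ⟨Sum.inr ⟨(a • x, y), h.smulA a⟩, rfl, rfl⟩

theorem balanced_sum_right (Y Y' : FSet A Λ) :
    Nonempty ((balanced X Y i j p q hp hq).sum (balanced X Y' i j p q hp hq) ≅
      balanced X (Y.sum Y') i j p q hp hq) := by
  have h1 : ∀ x y, IsFree X (Y.sum Y') i j x (inl Y Y' y) ↔ IsFree X Y i j x y := by
    intro x y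
    rw [isFree_iff, isFree_iff, stab_inl]
  have h2 : ∀ x y, IsFree X (Y.sum Y') i j x (inr Y Y' y) ↔ IsFree X Y' i j x y := by
    intro x y
    rw [isFree_iff, isFree_iff, stab_inr]
  refine nonempty_iso_of_param (P := {z : X.carrier × Y.carrier // IsFree X Y i j z.1 z.2} ⊕
      {z : X.carrier × Y'.carrier // IsFree X Y' i j z.1 z.2})
    (Sum.elim (fun z => inl _ _ (tmul z.1.1 z.1.2 z.2)) (fun z => inr _ _ (tmul z.1.1 z.1.2 z.2)))
    (Sum.elim (fun z => tmul z.1.1 (inl Y Y' z.1.2) ((h1 _ _).2 z.2))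
      (fun z => tmul z.1.1 (inr Y Y' z.1.2) ((h2 _ _).2 z.2))) ?_ ?_ ?_ ?_ ?_
  · intro z
    obtain ⟨z, rfl⟩ | ⟨z, rfl⟩ := sum_cases _ _ z
    · obtain ⟨x, y, h, rfl⟩ := exists_tmul z
      exact ⟨Sum.inl ⟨(x, y), h⟩, rfl⟩
    · obtain ⟨x, y, h, rfl⟩ := exists_tmul z
      exact ⟨Sum.inr ⟨(x, y), h⟩, rfl⟩
  · intro z
    obtain ⟨x, y, h, rfl⟩ := exists_tmul z
    obtain ⟨y, rfl⟩ | ⟨y, rfl⟩ := sum_cases _ _ y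
    · exact ⟨Sum.inl ⟨(x, y), (h1 _ _).1 h⟩, rfl⟩
    · exact ⟨Sum.inr ⟨(x, y), (h2 _ _).1 h⟩, rfl⟩
  · rintro (⟨⟨x, y⟩, h⟩ | ⟨⟨x, y⟩, h⟩) (⟨⟨x', y'⟩, h'⟩ | ⟨⟨x', y'⟩, h'⟩)
    · simp only [Sum.elim_inl, (inl_injective _ _).eq_iff, tmul_eq_iff, smulA_inl, smul_inl]
    · simp only [Sum.elim_inl, Sum.elim_inr, tmul_eq_iff, smulA_inl, smul_inl, inl_ne_inr,
        (inl_ne_inr _ _ _ _).symm, and_false, exists_false]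
    · simp only [Sum.elim_inl, Sum.elim_inr, tmul_eq_iff, smulA_inr, smul_inr, inl_ne_inr,
        (inl_ne_inr _ _ _ _).symm, and_false, exists_false]
    · simp only [Sum.elim_inr, (inr_injective _ _).eq_iff, tmul_eq_iff, smulA_inr, smul_inr]
  · rintro d (⟨⟨x, y⟩, h⟩ | ⟨⟨x, y⟩, h⟩)
    · exact ⟨Sum.inl ⟨(p d • x, q d • y), h.smul (hp d) (hq d)⟩, rfl, rfl⟩
    · exact ⟨Sum.inr ⟨(p d • x, q d • y), h.smul (hp d) (hq d)⟩, rfl, rfl⟩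
  · rintro a (⟨⟨x, y⟩, h⟩ | ⟨⟨x, y⟩, h⟩)
    · exact ⟨Sum.inl ⟨(a • x, y), h.smulA a⟩, rfl, rfl⟩
    · exact ⟨Sum.inr ⟨(a • x, y), h.smulA a⟩, rfl, rfl⟩

end Balanced

section Bisets

variable {A G H K L : Type u} [CommGroup A] [Group G] [Group H] [Group K] [Group L]

/-- The tensor product `U ⊗_{AH} V` of an `A`-fibered `(G, H)`-biset and an `A`-fibered
`(H, K)`-biset: `u h ⊗ v = u ⊗ h v`, `u a ⊗ v = u ⊗ a v`, with
`(g, k)(u ⊗ v) = (g, 1)u ⊗ (1, k)v`. -/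
abbrev tensor (U : FSet A (G × H)) (V : FSet A (H × K)) : FSet A (G × K) :=
  balanced U V (MonoidHom.inr G H) (MonoidHom.inl H K)
    ((MonoidHom.inl G H).comp (MonoidHom.fst G K)) ((MonoidHom.inr H K).comp (MonoidHom.snd G K))
    (fun _ _ => by simp) (fun _ _ => by simp)

/-- The tensor product `U ⊗_{AH} X` of an `A`-fibered `(G, H)`-biset and an `A`-fibered
`H`-set: `u h ⊗ x = u ⊗ h x`, `u a ⊗ x = u ⊗ a x`, with `g(u ⊗ x) = (g, 1)u ⊗ x`. -/
abbrev act (U : FSet A (G × H)) (X : FSet A H) : FSet A G :=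
  balanced U X (MonoidHom.inr G H) (MonoidHom.id H) (MonoidHom.inl G H) 1
    (fun _ _ => by simp) (fun _ _ => by simp)

/-- The orbit of `(u, x)` is `A`-free, that is, `u ⊗ x` is an element of `U ⊗_{AH} X`. -/
abbrev ActFree (U : FSet A (G × H)) (X : FSet A H) (u : U) (x : X) : Prop :=
  IsFree U X (MonoidHom.inr G H) (MonoidHom.id H) u x

theorem stabilizer_act {U : FSet A (G × H)} {X : FSet A H} (u : U) (x : X)
    (h : ActFree U X u x) :
    (U.act X).stabilizer (tmul u x h) = (U.stab u).starSubgroup (X.stabilizer x) := by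
  ext g
  rw [FibPair.mem_starSubgroup]
  constructor
  · rintro hg
    obtain ⟨k, b, c, h1, h2, _⟩ := (rel_stab_tmul _ _ h g _).1 ((FibPair.rel_chr _ hg))
    refine ⟨k, ?_, ?_⟩
    · simpa using h2.1
    · simpa using h1.1
  · rintro ⟨k, hk, hg⟩
    refine ((rel_stab_tmul _ _ h g ((U.stab u).chr ⟨_, hg⟩ * (X.stab x).chr ⟨_, hk⟩)).2
      ⟨k, _, _, ?_, ?_, rfl⟩).1
    · simpa using FibPair.rel_chr _ hg
    · simpa using FibPair.rel_chr _ hk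

theorem compat_stab {U : FSet A (G × H)} {V : FSet A (H × K)} {u : U} {v : V}
    (h : IsFree U V (MonoidHom.inr G H) (MonoidHom.inl H K) u v) :
    FibPair.Compat (U.stab u) (V.stab v) := by
  rw [FibPair.compat_iff]
  exact isFree_iff.1 h

/-- The stabilizing pair of `u ⊗ v` is the product of the stabilizing pairs of `u` and `v`. -/
theorem stab_tensor {U : FSet A (G × H)} {V : FSet A (H × K)} {u : U} {v : V}
    (h : IsFree U V (MonoidHom.inr G H) (MonoidHom.inl H K) u v) :
    (U.tensor V).stab (tmul u v h) = (U.stab u).star (V.stab v) (compat_stab h) := by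
  apply FibPair.ext_rel
  rintro ⟨g, k⟩ a
  rw [FibPair.rel_star]
  refine (rel_stab_tmul u v h (g, k) a).trans ?_
  simp

/-- Freeness of a triple. -/
def TFree {U : FSet A (G × H)} {V : FSet A (H × K)} {W : FSet A (K × L)} (u : U) (v : V)
    (w : W) : Prop :=
  ∀ h k a b c, (U.stab u).Rel (1, h) a → (V.stab v).Rel (h, k) b → (W.stab w).Rel (k, 1) c →
    a * b * c = 1

section Triple

variable {U : FSet A (G × H)} {V : FSet A (H × K)} {W : FSet A (K × L)}

theorem TFree.left {u : U} {v : V} {w : W} (h : TFree u v w) :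
    IsFree U V (MonoidHom.inr G H) (MonoidHom.inl H K) u v := by
  rw [isFree_iff]
  intro k a b ha hb
  simpa using h k 1 a b 1 ha hb ((rel_stab _ _ _ _).2 (by simp [← Prod.one_eq_mk]))

theorem TFree.right {u : U} {v : V} {w : W} (h : TFree u v w) :
    IsFree V W (MonoidHom.inr H K) (MonoidHom.inl K L) v w := by
  rw [isFree_iff]
  intro k a b ha hb
  simpa using h 1 k 1 a b ((rel_stab _ _ _ _).2 (by simp [← Prod.one_eq_mk])) ha hb

theorem tFree_iff_left {u : U} {v : V} {w : W}
    (h : IsFree U V (MonoidHom.inr G H) (MonoidHom.inl H K) u v) :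
    TFree u v w ↔ IsFree (U.tensor V) W (MonoidHom.inr G K) (MonoidHom.inl K L) (tmul u v h) w := by
  rw [isFree_iff, stab_tensor]
  simp only [FibPair.rel_star]
  constructor
  · rintro ht k a b ⟨x, c, d, h1, h2, rfl⟩ h3
    exact ht _ _ _ _ _ h1 h2 h3
  · intro ht x k a b c h1 h2 h3
    exact ht k _ _ ⟨x, a, b, h1, h2, rfl⟩ h3

theorem tFree_iff_right {u : U} {v : V} {w : W}
    (h : IsFree V W (MonoidHom.inr H K) (MonoidHom.inl K L) v w) :
    TFree u v w ↔ IsFree U (V.tensor W) (MonoidHom.inr G H) (MonoidHom.inl H L) u (tmul v w h) := by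
  rw [isFree_iff, stab_tensor]
  simp only [FibPair.rel_star]
  constructor
  · rintro ht k a b h1 ⟨x, c, d, h2, h3, rfl⟩
    rw [← mul_assoc]
    exact ht _ _ _ _ _ h1 h2 h3
  · intro ht x k a b c h1 h2 h3
    rw [mul_assoc]
    exact ht _ _ _ h1 ⟨k, b, c, h2, h3, rfl⟩

theorem TFree.smul {u : U} {v : V} {w : W} (h : TFree u v w) (g : G) (l : L) :
    TFree ((g, (1 : H)) • u) v (((1 : K), l) • w) := by
  intro x k a b c h1 h2 h3
  refine h x k a b c ?_ h2 ?_
  · rw [rel_stab] at h1 ⊢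
    rw [smul_smul, show ((1 : G), x) * (g, 1) = (g, 1) * (1, x) by simp, mul_smul,
      ← smul_commA] at h1
    exact MulAction.injective _ h1
  · rw [rel_stab] at h3 ⊢
    rw [smul_smul, show (k, (1 : L)) * (1, l) = (1, l) * (k, 1) by simp, mul_smul,
      ← smul_commA] at h3
    exact MulAction.injective _ h3

theorem TFree.smulA {u : U} {v : V} {w : W} (h : TFree u v w) (a : A) :
    TFree (a • u) v w := by
  intro x k b c d h1 h2 h3
  refine h x k b c d ?_ h2 h3
  rw [rel_stab] at h1 ⊢
  rw [smul_commA, smul_comm b] at h1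
  exact MulAction.injective _ h1

theorem tensor_assoc (U : FSet A (G × H)) (V : FSet A (H × K)) (W : FSet A (K × L)) :
    Nonempty ((U.tensor V).tensor W ≅ U.tensor (V.tensor W)) := by
  have hone : ∀ {G₁ G₂ : Type u} [Group G₁] [Group G₂] (X : FSet A (G₁ × G₂)) (x : X),
      ((1 : G₁), (1 : G₂)) • x = x := fun X x => by rw [← Prod.one_eq_mk, one_smul]
  refine nonempty_iso_of_param
    (P := {z : U.carrier × V.carrier × W.carrier // TFree z.1 z.2.1 z.2.2})
    (fun z => tmul (X := U.tensor V) (tmul z.1.1 z.1.2.1 z.2.left) z.1.2.2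
      ((tFree_iff_left z.2.left).1 z.2))
    (fun z => tmul (Y := V.tensor W) z.1.1 (tmul z.1.2.1 z.1.2.2 z.2.right)
      ((tFree_iff_right z.2.right).1 z.2)) ?_ ?_ ?_ ?_ ?_
  · intro z
    obtain ⟨t, w, h, rfl⟩ := exists_tmul z
    obtain ⟨u, v, h', rfl⟩ := exists_tmul t
    exact ⟨⟨(u, v, w), (tFree_iff_left h').2 h⟩, rfl⟩
  · intro z
    obtain ⟨u, t, h, rfl⟩ := exists_tmul z
    obtain ⟨v, w, h', rfl⟩ := exists_tmul t
    exact ⟨⟨(u, v, w), (tFree_iff_right h').2 h⟩, rfl⟩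
  · rintro ⟨⟨u, v, w⟩, h⟩ ⟨⟨u', v', w'⟩, h'⟩
    simp only [tmul_eq_iff, smul_tmul, smulA_tmul, MonoidHom.inr_apply, MonoidHom.inl_apply,
      MonoidHom.comp_apply, MonoidHom.coe_fst, MonoidHom.coe_snd, hone]
    constructor
    · rintro ⟨k, b, ⟨x, a, h1, h2⟩, rfl⟩
      have e1 : u' = ((1 : G), x⁻¹) • (a⁻¹ * b)⁻¹ • u := by
        have := congrArg (fun z => ((1 : G), x⁻¹) • a • z) h1
        simp only [smul_commA, smul_smul, Prod.mk_mul_mk, inv_mul_cancel, one_mul, hone,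
          mul_inv_cancel, one_smul] at this
        rw [← this]
        simp only [smul_commA, smul_smul, mul_inv_rev, inv_inv, mul_comm, hone]
      have e2 : v' = (x⁻¹, k) • a⁻¹ • v := by
        have := congrArg (fun z => (x⁻¹, (1 : K)) • a⁻¹ • z) h2
        simp only [smul_commA, smul_smul, Prod.mk_mul_mk, inv_mul_cancel, one_mul, mul_one, hone,
          one_smul] at this
        rw [← this]
        simp only [smul_commA]
      refine ⟨x⁻¹, a⁻¹ * b, e1, k⁻¹, b⁻¹, ?_, ?_⟩
      · rw [e2]
        simp only [smul_commA, smul_smul, Prod.mk_mul_mk, inv_mul_cancel, one_mul, mul_one, hone,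
          one_smul, inv_inv, mul_comm]
      · simp only [smul_commA, smul_smul, Prod.mk_mul_mk, inv_mul_cancel, one_mul, mul_one, hone,
          one_smul]
    · rintro ⟨x, a, rfl, k, b, h1, h2⟩
      have e1 : v' = (x, k⁻¹) • b • a • v := by
        have := congrArg (fun z => ((1 : H), k⁻¹) • b • z) h1
        simp only [smul_commA, smul_smul, Prod.mk_mul_mk, inv_mul_cancel, one_mul, mul_one, hone,
          mul_inv_cancel, one_smul] at this
        rw [← this]
        simp only [smul_commA, smul_smul, mul_comm]
      subst h2 e1
      have ea : a⁻¹ * (b⁻¹ * (b * a)) = 1 := by simp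
      refine ⟨k⁻¹, b⁻¹, ⟨x⁻¹, a⁻¹ * b⁻¹, ?_, ?_⟩, ?_⟩
      · simp only [smul_commA, smul_smul, Prod.mk_mul_mk, inv_mul_cancel, one_mul, mul_one, hone,
          one_smul, inv_inv, mul_inv_rev]
        simp only [mul_assoc, mul_inv_cancel, mul_one]
      · simp only [smul_commA, smul_smul, Prod.mk_mul_mk, inv_mul_cancel, one_mul, mul_one, hone,
          one_smul]
        simp only [mul_assoc, ea, one_smul]
      · simp only [smul_commA, smul_smul, Prod.mk_mul_mk, inv_mul_cancel, one_mul, mul_one, hone,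
          one_smul]
  · rintro ⟨g, l⟩ ⟨⟨u, v, w⟩, h⟩
    refine ⟨⟨((g, (1 : H)) • u, v, ((1 : K), l) • w), h.smul g l⟩, ?_, ?_⟩
    · simp [smul_tmul, hone]
    · simp [smul_tmul, hone]
  · rintro a ⟨⟨u, v, w⟩, h⟩
    exact ⟨⟨(a • u, v, w), h.smulA a⟩, rfl, rfl⟩

end Triple

theorem tmk_diag_eq_iff [Finite G] (g h g' h' : G) (a b : A) :
    tmk (FibPair.diag A G) (g, h) a = tmk (FibPair.diag A G) (g', h') b ↔
      h⁻¹ * h' = g⁻¹ * g' ∧ a = b := by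
  rw [tmk_eq_iff, FibPair.diag, FibPair.rel_graph]
  simp [mul_inv_eq_one]

theorem one_tmk_diag [Finite G] : ∀ z : transitive (FibPair.diag A G), ∃ (g : G) (a : A),
    z = tmk _ (1, g) a ∧ z = tmk _ (g⁻¹, 1) a := by
  intro z
  obtain ⟨⟨g, h⟩, a, rfl⟩ := exists_tmk _ z
  refine ⟨h * g⁻¹, a, ?_, ?_⟩
  · rw [tmk_diag_eq_iff]; simp
  · rw [tmk_diag_eq_iff]; simp

theorem one_tensor [Finite G] (V : FSet A (G × H)) :
    Nonempty ((transitive (FibPair.diag A G)).tensor V ≅ V) := by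
  have hfree : ∀ v : V, IsFree (transitive (FibPair.diag A G)) V (MonoidHom.inr G G)
      (MonoidHom.inl G H) (tmk _ (1, 1) 1) v := by
    intro v
    rw [isFree_iff]
    intro h a b h1 h2
    rw [rel_stab, MonoidHom.inr_apply, smul_tmk, smulA_tmk, Prod.mk_mul_mk,
      tmk_diag_eq_iff] at h1
    obtain ⟨h3, h4⟩ := h1
    have h5 : h = 1 := by simpa using h3
    subst h5
    have := h2.unique (b := 1) ((rel_stab _ _ _ _).2 (by simp [← Prod.one_eq_mk]))
    rw [this, mul_one, ← mul_one a, ← h4]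
  refine nonempty_iso_of_param (P := V) (fun v => tmul (tmk _ (1, 1) 1) v (hfree v)) id ?_
    Function.surjective_id ?_ ?_ ?_
  · intro z
    obtain ⟨t, v, h, rfl⟩ := exists_tmul z
    obtain ⟨g, a, rfl, -⟩ := one_tmk_diag t
    refine ⟨(g⁻¹, (1 : H)) • a • v, ?_⟩
    dsimp only
    rw [tmul_eq_iff]
    refine ⟨g, a⁻¹, ?_, ?_⟩
    · rw [MonoidHom.inr_apply, smulA_tmk, smul_tmk]; simp
    · rw [MonoidHom.inl_apply]
      simp only [smul_commA, smul_smul]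
      simp [← Prod.one_eq_mk]
  · intro v w
    dsimp only [id]
    rw [tmul_eq_iff]
    constructor
    · rintro ⟨h, a, h1, rfl⟩
      rw [MonoidHom.inr_apply, smulA_tmk, smul_tmk, Prod.mk_mul_mk, tmk_diag_eq_iff] at h1
      obtain ⟨h3, h4⟩ := h1
      have h5 : h = 1 := by simpa using h3
      have h6 : a = 1 := by simpa using h4.symm
      subst h5 h6
      simp [← Prod.one_eq_mk]
    · rintro rfl
      exact ⟨1, 1, by simp [← Prod.one_eq_mk]⟩
  · rintro ⟨g, h⟩ v
    refine ⟨(g, h) • v, ?_, rfl⟩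
    rw [smul_tmul]
    rw [tmul_eq_iff]
    refine ⟨g⁻¹, 1, ?_, ?_⟩
    · rw [MonoidHom.inr_apply, smulA_tmk, smul_tmk]
      simp only [MonoidHom.comp_apply, MonoidHom.inl_apply, MonoidHom.coe_fst]
      rw [smul_tmk, Prod.mk_mul_mk, Prod.mk_mul_mk, tmk_diag_eq_iff]
      simp
    · simp [smul_smul]
  · rintro a v
    refine ⟨a • v, ?_, rfl⟩
    rw [smulA_tmul]
    rw [tmul_eq_iff]
    refine ⟨1, a⁻¹, ?_, ?_⟩
    · rw [smulA_tmk, smulA_tmk]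
      simp [← Prod.one_eq_mk]
    · simp [← Prod.one_eq_mk]

theorem tensor_one [Finite H] (V : FSet A (G × H)) :
    Nonempty (V.tensor (transitive (FibPair.diag A H)) ≅ V) := by
  have hfree : ∀ v : V, IsFree V (transitive (FibPair.diag A H)) (MonoidHom.inr G H)
      (MonoidHom.inl H H) v (tmk _ (1, 1) 1) := by
    intro v
    rw [isFree_iff]
    intro h a b h2 h1
    rw [rel_stab, MonoidHom.inl_apply, smul_tmk, smulA_tmk, Prod.mk_mul_mk,
      tmk_diag_eq_iff] at h1
    obtain ⟨h3, h4⟩ := h1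
    have h5 : h = 1 := by simpa using h3
    subst h5
    have := h2.unique (b := 1) ((rel_stab _ _ _ _).2 (by simp [← Prod.one_eq_mk]))
    rw [this, one_mul, ← mul_one b, ← h4]
  refine nonempty_iso_of_param (P := V) (fun v => tmul v (tmk _ (1, 1) 1) (hfree v)) id ?_
    Function.surjective_id ?_ ?_ ?_
  · intro z
    obtain ⟨v, t, h, rfl⟩ := exists_tmul z
    obtain ⟨g, a, -, rfl⟩ := one_tmk_diag t
    refine ⟨((1 : G), g) • a • v, ?_⟩
    dsimp only
    rw [tmul_eq_iff]
    refine ⟨g⁻¹, a, ?_, ?_⟩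
    · rw [MonoidHom.inr_apply]
      simp only [smul_commA, smul_smul]
      simp [← Prod.one_eq_mk]
    · rw [MonoidHom.inl_apply, smulA_tmk, smul_tmk]; simp
  · intro v w
    dsimp only [id]
    rw [tmul_eq_iff]
    constructor
    · rintro ⟨h, a, rfl, h1⟩
      rw [MonoidHom.inl_apply, smulA_tmk, smul_tmk, Prod.mk_mul_mk, tmk_diag_eq_iff] at h1
      obtain ⟨h3, h4⟩ := h1
      have h5 : h = 1 := by simpa using h3.symm
      have h6 : a = 1 := by simpa using h4.symm
      subst h5 h6
      simp [← Prod.one_eq_mk]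
    · rintro rfl
      exact ⟨1, 1, by simp [← Prod.one_eq_mk]⟩
  · rintro ⟨g, h⟩ v
    refine ⟨(g, h) • v, ?_, rfl⟩
    rw [smul_tmul]
    rw [tmul_eq_iff]
    refine ⟨h⁻¹, 1, ?_, ?_⟩
    · simp [smul_smul]
    · simp only [MonoidHom.comp_apply, MonoidHom.inr_apply, MonoidHom.coe_snd, MonoidHom.inl_apply]
      rw [smulA_tmk, smul_tmk, smul_tmk, Prod.mk_mul_mk, Prod.mk_mul_mk, tmk_diag_eq_iff]
      simp
  · rintro a v
    refine ⟨a • v, ?_, rfl⟩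
    rw [smulA_tmul]

theorem empty_of_isEmpty {Γ : Type u} [Group Γ] (X : FSet A Γ) [IsEmpty X] :
    Nonempty (X ≅ empty A Γ) :=
  ⟨isoOf (Equiv.equivOfIsEmpty X PEmpty) (fun _ x => isEmptyElim x) (fun _ x => isEmptyElim x)⟩

theorem empty_tensor (V : FSet A (H × K)) :
    Nonempty ((empty A (G × H)).tensor V ≅ empty A (G × K)) := by
  have : IsEmpty ((empty A (G × H)).tensor V) :=
    ⟨fun z => by obtain ⟨x, _⟩ := exists_tmul z; exact PEmpty.elim x⟩
  exact empty_of_isEmpty _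

theorem tensor_empty (V : FSet A (G × H)) :
    Nonempty (V.tensor (empty A (H × K)) ≅ empty A (G × K)) := by
  have : IsEmpty (V.tensor (empty A (H × K))) :=
    ⟨fun z => by obtain ⟨_, x, _⟩ := exists_tmul z; exact PEmpty.elim x⟩
  exact empty_of_isEmpty _

end Bisets

end FSet
/-! ### The Burnside groups `B^A_R` and composition -/

open scoped TensorProduct

section Burnside

/-- The group `B^A(Γ)`, the Grothendieck group of the isomorphism classes of `A`-fibered
`Γ`-sets with respect to disjoint unions. -/
abbrev Burnside (A Γ : Type u) [CommGroup A] [Group Γ] : Type (u + 1) :=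
  Algebra.GrothendieckAddGroup (FClass A Γ)

/-- `B^A_R(Γ) = R ⊗ B^A(Γ)`. -/
abbrev BurnsideR (R : Type v) [CommRing R] (A Γ : Type u) [CommGroup A] [Group Γ] :
    Type (max (u + 1) v) := R ⊗[ℤ] Burnside A Γ

variable (R : Type v) [CommRing R] {A Γ G H K L : Type u} [CommGroup A] [Group Γ] [Group G]
  [Group H] [Group K] [Group L]

/-- The class of an isomorphism class in `B^A_R(Γ)`, as an additive map. -/
noncomputable def BurnsideR.clHom : FClass A Γ →+ BurnsideR R A Γ :=
  (TensorProduct.mk ℤ R (Burnside A Γ) 1).toAddMonoidHom.comp Algebra.GrothendieckAddGroup.of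

/-- The class `[X]` in `B^A_R(Γ)`. -/
noncomputable def BurnsideR.cl (X : FSet A Γ) : BurnsideR R A Γ :=
  BurnsideR.clHom R (FClass.mk X)

theorem BurnsideR.cl_eq (X : FSet A Γ) : BurnsideR.cl R X =
    (1 : R) ⊗ₜ[ℤ] (Algebra.GrothendieckAddGroup.of (FClass.mk X) : Burnside A Γ) := rfl

theorem BurnsideR.cl_congr {X Y : FSet A Γ} (h : Nonempty (X ≅ Y)) : cl R X = cl R Y := by
  rw [cl, cl, FClass.sound h]

theorem lift_of {M N : Type*} [AddCommMonoid M] [AddCommGroup N] (f : M →+ N) (x : M) :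
    Algebra.GrothendieckAddGroup.lift f (Algebra.GrothendieckAddGroup.of x) = f x :=
  DFunLike.congr_fun (Algebra.GrothendieckAddGroup.lift.symm_apply_apply f) x

theorem Burnside.closure_eq_top : AddSubgroup.closure (Set.range fun X : FSet A Γ =>
    (Algebra.GrothendieckAddGroup.of (FClass.mk X) : Burnside A Γ)) = ⊤ := by
  rw [eq_top_iff]
  intro z _
  induction z using AddLocalization.ind with
  | _ z =>
    obtain ⟨x, y, hy⟩ := z
    obtain ⟨X, rfl⟩ := x.exists_mk
    obtain ⟨Y, rfl⟩ := y.exists_mk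
    have : AddLocalization.mk (FClass.mk X) ⟨FClass.mk Y, hy⟩ =
        (Algebra.GrothendieckAddGroup.of (FClass.mk X) : Burnside A Γ) -
          Algebra.GrothendieckAddGroup.of (FClass.mk Y) := by
      rw [eq_sub_iff_add_eq]
      simp only [Algebra.GrothendieckAddGroup.of]
      change _ + AddLocalization.mk _ _ = AddLocalization.mk _ _
      rw [AddLocalization.mk_add, AddLocalization.mk_eq_mk_iff, AddLocalization.r_iff_exists]
      exact ⟨0, by simp [add_comm]⟩
    rw [this]
    exact sub_mem (AddSubgroup.subset_closure ⟨X, rfl⟩) (AddSubgroup.subset_closure ⟨Y, rfl⟩)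

theorem BurnsideR.span_eq_top : Submodule.span R (Set.range (BurnsideR.cl R (A := A) (Γ := Γ))) =
    ⊤ := by
  rw [eq_top_iff]
  intro z _
  induction z using TensorProduct.induction_on with
  | zero => exact zero_mem _
  | add x y hx hy => exact add_mem (hx trivial) (hy trivial)
  | tmul r x =>
    have hx : x ∈ AddSubgroup.closure (Set.range fun X : FSet A Γ =>
      (Algebra.GrothendieckAddGroup.of (FClass.mk X) : Burnside A Γ)) := by
      rw [Burnside.closure_eq_top]; trivial
    have e : r ⊗ₜ[ℤ] x = r • ((1 : R) ⊗ₜ[ℤ] x) := by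
      rw [TensorProduct.smul_tmul', smul_eq_mul, mul_one]
    rw [e]
    refine Submodule.smul_mem _ _ ?_
    induction hx using AddSubgroup.closure_induction with
    | mem x hx =>
      obtain ⟨X, rfl⟩ := hx
      exact Submodule.subset_span ⟨X, rfl⟩
    | zero => rw [TensorProduct.tmul_zero]; exact zero_mem _
    | add x y _ _ hx hy =>
      rw [TensorProduct.tmul_add]
      exact add_mem (hx trivial (by rw [TensorProduct.smul_tmul', smul_eq_mul, mul_one]))
        (hy trivial (by rw [TensorProduct.smul_tmul', smul_eq_mul, mul_one]))
    | neg x _ hx =>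
      rw [TensorProduct.tmul_neg]
      exact neg_mem (hx trivial (by rw [TensorProduct.smul_tmul', smul_eq_mul, mul_one]))

/-- The map on isomorphism classes induced by the tensor product. -/
def FClass.tensor (x : FClass A (G × H)) (y : FClass A (H × K)) : FClass A (G × K) :=
  Quotient.map₂ FSet.tensor (by
    rintro U U' ⟨e⟩ V V' ⟨f⟩
    exact FSet.balanced_congr e f) x y

theorem FClass.mk_tensor (U : FSet A (G × H)) (V : FSet A (H × K)) :
    FClass.tensor (FClass.mk U) (FClass.mk V) = FClass.mk (U.tensor V) := rfl

/-- The tensor product as a biadditive map. -/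
def FClass.tensorHom : FClass A (G × H) →+ FClass A (H × K) →+ FClass A (G × K) where
  toFun x :=
    { toFun := x.tensor
      map_zero' := by
        obtain ⟨U, rfl⟩ := x.exists_mk
        exact FClass.sound (FSet.tensor_empty U)
      map_add' := by
        intro y z
        obtain ⟨U, rfl⟩ := x.exists_mk
        obtain ⟨V, rfl⟩ := y.exists_mk
        obtain ⟨W, rfl⟩ := z.exists_mk
        exact (FClass.sound (FSet.balanced_sum_right V W)).symm }
  map_zero' := by
    ext y
    obtain ⟨V, rfl⟩ := y.exists_mk
    exact FClass.sound (FSet.empty_tensor V)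
  map_add' x y := by
    ext z
    obtain ⟨U, rfl⟩ := x.exists_mk
    obtain ⟨V, rfl⟩ := y.exists_mk
    obtain ⟨W, rfl⟩ := z.exists_mk
    exact (FClass.sound (FSet.balanced_sum_left U V)).symm

/-- The composition `B^A(G, H) × B^A(H, K) → B^A(G, K)`. -/
noncomputable def Burnside.compHom :
    Burnside A (G × H) →+ Burnside A (H × K) →+ Burnside A (G × K) :=
  Algebra.GrothendieckAddGroup.lift
    { toFun := fun x => Algebra.GrothendieckAddGroup.lift
        (Algebra.GrothendieckAddGroup.of.comp (FClass.tensorHom x))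
      map_zero' := by
        rw [← Equiv.eq_symm_apply]
        ext y
        simp [Algebra.GrothendieckAddGroup.lift_symm_apply]
      map_add' := fun x y => by
        rw [← Equiv.eq_symm_apply]
        ext z
        simp only [Algebra.GrothendieckAddGroup.lift_symm_apply, AddMonoidHom.comp_apply,
          AddMonoidHom.add_apply, map_add, lift_of] }

theorem Burnside.compHom_of (x : FClass A (G × H)) (y : FClass A (H × K)) :
    Burnside.compHom (Algebra.GrothendieckAddGroup.of x) (Algebra.GrothendieckAddGroup.of y) =
      Algebra.GrothendieckAddGroup.of (x.tensor y) := by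
  rw [compHom, lift_of]
  exact lift_of _ _

/-- The `R`-bilinear composition `B^A_R(G, H) × B^A_R(H, K) → B^A_R(G, K)`. -/
noncomputable def BurnsideR.comp :
    BurnsideR R A (G × H) →ₗ[R] BurnsideR R A (H × K) →ₗ[R] BurnsideR R A (G × K) :=
  LinearMap.liftBaseChange R (AddMonoidHom.toIntLinearMap
    (AddMonoidHom.mk' (fun x => (Burnside.compHom x).toIntLinearMap.baseChange R) fun x y => by
      rw [← LinearMap.baseChange_add]
      congr 1
      ext z
      simp))

theorem BurnsideR.comp_cl (U : FSet A (G × H)) (V : FSet A (H × K)) :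
    BurnsideR.comp R (BurnsideR.cl R U) (BurnsideR.cl R V) = BurnsideR.cl R (U.tensor V) := by
  rw [cl_eq, cl_eq, cl_eq, comp, LinearMap.liftBaseChange_tmul, one_smul]
  change LinearMap.baseChange R _ _ = _
  rw [LinearMap.baseChange_tmul]
  change (1 : R) ⊗ₜ[ℤ] (Burnside.compHom _ _) = _
  rw [Burnside.compHom_of]
  rfl

theorem BurnsideR.induction {p : BurnsideR R A Γ → Prop} (x : BurnsideR R A Γ)
    (h : ∀ X, p (cl R X)) (h0 : p 0) (hadd : ∀ x y, p x → p y → p (x + y))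
    (hsmul : ∀ (r : R) x, p x → p (r • x)) : p x := by
  have hx : x ∈ Submodule.span R (Set.range (BurnsideR.cl R (A := A) (Γ := Γ))) := by
    rw [span_eq_top]; trivial
  induction hx using Submodule.span_induction with
  | mem x hx => obtain ⟨X, rfl⟩ := hx; exact h X
  | zero => exact h0
  | add x y _ _ hx hy => exact hadd x y hx hy
  | smul r x _ hx => exact hsmul r x hx

theorem BurnsideR.comp_assoc (x : BurnsideR R A (G × H)) (y : BurnsideR R A (H × K))
    (z : BurnsideR R A (K × L)) : comp R (comp R x y) z = comp R x (comp R y z) := by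
  induction x using BurnsideR.induction with
  | h0 => simp
  | hadd x x' hx hx' => simp only [map_add, LinearMap.add_apply, hx, hx']
  | hsmul r x hx => simp only [map_smul, LinearMap.smul_apply, hx]
  | h U =>
    induction y using BurnsideR.induction with
    | h0 => simp
    | hadd x x' hx hx' => simp only [map_add, LinearMap.add_apply, hx, hx']
    | hsmul r x hx => simp only [map_smul, LinearMap.smul_apply, hx]
    | h V =>
      induction z using BurnsideR.induction with
      | h0 => simp
      | hadd x x' hx hx' => simp only [map_add, hx, hx']
      | hsmul r x hx => simp only [map_smul, hx]
      | h W =>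
        simp only [comp_cl]
        exact cl_congr R (FSet.tensor_assoc U V W)

/-- The class `[Γ / (U, φ)]`. -/
noncomputable def BurnsideR.tr [Finite Γ] (p : FibPair A Γ) : BurnsideR R A Γ :=
  cl R (FSet.transitive p)

theorem BurnsideR.one_comp [Finite G] (x : BurnsideR R A (G × H)) :
    comp R (tr R (FibPair.diag A G)) x = x := by
  induction x using BurnsideR.induction with
  | h0 => simp
  | hadd x x' hx hx' => simp only [map_add, hx, hx']
  | hsmul r x hx => simp only [map_smul, hx]
  | h U =>
    rw [tr, comp_cl]
    exact cl_congr R (FSet.one_tensor U)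

theorem BurnsideR.comp_one [Finite H] (x : BurnsideR R A (G × H)) :
    comp R x (tr R (FibPair.diag A H)) = x := by
  induction x using BurnsideR.induction with
  | h0 => simp
  | hadd x x' hx hx' => simp only [map_add, LinearMap.add_apply, hx, hx']
  | hsmul r x hx => simp only [map_smul, LinearMap.smul_apply, hx]
  | h U =>
    rw [tr, comp_cl]
    exact cl_congr R (FSet.tensor_one U)

/-- The `R`-submodule of `B^A_R(Γ)` spanned by the classes `[Γ / (U, φ)]` with `(U, φ) ∈ S`. -/
noncomputable def BurnsideR.spanOf [Finite Γ] (S : Set (FibPair A Γ)) :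
    Submodule R (BurnsideR R A Γ) := Submodule.span R (BurnsideR.tr R '' S)

/-- If all stabilizing pairs of `X` are in `S`, then `[X]` is a sum of the `[Γ / (U, φ)]` with
`(U, φ) ∈ S`. -/
theorem BurnsideR.cl_mem_spanOf [Finite Γ] (S : Set (FibPair A Γ)) (X : FSet A Γ)
    (hX : ∀ x : X, X.stab x ∈ S) : cl R X ∈ spanOf R S := by
  have h := FClass.mem_closure_transitive S X hX
  have : ∀ y ∈ AddSubmonoid.closure {y | ∃ p ∈ S, y = FClass.mk (FSet.transitive p)},
      clHom R y ∈ spanOf R S := by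
    intro y hy
    induction hy using AddSubmonoid.closure_induction with
    | mem y hy =>
      obtain ⟨p, hp, rfl⟩ := hy
      exact Submodule.subset_span ⟨p, hp, rfl⟩
    | zero => rw [map_zero]; exact zero_mem _
    | add y z _ _ hy hz => rw [map_add]; exact add_mem hy hz
  exact this _ h

end Burnside

section Cat

variable (R : Type v) [CommRing R] {Ω A : Type u} [CommGroup A]

theorem BurnsideR.comp_mem {D : Datum Ω A} (hD : D.IsCategorical) {G H K : FinGroup Ω}
    (hG : D.𝒢 G) (hH : D.𝒢 H) (hK : D.𝒢 K) {x : BurnsideR R A (G × H)}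
    {y : BurnsideR R A (H × K)} (hx : x ∈ spanOf R (D.𝒮 G H)) (hy : y ∈ spanOf R (D.𝒮 H K)) :
    comp R x y ∈ spanOf R (D.𝒮 G K) := by
  induction hx using Submodule.span_induction with
  | zero => simp
  | add x x' _ _ hx hx' =>
    simp only [map_add, LinearMap.add_apply]
    exact add_mem hx hx'
  | smul r x _ hx =>
    simp only [map_smul, LinearMap.smul_apply]
    exact Submodule.smul_mem _ _ hx
  | mem x hx =>
    obtain ⟨p, hp, rfl⟩ := hx
    induction hy using Submodule.span_induction with
    | zero => simp
    | add x x' _ _ hx hx' =>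
      simp only [map_add]
      exact add_mem hx hx'
    | smul r x _ hx =>
      simp only [map_smul]
      exact Submodule.smul_mem _ _ hx
    | mem y hy =>
      obtain ⟨q, hq, rfl⟩ := hy
      rw [tr, tr, comp_cl]
      refine cl_mem_spanOf R _ _ fun z => ?_
      obtain ⟨u, v, h, rfl⟩ := FSet.exists_tmul z
      rw [FSet.stab_tensor]
      refine hD.star_mem G H K hG hH hK _ ?_ _ ?_ _
      · obtain ⟨γ, a, rfl⟩ := FSet.exists_tmk _ u
        rw [FSet.stab_tmk]
        exact hD.conj_mem G H hG hH p hp γ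
      · obtain ⟨γ, a, rfl⟩ := FSet.exists_tmk _ v
        rw [FSet.stab_tmk]
        exact hD.conj_mem H K hH hK q hq γ

/-- The category `𝒞(𝒢, 𝒮)` (with coefficients in `R`). -/
structure DCat (R : Type v) [CommRing R] (D : Datum Ω A) where
  obj : FinGroup Ω
  mem : D.𝒢 obj

variable {R} {D : Datum Ω A} [hD : D.IsCategorical]

/-- `Hom(H, G)` is the `R`-span of the classes `[G × H / (U, φ)]` with `(U, φ) ∈ 𝒮(G, H)` in
`B^A_R(G, H)`.  The composite of `y : K → H` and `x : H → G` is `x ⊗_{AH} y`. -/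
noncomputable instance : Category (DCat R D) where
  Hom H G := BurnsideR.spanOf R (D.𝒮 G.obj H.obj)
  id G := ⟨BurnsideR.tr R (FibPair.diag A G.obj),
    Submodule.subset_span ⟨_, hD.diag_mem _ G.mem, rfl⟩⟩
  comp {K H G} y x := ⟨BurnsideR.comp R x.1 y.1,
    BurnsideR.comp_mem R hD G.mem H.mem K.mem x.2 y.2⟩
  id_comp x := Subtype.ext (BurnsideR.comp_one R x.1)
  comp_id x := Subtype.ext (BurnsideR.one_comp R x.1)
  assoc x y z := Subtype.ext (BurnsideR.comp_assoc R z.1 y.1 x.1).symm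

noncomputable instance : Preadditive (DCat R D) where
  homGroup H G := inferInstanceAs (AddCommGroup (BurnsideR.spanOf R (D.𝒮 G.obj H.obj)))
  add_comp _ _ _ x x' y := Subtype.ext (map_add (BurnsideR.comp R y.1) x.1 x'.1)
  comp_add _ _ _ x y y' := Subtype.ext (by
    change BurnsideR.comp R (y.1 + y'.1) x.1 = BurnsideR.comp R y.1 x.1 + BurnsideR.comp R y'.1 x.1
    rw [map_add, LinearMap.add_apply])

noncomputable instance : Linear R (DCat R D) where
  homModule H G := inferInstanceAs (Module R (BurnsideR.spanOf R (D.𝒮 G.obj H.obj)))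
  smul_comp _ _ _ r x y := Subtype.ext (map_smul (BurnsideR.comp R y.1) r x.1)
  comp_smul _ _ _ x r y := Subtype.ext (by
    change BurnsideR.comp R (r • y.1) x.1 = r • BurnsideR.comp R y.1 x.1
    rw [map_smul, LinearMap.smul_apply])

/-- The morphism `[U] : H → G` given by an `A`-fibered `(G, H)`-biset `U` all of whose stabilizing
pairs are in `𝒮(G, H)`. -/
noncomputable def DCat.homOf {G H : DCat R D} (U : FSet A (G.obj × H.obj))
    (hU : ∀ u : U, U.stab u ∈ D.𝒮 G.obj H.obj) : H ⟶ G :=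
  ⟨BurnsideR.cl R U, BurnsideR.cl_mem_spanOf R _ U hU⟩

/-- The morphism `[G × H / (U, φ)] : H → G` for `(U, φ) ∈ 𝒮(G, H)`. -/
noncomputable def DCat.homTr {G H : DCat R D} (p : FibPair A (G.obj × H.obj))
    (hp : p ∈ D.𝒮 G.obj H.obj) : H ⟶ G :=
  ⟨BurnsideR.tr R p, Submodule.subset_span ⟨p, hp, rfl⟩⟩

variable (R D)

/-- The category `𝓕^A_{𝒟,R}` of fibered biset functors on `𝒟 = 𝒞(𝒢, 𝒮)` over `R`: the `R`-linear
functors from `𝒟` to the category of `R`-modules. -/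
abbrev FibFunctor : Type _ :=
  ObjectProperty.FullSubcategory (fun F : DCat R D ⥤ ModuleCat.{w} R =>
    F.Additive ∧ F.Linear R)

end Cat
section Mackey

variable {A G H K : Type u} [CommGroup A] [Group G] [Group H] [Group K]

/-- The Mackey formula when there is only one double coset. -/
theorem FSet.tensor_transitive [Finite G] [Finite H] [Finite K] (p : FibPair A (G × H))
    (q : FibPair A (H × K)) (hc : FibPair.Compat p q)
    (hpq : ∀ h : H, ∃ x y, (∃ g, (g, x) ∈ p.sub) ∧ (∃ k, (y, k) ∈ q.sub) ∧ x * y = h) :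
    Nonempty (FSet.transitive (p.star q hc) ≅ (FSet.transitive p).tensor (FSet.transitive q)) := by
  have hp : (FSet.transitive p).stab (FSet.tmk p 1 1) = p := by
    rw [FSet.stab_tmk]
    exact FibPair.ext_rel fun x a => by rw [FibPair.rel_conj]; simp
  have hq : (FSet.transitive q).stab (FSet.tmk q 1 1) = q := by
    rw [FSet.stab_tmk]
    exact FibPair.ext_rel fun x a => by rw [FibPair.rel_conj]; simp
  have hfree : FSet.IsFree (FSet.transitive p) (FSet.transitive q) (MonoidHom.inr G H)
      (MonoidHom.inl H K) (FSet.tmk p 1 1) (FSet.tmk q 1 1) := by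
    rw [FSet.isFree_iff, hp, hq]
    exact (FibPair.compat_iff p q).1 hc
  have hs : ((FSet.transitive p).tensor (FSet.transitive q)).stab (FSet.tmul _ _ hfree) =
      p.star q hc := by
    rw [FSet.stab_tensor]
    apply FibPair.ext_rel
    intro x a
    rw [FibPair.rel_star, FibPair.rel_star, hp, hq]
  rw [← hs]
  refine FSet.nonempty_iso_transitive _ _ fun z => ?_
  obtain ⟨s, t, h, rfl⟩ := FSet.exists_tmul z
  obtain ⟨⟨g, x⟩, a, rfl⟩ := FSet.exists_tmk _ s
  obtain ⟨⟨y, k⟩, b, rfl⟩ := FSet.exists_tmk _ t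
  obtain ⟨x0, y0, ⟨g0, h1⟩, ⟨k0, h2⟩, h3⟩ := hpq (x⁻¹ * y)
  obtain ⟨c, h1⟩ : ∃ c, p.Rel (g0, x0) c := ⟨_, p.rel_chr h1⟩
  obtain ⟨d, h2⟩ : ∃ d, q.Rel (y0, k0) d := ⟨_, q.rel_chr h2⟩
  obtain rfl : y = x * (x0 * y0) := by rw [h3, mul_inv_cancel_left]
  refine ⟨(g * g0, k * k0⁻¹), c⁻¹ * d * a * b, ?_⟩
  rw [FSet.smulA_tmul, FSet.smul_tmul, FSet.tmul_eq_iff]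
  refine ⟨x0⁻¹ * x⁻¹, b⁻¹ * d⁻¹, ?_, ?_⟩
  · simp only [FSet.smulA_tmk, FSet.smul_tmk, MonoidHom.comp_apply, MonoidHom.inl_apply,
      MonoidHom.coe_fst, MonoidHom.inr_apply, Prod.mk_mul_mk, mul_one, one_mul]
    rw [FSet.tmk_eq_iff]
    convert! h1.inv using 1
    · simp
    · simp only [mul_inv_rev, inv_inv]
      rw [show c⁻¹ * d * a * b = c⁻¹ * (d * a * b) by simp only [mul_assoc],
        show a⁻¹ * (b⁻¹ * d⁻¹) = (d * a * b)⁻¹ by simp only [mul_inv_rev]; simp only [mul_comm, mul_left_comm, mul_assoc], mul_inv_cancel_right]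
  · simp only [FSet.smulA_tmk, FSet.smul_tmk, MonoidHom.comp_apply, MonoidHom.inl_apply,
      MonoidHom.coe_snd, MonoidHom.inr_apply, Prod.mk_mul_mk, mul_one, one_mul]
    rw [FSet.tmk_eq_iff]
    convert! h2 using 1
    · simp [mul_assoc]
    · simp [mul_comm]

end Mackey
section HomTr

variable {R : Type v} [CommRing R] {Ω A : Type u} [CommGroup A] {D : Datum Ω A}
  [hD : D.IsCategorical]

theorem DCat.homTr_comp {G H K : FinGroup Ω} (hG : D.𝒢 G) (hH : D.𝒢 H) (hK : D.𝒢 K)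
    {p : FibPair A (G × H)} {q : FibPair A (H × K)} {r : FibPair A (G × K)} (hp : p ∈ D.𝒮 G H)
    (hq : q ∈ D.𝒮 H K) (hr : r ∈ D.𝒮 G K) (hc : FibPair.Compat p q)
    (hpq : ∀ h : H, ∃ x y, (∃ g, (g, x) ∈ p.sub) ∧ (∃ k, (y, k) ∈ q.sub) ∧ x * y = h)
    (hrel : ∀ g k a, r.Rel (g, k) a ↔ ∃ h b c, p.Rel (g, h) b ∧ q.Rel (h, k) c ∧ a = b * c) :
    DCat.homTr (R := R) (G := ⟨H, hH⟩) (H := ⟨K, hK⟩) q hq ≫ DCat.homTr (G := ⟨G, hG⟩) p hp =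
      DCat.homTr r hr := by
  obtain rfl : r = p.star q hc := by
    apply FibPair.ext_rel
    rintro ⟨g, k⟩ a
    rw [hrel, FibPair.rel_star]
  apply Subtype.ext
  change BurnsideR.comp R (BurnsideR.tr R p) (BurnsideR.tr R q) = BurnsideR.tr R _
  rw [BurnsideR.tr, BurnsideR.tr, BurnsideR.tr, BurnsideR.comp_cl]
  obtain ⟨e⟩ := FSet.tensor_transitive p q hc hpq
  exact BurnsideR.cl_congr R ⟨e.symm⟩

/-- A subgroup of `G` that belongs to `𝒢`, as an object. -/
abbrev DCat.sub (G : DCat R D) (P : Subgroup G.obj) (hP : D.𝒢 (G.obj.sub P)) : DCat R D :=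
  ⟨G.obj.sub P, hP⟩

/-- The identity morphism between equal subgroups of `G`. -/
noncomputable def DCat.transport (G : DCat R D) {P Q : Subgroup G.obj} (e : P = Q)
    (hP : D.𝒢 (G.obj.sub P)) (hQ : D.𝒢 (G.obj.sub Q)) : G.sub P hP ⟶ G.sub Q hQ :=
  eqToHom (by subst e; rfl)

@[simp] theorem DCat.transport_rfl (G : DCat R D) {P : Subgroup G.obj}
    (hP : D.𝒢 (G.obj.sub P)) (hQ : D.𝒢 (G.obj.sub P)) :
    G.transport rfl hP hQ = 𝟙 (G.sub P hP) := rfl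

theorem DCat.transport_trans (G : DCat R D) {P Q L : Subgroup G.obj} (e : P = Q) (e' : Q = L)
    (hP : D.𝒢 (G.obj.sub P)) (hQ : D.𝒢 (G.obj.sub Q)) (hL : D.𝒢 (G.obj.sub L)) :
    G.transport e hP hQ ≫ G.transport e' hQ hL = G.transport (e.trans e') hP hL := by
  subst e e'
  exact Category.id_comp _

/-- For subgroups `P` and `Q = gPg⁻¹` of `G`, the pair `({(c_g(x), x) | x ∈ P}, 1)`, where
`c_g : P → Q` is conjugation by `g`. -/
def FibPair.conjGraph (A : Type u) [CommGroup A] (G : FinGroup Ω) (P Q : Subgroup G) (g : G) :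
    FibPair A (G.sub Q × G.sub P) where
  sub :=
    { carrier := {z | G.incl Q z.1 = g * G.incl P z.2 * g⁻¹}
      one_mem' := by simp
      mul_mem' := by
        intro x y hx hy
        simp only [Set.mem_ofPred_eq, Prod.fst_mul, Prod.snd_mul, map_mul] at hx hy ⊢
        rw [hx, hy]
        group
      inv_mem' := by
        intro x hx
        simp only [Set.mem_ofPred_eq, Prod.fst_inv, Prod.snd_inv, map_inv] at hx ⊢
        rw [hx]
        group }
  chr := 1

theorem FibPair.rel_conjGraph (G : FinGroup Ω) (P Q : Subgroup G) (g : G) (z : G.sub Q × G.sub P)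
    (a : A) : (FibPair.conjGraph A G P Q g).Rel z a ↔
      G.incl Q z.1 = g * G.incl P z.2 * g⁻¹ ∧ a = 1 := by
  constructor
  · rintro ⟨h, rfl⟩
    exact ⟨h, rfl⟩
  · rintro ⟨h, rfl⟩
    exact ⟨h, rfl⟩

end HomTr

section Gamma

variable {R : Type v} [CommRing R] {Ω A : Type u} [CommGroup A] {D : Datum Ω A}
  [hD : D.IsPlusCategorical]

theorem conjGraph_mem {G : FinGroup Ω} (hG : D.𝒢 G)
    {P Q : Subgroup G} (g : G) (hP : D.𝒢 (G.sub P)) (hPQ : ∀ x, x ∈ Q ↔ g⁻¹ * x * g ∈ P) :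
    FibPair.conjGraph A G P Q g ∈ D.𝒮 (G.sub Q) (G.sub P) := by
  refine (hD.conjIso_mem hG P Q hP g hPQ _ ?_).2
  intro x a
  rw [FibPair.rel_conjGraph]
  refine and_congr_left fun _ => ?_
  constructor
  · intro h; rw [h]; group
  · intro h; rw [← h]; group

/-- The morphism `iso(c_g) : P → Q`, for subgroups `P` and `Q = gPg⁻¹` of `G` that belong
to `𝒢`. -/
noncomputable def DCat.conjHom (G : DCat R D) {P Q : Subgroup G.obj} (g : G.obj)
    (hP : D.𝒢 (G.obj.sub P)) (hQ : D.𝒢 (G.obj.sub Q))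
    (hPQ : ∀ x, x ∈ Q ↔ g⁻¹ * x * g ∈ P) : G.sub P hP ⟶ G.sub Q hQ :=
  DCat.homTr (FibPair.conjGraph A G.obj P Q g) (conjGraph_mem G.mem g hP hPQ)

theorem DCat.conjHom_transport (G : DCat R D) {P Q P' Q' : Subgroup G.obj}
    (g : G.obj) (hP : D.𝒢 (G.obj.sub P)) (hQ : D.𝒢 (G.obj.sub Q))
    (hP' : D.𝒢 (G.obj.sub P')) (hQ' : D.𝒢 (G.obj.sub Q')) (hPQ : ∀ x, x ∈ Q ↔ g⁻¹ * x * g ∈ P)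
    (hPQ' : ∀ x, x ∈ Q' ↔ g⁻¹ * x * g ∈ P') (e : P = P') (e' : Q = Q') :
    G.conjHom g hP hQ hPQ ≫ G.transport e' hQ hQ' =
      G.transport e hP hP' ≫ G.conjHom g hP' hQ' hPQ' := by
  subst e e'
  simp only [transport_rfl, Category.id_comp]
  exact Category.comp_id _

/-- The condition that `G_x ∈ 𝒢` for all `x ∈ X`. -/
abbrev FSet.InClass (D : Datum Ω A) {G : FinGroup Ω} (X : FSet A G) : Prop :=
  ∀ x : X, D.𝒢 (G.sub (X.stabilizer x))

/-- The `R`-module of the `(G, A)`-invariant sections of `F` over `X`. -/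
noncomputable def Sec (F : FibFunctor.{u, v, w} R D)
    {G : DCat R D} (X : FSet A G.obj) (hX : X.InClass D) :
    Submodule R (∀ x : X, F.obj.obj (G.sub (X.stabilizer x) (hX x))) where
  carrier := {s | ∀ (g : G.obj) (a : A) (x : X),
    s (g • a • x) = F.obj.map (G.conjHom g (hX x) (hX (g • a • x))
      (X.mem_stabilizer_smul x g a)) (s x)}
  zero_mem' := fun g a x => by simp
  add_mem' := fun hs ht g a x => by simp [hs g a x, ht g a x]
  smul_mem' := fun r s hs g a x => by simp [hs g a x]

theorem Sec.inv {F : FibFunctor.{u, v, w} R D} {G : DCat R D} {X : FSet A G.obj}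
    {hX : X.InClass D} (s : Sec F X hX) (g : G.obj) (a : A) (x : X) :
    s.1 (g • a • x) = F.obj.map (G.conjHom g (hX x) (hX (g • a • x))
      (X.mem_stabilizer_smul x g a)) (s.1 x) := s.2 g a x

/-- The objects of the category `Γ_F(G)`. -/
structure Gam (F : FibFunctor.{u, v, w} R D) (G : DCat R D) where
  set : FSet A G.obj
  mem : set.InClass D
  sec : Sec F set mem

/-- The arrows of `Γ_F(G)`: equivariant maps `α` with `G_x = G_{α(x)}` and `t(α(x)) = s(x)`. -/
@[ext] structure Gam.Hom {F : FibFunctor.{u, v, w} R D}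
    {G : DCat R D} (X Y : Gam F G) where
  hom : X.set ⟶ Y.set
  stab : ∀ x, X.set.stabilizer x = Y.set.stabilizer (hom.toFun x)
  val : ∀ x, Y.sec.1 (hom.toFun x) =
    F.obj.map (G.transport (stab x) (X.mem x) (Y.mem (hom.toFun x))) (X.sec.1 x)

instance (F : FibFunctor.{u, v, w} R D) (G : DCat R D) :
    Category (Gam F G) where
  Hom := Gam.Hom
  id X := ⟨𝟙 _, fun _ => rfl, fun x => by
    change X.sec.1 x = F.obj.map (𝟙 _) (X.sec.1 x)
    rw [F.obj.map_id]; rfl⟩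
  comp {X Y Z} f g := ⟨f.hom ≫ g.hom, fun x => (f.stab x).trans (g.stab _), fun x => by
    have h1 := g.val (f.hom.toFun x)
    rw [f.val, ← ConcreteCategory.comp_apply, ← F.obj.map_comp, G.transport_trans] at h1
    exact h1⟩
  id_comp _ := rfl
  comp_id _ := rfl
  assoc _ _ _ := rfl

end Gamma
section GammaU

variable {R : Type v} [CommRing R] {Ω A : Type u} [CommGroup A] {D : Datum Ω A}
  [hD : D.IsPlusCategorical]

/-- The pair `((G × H)_u, φ_u) * (Δ(K), 1)`, regarded as an element of `M(P × K)`. -/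
noncomputable def FSet.actPair {G H : FinGroup Ω} {U : FSet A (G × H)} (u : U) (P : Subgroup G)
    (K : Subgroup H) : FibPair A (G.sub P × H.sub K) :=
  ((U.stab u).starDiag K).restrictLeft P

theorem FSet.rel_actPair {G H : FinGroup Ω} {U : FSet A (G × H)} (u : U) (P : Subgroup G)
    (K : Subgroup H) (x : G.sub P) (y : H.sub K) (a : A) :
    (FSet.actPair u P K).Rel (x, y) a ↔ (G.incl P x, H.incl K y) • u = a • u := by
  rw [actPair, FibPair.rel_restrictLeft, FibPair.rel_starDiag, rel_stab]

/-- All stabilizing pairs of the biset `U` are in `𝒮₊(G, H)`. -/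
abbrev FSet.InPlus (D : Datum Ω A) {G H : FinGroup Ω} (U : FSet A (G × H)) : Prop :=
  ∀ u : U, U.stab u ∈ D.plus.𝒮 G H

theorem FSet.actPair_mem {G H : FinGroup Ω} (hH : D.𝒢 H) {U : FSet A (G × H)} (hU : U.InPlus D)
    (u : U) {P : Subgroup G} {K : Subgroup H} (hK : D.𝒢 (H.sub K))
    (e : P = (U.stab u).starSubgroup K) :
    D.𝒢 (G.sub P) ∧ FSet.actPair u P K ∈ D.𝒮 (G.sub P) (H.sub K) := by
  obtain ⟨h1, h2⟩ := hU u
  obtain ⟨h3, h4⟩ := hD.restrict_mem _ _ h1 hH _ h2 K hK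
  refine D.mem_of_eq ((G.incl _).comp ((G.sub (U.stab u).p₁).incl _)) (G.incl P)
    (fun _ => rfl) (fun _ => rfl) ?_ h3 _ h4 _ ?_
  · subst e
    ext x
    constructor
    · rintro ⟨⟨hx, hx1⟩, hx2⟩
      refine ⟨hx, ?_⟩
      rw [FibPair.mem_starSubgroup] at hx2 ⊢
      exact hx2
    · rintro ⟨hx, hx1⟩
      rw [FibPair.mem_starSubgroup] at hx1
      obtain ⟨k, hk, hl⟩ := hx1
      refine ⟨⟨hx, (FibPair.mem_p₁ _ _).2 ⟨k, hl⟩⟩, ?_⟩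
      rw [FibPair.mem_starSubgroup]
      exact ⟨k, hk, hl⟩
  · intro x x' y a hxx
    have e' : G.incl _ ((G.sub (U.stab u).p₁).incl _ x) = G.incl P x' := Subtype.ext hxx
    rw [FSet.rel_actPair, FibPair.rel_restrictLeft, FibPair.rel_starDiag, FibPair.rel_restrictLeft,
      FSet.rel_stab]
    dsimp only
    rw [e']

/-- For `P = (G × H)_u * K`, the morphism `[P × K / ((G × H)_u, φ_u) * (Δ(K), 1)] : K → P`
of `𝒟`. -/
noncomputable def DCat.actHom {G H : DCat R D} {U : FSet A (G.obj × H.obj)} (hU : U.InPlus D)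
    (u : U) {P : Subgroup G.obj} {K : Subgroup H.obj} (hP : D.𝒢 (G.obj.sub P))
    (hK : D.𝒢 (H.obj.sub K)) (e : P = (U.stab u).starSubgroup K) : H.sub K hK ⟶ G.sub P hP :=
  DCat.homTr (FSet.actPair u P K) (FSet.actPair_mem H.mem hU u hK e).2

theorem FSet.one_smul' {G H : Type u} [Group G] [Group H] {X : FSet A (G × H)} (x : X) :
    ((1 : G), (1 : H)) • x = x := by rw [← Prod.one_eq_mk, one_smul]

theorem FSet.smul_conj_iff {Γ : Type u} [Group Γ] {X : FSet A Γ} (γ δ : Γ) (a c : A) (x : X) :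
    (γ * δ * γ⁻¹) • γ • a • x = c • γ • a • x ↔ δ • x = c • x := by
  rw [smul_smul, inv_mul_cancel_right, mul_smul, FSet.smul_commA X δ, FSet.smul_commA X γ a,
    FSet.smul_commA X γ a, smul_comm c a, ← FSet.smul_commA X γ c,
    (MulAction.injective a).eq_iff, (MulAction.injective γ).eq_iff]

theorem DCat.conjHom_actHom {G H : DCat R D} {U : FSet A (G.obj × H.obj)} (hU : U.InPlus D)
    {u u' : U} {P : Subgroup G.obj} {K K' : Subgroup H.obj} (hP : D.𝒢 (G.obj.sub P))
    (hK : D.𝒢 (H.obj.sub K)) (hK' : D.𝒢 (H.obj.sub K')) (e : P = (U.stab u).starSubgroup K)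
    (e' : P = (U.stab u').starSubgroup K') (h : H.obj) (a : A)
    (hu : u' = ((1 : G.obj), h) • a • u) (hKK : ∀ x, x ∈ K' ↔ h⁻¹ * x * h ∈ K) :
    H.conjHom h hK hK' hKK ≫ DCat.actHom hU u' hP hK' e' = DCat.actHom hU u hP hK e := by
  refine DCat.homTr_comp (G := G.obj.sub P) (H := H.obj.sub K') (K := H.obj.sub K) hP hK' hK
    _ _ _ ?_ ?_ ?_
  · rw [FibPair.compat_iff]
    intro y b c hb hc'
    obtain ⟨h1, rfl⟩ := (FibPair.rel_conjGraph _ _ _ _ _ _).1 hc'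
    obtain rfl : y = 1 := (H.obj.incl_injective _) (by rw [h1]; simp)
    rw [FSet.rel_actPair] at hb
    simp only [map_one, FSet.one_smul'] at hb
    rw [mul_one]
    exact U.free _ _ u' (by rw [← hb, one_smul])
  · intro x
    refine ⟨1, x, ⟨1, one_mem _⟩, ⟨H.obj.toSub _ ((hKK _).1 (H.obj.incl_mem _ x)), ?_⟩, one_mul _⟩
    refine ((FibPair.rel_conjGraph H.obj K K' h _ (1 : A)).2 ⟨?_, rfl⟩).1
    simp only [FinGroup.incl_toSub]
    group
  · intro x y b
    have key : ∀ c : A, (FSet.actPair u P K).Rel (x, y) c ↔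
        (G.obj.incl P x, h * H.obj.incl K y * h⁻¹) • u' = c • u' := by
      intro c
      rw [FSet.rel_actPair, hu, ← FSet.smul_conj_iff ((1 : G.obj), h) _ a c u]
      simp
    rw [key]
    constructor
    · intro hb
      refine ⟨H.obj.toSub (h * H.obj.incl K y * h⁻¹) ?_, b, 1, ?_, ?_, (mul_one b).symm⟩
      · rw [hKK]
        have := H.obj.incl_mem K y
        convert! this using 1
        group
      · rw [FSet.rel_actPair]
        exact hb
      · exact (FibPair.rel_conjGraph _ _ _ _ _ _).2 ⟨rfl, rfl⟩
    · rintro ⟨z, b, c, h1, h2, rfl⟩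
      obtain ⟨h3, rfl⟩ := (FibPair.rel_conjGraph _ _ _ _ _ _).1 h2
      rw [FSet.rel_actPair] at h1
      dsimp only at h3
      rw [mul_one, ← h1, h3]

theorem DCat.actHom_conjHom {G H : DCat R D} {U : FSet A (G.obj × H.obj)} (hU : U.InPlus D)
    {u u' : U} {P P' : Subgroup G.obj} {K : Subgroup H.obj} (hP : D.𝒢 (G.obj.sub P))
    (hP' : D.𝒢 (G.obj.sub P'))
    (hK : D.𝒢 (H.obj.sub K)) (e : P = (U.stab u).starSubgroup K)
    (e' : P' = (U.stab u').starSubgroup K) (g : G.obj) (a : A)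
    (hu : u' = (g, (1 : H.obj)) • a • u) (hPP : ∀ x, x ∈ P' ↔ g⁻¹ * x * g ∈ P) :
    DCat.actHom hU u hP hK e ≫ G.conjHom g hP hP' hPP = DCat.actHom hU u' hP' hK e' := by
  refine DCat.homTr_comp (G := G.obj.sub P') (H := G.obj.sub P) (K := H.obj.sub K) hP' hP hK
    _ _ _ ?_ ?_ ?_
  · rw [FibPair.compat_iff]
    intro y b c hc' hb
    obtain ⟨h1, rfl⟩ := (FibPair.rel_conjGraph _ _ _ _ _ _).1 hc'
    obtain rfl : y = 1 := (G.obj.incl_injective _) (by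
      dsimp only at h1
      rw [map_one, eq_comm, conj_eq_one_iff] at h1
      rw [h1, map_one])
    rw [FSet.rel_actPair] at hb
    simp only [map_one, FSet.one_smul'] at hb
    rw [one_mul]
    exact U.free _ _ u (by rw [← hb, one_smul])
  · intro x
    refine ⟨x, 1, ⟨G.obj.toSub (g * G.obj.incl P x * g⁻¹) ?_, ?_⟩, ⟨1, one_mem _⟩, mul_one _⟩
    · rw [hPP]
      have := G.obj.incl_mem P x
      convert! this using 1
      group
    · exact ((FibPair.rel_conjGraph G.obj P P' g _ (1 : A)).2 ⟨rfl, rfl⟩).1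
  · intro x y b
    have key : ∀ z : G.obj.sub P, G.obj.incl P' x = g * G.obj.incl P z * g⁻¹ → ∀ c : A,
        ((FSet.actPair u' P' K).Rel (x, y) c ↔ (FSet.actPair u P K).Rel (z, y) c) := by
      intro z hz c
      rw [FSet.rel_actPair, FSet.rel_actPair, hu, hz,
        ← FSet.smul_conj_iff (g, (1 : H.obj)) (G.obj.incl P z, H.obj.incl K y) a c u]
      simp
    constructor
    · intro hb
      have hz : G.obj.incl P' x = g * G.obj.incl P (G.obj.toSub _
          ((hPP _).1 (G.obj.incl_mem P' x))) * g⁻¹ := by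
        rw [FinGroup.incl_toSub]; group
      exact ⟨_, 1, b, (FibPair.rel_conjGraph _ _ _ _ _ _).2 ⟨hz, rfl⟩, (key _ hz _).1 hb,
        (one_mul b).symm⟩
    · rintro ⟨z, b, c, h1, h2, rfl⟩
      obtain ⟨h3, rfl⟩ := (FibPair.rel_conjGraph G.obj P P' g (x, z) b).1 h1
      rw [one_mul]
      exact (key z h3 _).2 h2

theorem DCat.transport_actHom {G H : DCat R D} {U : FSet A (G.obj × H.obj)} (hU : U.InPlus D)
    (u : U) {P P' : Subgroup G.obj} {K K' : Subgroup H.obj} (hP : D.𝒢 (G.obj.sub P))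
    (hP' : D.𝒢 (G.obj.sub P')) (hK : D.𝒢 (H.obj.sub K)) (hK' : D.𝒢 (H.obj.sub K'))
    (e : P = (U.stab u).starSubgroup K) (e' : P' = (U.stab u).starSubgroup K')
    (eK : K = K') (eP : P = P') :
    H.transport eK hK hK' ≫ DCat.actHom hU u hP' hK' e' =
      DCat.actHom hU u hP hK e ≫ G.transport eP hP hP' := by
  subst eK eP
  exact (Category.id_comp _).trans (Category.comp_id _).symm

end GammaU
section GammaFunctor

variable {R : Type v} [CommRing R] {Ω A : Type u} [CommGroup A] {D : Datum Ω A}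
  [hD : D.IsPlusCategorical]

theorem FSet.InClass.act {G H : FinGroup Ω} (hH : D.𝒢 H) {U : FSet A (G × H)} (hU : U.InPlus D)
    {X : FSet A H} (hX : X.InClass D) : (U.act X).InClass D := by
  intro z
  obtain ⟨u, x, h, rfl⟩ := FSet.exists_tmul z
  exact (FSet.actPair_mem hH hU u (hX x) (FSet.stabilizer_act u x h)).1

theorem FSet.exists_act {G H : Type u} [Group G] [Group H] {U : FSet A (G × H)} {X : FSet A H}
    (z : U.act X) : ∃ (q : U.carrier × X.carrier) (h : FSet.ActFree U X q.1 q.2),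
      z = FSet.tmul q.1 q.2 h := by
  obtain ⟨u, x, h, rfl⟩ := FSet.exists_tmul z
  exact ⟨(u, x), h, rfl⟩

variable (F : FibFunctor.{u, v, w} R D) {G H : DCat R D} (U : FSet A (G.obj × H.obj))
  (hU : U.InPlus D)

/-- The values of `U(s)`, computed with a choice of a representative `(u, x)` of `u ⊗ x`; they do
not depend on the choice, see `actVal_tmul`. -/
noncomputable def actVal {X : FSet A H.obj} (hX : X.InClass D)
    (s : ∀ x : X, F.obj.obj (H.sub (X.stabilizer x) (hX x))) (z : U.act X) :
    F.obj.obj (G.sub ((U.act X).stabilizer z) (hX.act H.mem hU z)) :=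
  F.obj.map (DCat.actHom hU (FSet.exists_act z).choose.1 (hX.act H.mem hU z) (hX _) (by
    have := FSet.stabilizer_act _ _ (FSet.exists_act z).choose_spec.choose
    rw [← (FSet.exists_act z).choose_spec.choose_spec] at this
    exact this)) (s (FSet.exists_act z).choose.2)

theorem actVal_eq {X : FSet A H.obj} (hX : X.InClass D) (s : Sec F X hX) (z : U.act X) (u : U)
    (x : X) (h : FSet.ActFree U X u x) (hz : z = FSet.tmul u x h) :
    actVal F U hU hX s.1 z = F.obj.map (DCat.actHom hU u (hX.act H.mem hU z) (hX x)
      (by rw [hz]; exact FSet.stabilizer_act u x h)) (s.1 x) := by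
  rw [actVal]
  have key : ∀ (u' : U) (x' : X) (h' : FSet.ActFree U X u' x') (hz' : z = FSet.tmul u' x' h'),
      F.obj.map (DCat.actHom hU u' (hX.act H.mem hU z) (hX x')
        (by rw [hz']; exact FSet.stabilizer_act u' x' h')) (s.1 x') =
      F.obj.map (DCat.actHom hU u (hX.act H.mem hU z) (hX x)
        (by rw [hz]; exact FSet.stabilizer_act u x h)) (s.1 x) := by
    intro u' x' h' hz'
    obtain ⟨k, a, hu, hx⟩ := (FSet.tmul_eq_iff h h').1 (hz.symm.trans hz')
    replace hx : x' = k • a • x := hx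
    subst hx
    rw [Sec.inv s k a x, ← ConcreteCategory.comp_apply, ← F.obj.map_comp]
    rw [DCat.conjHom_actHom hU _ _ _ _ _ k a⁻¹ hu]
  exact key _ _ _ (FSet.exists_act z).choose_spec.choose_spec

/-- The section `U(s)` of `F` over `U ⊗_{AH} X`. -/
noncomputable def actSec {X : FSet A H.obj} {hX : X.InClass D} (s : Sec F X hX) :
    Sec F (U.act X) (hX.act H.mem hU) :=
  ⟨actVal F U hU hX s.1, fun g a z => by
    obtain ⟨u, x, h, rfl⟩ := FSet.exists_tmul z
    have h0 : FSet.ActFree U X ((g, (1 : H.obj)) • a • u) x := by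
      have := FSet.IsFree.smul (FSet.IsFree.smulA h a) (γ := (g, 1)) (l := 1)
        (fun _ => by simp) (fun _ => by simp)
      rwa [one_smul] at this
    rw [actVal_eq F U hU hX s (g • a • FSet.tmul u x h) _ x h0
      (FSet.tmul_congr _ rfl (one_smul _ x)), actVal_eq F U hU hX s _ u x h rfl,
      ← ConcreteCategory.comp_apply, ← F.obj.map_comp]
    rw [DCat.actHom_conjHom hU _ _ _ _ _ g a rfl]⟩

/-- `U(s)(u ⊗ x) = F([G_{u ⊗ x} × H_x / ((G × H)_u, φ_u) * (Δ(H_x), 1)])(s(x))`. -/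
theorem actSec_tmul {X : FSet A H.obj} {hX : X.InClass D} (s : Sec F X hX) (u : U) (x : X)
    (h : FSet.ActFree U X u x) :
    (actSec F U hU s).1 (FSet.tmul u x h) =
      F.obj.map (DCat.actHom hU u (hX.act H.mem hU _) (hX x) (FSet.stabilizer_act u x h))
        (s.1 x) := actVal_eq F U hU hX s _ u x h rfl

theorem FSet.stab_map {Γ : Type u} [Group Γ] {X Y : FSet A Γ} (α : X ⟶ Y) (x : X)
    (h : X.stabilizer x = Y.stabilizer (α.toFun x)) : X.stab x = Y.stab (α.toFun x) := by
  have key : ∀ γ a, (X.stab x).Rel γ a → (Y.stab (α.toFun x)).Rel γ a := by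
    intro γ a hr
    rw [FSet.rel_stab] at hr ⊢
    rw [← α.map_smul, ← α.map_smulA, hr]
  apply FibPair.ext_rel
  intro γ a
  refine ⟨key γ a, fun hr => ?_⟩
  have h1 : γ ∈ X.stabilizer x := by rw [h]; exact hr.1
  obtain ⟨b, hb⟩ : ∃ b, (X.stab x).Rel γ b := ⟨_, FibPair.rel_chr _ h1⟩
  rwa [hr.unique (key _ _ hb)]

theorem FSet.ActFree.map {G H : Type u} [Group G] [Group H] {U : FSet A (G × H)} {X Y : FSet A H}
    (α : X ⟶ Y) (hα : ∀ x, X.stabilizer x = Y.stabilizer (α.toFun x)) {u : U} {x : X}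
    (h : FSet.ActFree U X u x) : FSet.ActFree U Y u (α.toFun x) := by
  rw [ActFree, FSet.isFree_iff] at h ⊢
  rw [← FSet.stab_map α x (hα x)]
  exact h

/-- The map `U ⊗ α : u ⊗ x ↦ u ⊗ α(x)`. -/
def FSet.actMap {G H : Type u} [Group G] [Group H] (U : FSet A (G × H)) {X Y : FSet A H}
    (α : X ⟶ Y) (hα : ∀ x, X.stabilizer x = Y.stabilizer (α.toFun x)) : U.act X ⟶ U.act Y where
  toFun := Quotient.map (fun z => ⟨(z.1.1, α.toFun z.1.2), FSet.ActFree.map α hα z.2⟩) (by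
    rintro ⟨⟨x, y⟩, hz⟩ ⟨⟨x', y'⟩, hz'⟩ h
    obtain ⟨k, a, rfl, rfl⟩ := (FSet.bal_iff _ _ _ _ _ _ _ _).1 h
    exact (FSet.bal_iff _ _ _ _ _ _ _ _).2 ⟨k, a, rfl, by
      simp only [MonoidHom.id_apply, α.map_smul, α.map_smulA]⟩)
  map_smul g z := by
    obtain ⟨u, x, h, rfl⟩ := FSet.exists_tmul z
    exact FSet.tmul_congr _ rfl (by simp)
  map_smulA a z := by
    obtain ⟨u, x, h, rfl⟩ := FSet.exists_tmul z
    rfl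

theorem FSet.actMap_tmul {G H : Type u} [Group G] [Group H] (U : FSet A (G × H)) {X Y : FSet A H}
    (α : X ⟶ Y) (hα : ∀ x, X.stabilizer x = Y.stabilizer (α.toFun x)) (u : U) (x : X)
    (h : FSet.ActFree U X u x) :
    (U.actMap α hα).toFun (FSet.tmul u x h) = FSet.tmul u (α.toFun x) (h.map α hα) := rfl

theorem FSet.stabilizer_actMap {G H : Type u} [Group G] [Group H] (U : FSet A (G × H))
    {X Y : FSet A H} (α : X ⟶ Y) (hα : ∀ x, X.stabilizer x = Y.stabilizer (α.toFun x))
    (z : U.act X) : (U.act X).stabilizer z = (U.act Y).stabilizer ((U.actMap α hα).toFun z) := by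
  obtain ⟨u, x, h, rfl⟩ := FSet.exists_tmul z
  rw [FSet.actMap_tmul, FSet.stabilizer_act, FSet.stabilizer_act, hα x]

theorem FSet.actMap_id {G H : Type u} [Group G] [Group H] (U : FSet A (G × H)) (X : FSet A H)
    (hX : ∀ x, X.stabilizer x = X.stabilizer ((𝟙 X : X ⟶ X).toFun x)) :
    U.actMap (𝟙 X) hX = 𝟙 (U.act X) := FSet.Hom.ext (by
  funext z
  obtain ⟨u, x, h, rfl⟩ := FSet.exists_tmul z
  rfl)

theorem FSet.actMap_comp {G H : Type u} [Group G] [Group H] (U : FSet A (G × H))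
    {X Y Z : FSet A H} (α : X ⟶ Y) (β : Y ⟶ Z)
    (hα : ∀ x, X.stabilizer x = Y.stabilizer (α.toFun x))
    (hβ : ∀ x, Y.stabilizer x = Z.stabilizer (β.toFun x))
    (h : ∀ x, X.stabilizer x = Z.stabilizer ((α ≫ β).toFun x)) :
    U.actMap (α ≫ β) h = U.actMap α hα ≫ U.actMap β hβ := FSet.Hom.ext (by
  funext z
  obtain ⟨u, x, h, rfl⟩ := FSet.exists_tmul z
  rfl)

theorem actSec_actMap {S T : Gam F H} (f : S ⟶ T) (z : U.act S.set) :
    (actSec F U hU T.sec).1 ((U.actMap f.hom f.stab).toFun z) =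
      F.obj.map (G.transport (U.stabilizer_actMap f.hom f.stab z) (S.mem.act H.mem hU z)
        (T.mem.act H.mem hU _)) ((actSec F U hU S.sec).1 z) := by
  obtain ⟨u, x, h, rfl⟩ := FSet.exists_tmul z
  refine (actVal_eq F U hU _ T.sec _ u _ (FSet.ActFree.map f.hom f.stab h) rfl).trans ?_
  rw [actSec_tmul F U hU S.sec u x h, f.val, ← ConcreteCategory.comp_apply,
    ← F.obj.map_comp, ← ConcreteCategory.comp_apply, ← F.obj.map_comp]
  rw [DCat.transport_actHom hU u (S.mem.act H.mem hU _) (T.mem.act H.mem hU _) (S.mem x)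
    (T.mem (f.hom.toFun x)) (FSet.stabilizer_act u x h)
    (FSet.stabilizer_act u _ (FSet.ActFree.map f.hom f.stab h)) (f.stab x)
    (U.stabilizer_actMap f.hom f.stab _)]
  rfl

/-- The functor `Γ_F(U) : Γ_F(H) ⥤ Γ_F(G)`, given by `(X, s) ↦ (U ⊗_{AH} X, U(s))` on objects and
by `α ↦ U ⊗ α` on arrows. -/
noncomputable def gammaFunctor : Gam F H ⥤ Gam F G where
  obj S := ⟨U.act S.set, S.mem.act H.mem hU, actSec F U hU S.sec⟩
  map f :=
    { hom := U.actMap f.hom f.stab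
      stab := U.stabilizer_actMap f.hom f.stab
      val := actSec_actMap F U hU f }
  map_id _ := Gam.Hom.ext (FSet.actMap_id U _ fun _ => rfl)
  map_comp f g := Gam.Hom.ext (FSet.actMap_comp U f.hom g.hom f.stab g.stab (f ≫ g).stab)

end GammaFunctor
section

variable {Ω A : Type u} [CommGroup A] {D : Datum Ω A}

theorem FSet.InClass.sum {G : FinGroup Ω} {X Y : FSet A G} (hX : X.InClass D)
    (hY : Y.InClass D) : (X.sum Y).InClass D := by
  intro z
  obtain ⟨x, rfl⟩ | ⟨y, rfl⟩ := FSet.sum_cases X Y z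
  · have := hX x
    rwa [FSet.stabilizer, ← FSet.stab_inl X Y x] at this
  · have := hY y
    rwa [FSet.stabilizer, ← FSet.stab_inr X Y y] at this

end

section FPlus

variable {R : Type v} [CommRing R] {Ω A : Type u} [CommGroup A] {D : Datum Ω A}
  [hD : D.IsPlusCategorical]

section

variable {F : FibFunctor.{u, v, w} R D} {G : DCat R D}

/-- The values of the section `s ⊔ t` over `X ⊔ Y`. -/
noncomputable def sumVal {X Y : FSet A G.obj} {hX : X.InClass D} {hY : Y.InClass D}
    (s : Sec F X hX) (t : Sec F Y hY) : ∀ z : X.carrier ⊕ Y.carrier,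
      F.obj.obj (G.sub ((X.sum Y).stabilizer z) (hX.sum hY z))
  | Sum.inl x => F.obj.map (G.transport (congrArg FibPair.sub (FSet.stab_inl X Y x).symm)
      (hX x) (hX.sum hY (FSet.inl X Y x))) (s.1 x)
  | Sum.inr y => F.obj.map (G.transport (congrArg FibPair.sub (FSet.stab_inr X Y y).symm)
      (hY y) (hX.sum hY (FSet.inr X Y y))) (t.1 y)

theorem map_conj_transport (F : FibFunctor.{u, v, w} R D) {P Q P' Q' : Subgroup G.obj}
    (g : G.obj) (hP : D.𝒢 (G.obj.sub P)) (hQ : D.𝒢 (G.obj.sub Q))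
    (hP' : D.𝒢 (G.obj.sub P')) (hQ' : D.𝒢 (G.obj.sub Q')) (hPQ : ∀ x, x ∈ Q ↔ g⁻¹ * x * g ∈ P)
    (hPQ' : ∀ x, x ∈ Q' ↔ g⁻¹ * x * g ∈ P') (e : P = P') (e' : Q = Q')
    (m : F.obj.obj (G.sub P hP)) :
    F.obj.map (G.transport e' hQ hQ') (F.obj.map (G.conjHom g hP hQ hPQ) m) =
      F.obj.map (G.conjHom g hP' hQ' hPQ') (F.obj.map (G.transport e hP hP') m) := by
  rw [← ConcreteCategory.comp_apply, ← F.obj.map_comp, ← ConcreteCategory.comp_apply,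
    ← F.obj.map_comp, G.conjHom_transport]

/-- The section `s ⊔ t` over `X ⊔ Y`. -/
noncomputable def Sec.sum {X Y : FSet A G.obj} {hX : X.InClass D} {hY : Y.InClass D}
    (s : Sec F X hX) (t : Sec F Y hY) : Sec F (X.sum Y) (hX.sum hY) :=
  ⟨sumVal s t, by
    intro g a z
    obtain ⟨x, rfl⟩ | ⟨y, rfl⟩ := FSet.sum_cases X Y z
    · exact (congrArg (F.obj.map (G.transport (congrArg FibPair.sub (FSet.stab_inl X Y _).symm)
        (hX (g • a • x)) (hX.sum hY (FSet.inl X Y (g • a • x))))) (Sec.inv s g a x)).trans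
        (map_conj_transport F g (hX x) (hX _) (hX.sum hY (FSet.inl X Y x))
          (hX.sum hY (FSet.inl X Y (g • a • x))) _ _ _ _ (s.1 x))
    · exact (congrArg (F.obj.map (G.transport (congrArg FibPair.sub (FSet.stab_inr X Y _).symm)
        (hY (g • a • y)) (hX.sum hY (FSet.inr X Y (g • a • y))))) (Sec.inv t g a y)).trans
        (map_conj_transport F g (hY y) (hY _) (hX.sum hY (FSet.inr X Y y))
          (hX.sum hY (FSet.inr X Y (g • a • y))) _ _ _ _ (t.1 y))⟩

theorem Sec.smul_sum {X Y : FSet A G.obj} {hX : X.InClass D} {hY : Y.InClass D}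
    (s : Sec F X hX) (t : Sec F Y hY) (r : R) : r • Sec.sum s t = Sec.sum (r • s) (r • t) := by
  apply Subtype.ext
  funext z
  rcases z with x | y
  · exact (map_smul (F.obj.map _).hom r (s.1 x)).symm
  · exact (map_smul (F.obj.map _).hom r (t.1 y)).symm

/-- The functor `(X, s) ↦ (X, r s)`. -/
noncomputable def Gam.smulFunctor (r : R) : Gam F G ⥤ Gam F G where
  obj S := ⟨S.set, S.mem, r • S.sec⟩
  map {S T} f := ⟨f.hom, f.stab, fun x => by
    change r • T.sec.1 (f.hom.toFun x) = F.obj.map _ (r • S.sec.1 x)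
    rw [f.val, map_smul]⟩

end

variable (F : FibFunctor.{u, v, w} R D) (G : DCat R D)

/-- The isomorphism classes `{X, s}` of objects of `Γ_F(G)`. -/
def GamClass : Type (max (u + 1) w) := Quotient (isIsomorphicSetoid (Gam F G))

variable {F G}

/-- The isomorphism class `{X, s}`, as a basis element of the free abelian group. -/
def Gam.free (S : Gam F G) : FreeAbelianGroup (GamClass F G) :=
  FreeAbelianGroup.of (Quotient.mk (isIsomorphicSetoid (Gam F G)) S)

theorem Gam.free_congr {S T : Gam F G} (e : S ≅ T) : S.free = T.free :=
  congrArg FreeAbelianGroup.of (Quotient.sound ⟨e⟩)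

variable (F G)

/-- The subgroup generated by the elements `{X ⊔ Y, s ⊔ t} - {X, s} - {Y, t}` and
`{X, s + r} - {X, s} - {X, r}`. -/
def plusRel : AddSubgroup (FreeAbelianGroup (GamClass F G)) :=
  AddSubgroup.closure
    ({z | ∃ (X Y : FSet A G.obj) (hX : X.InClass D) (hY : Y.InClass D) (s : Sec F X hX)
        (t : Sec F Y hY), z = Gam.free ⟨X.sum Y, hX.sum hY, Sec.sum s t⟩ - Gam.free ⟨X, hX, s⟩ -
          Gam.free ⟨Y, hY, t⟩} ∪
      {z | ∃ (X : FSet A G.obj) (hX : X.InClass D) (s r : Sec F X hX),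
        z = Gam.free ⟨X, hX, s + r⟩ - Gam.free ⟨X, hX, s⟩ - Gam.free ⟨X, hX, r⟩})

/-- The group `F₊(G)`. -/
def FPlus : Type (max (u + 1) w) := FreeAbelianGroup (GamClass F G) ⧸ plusRel F G

noncomputable instance : AddCommGroup (FPlus F G) :=
  inferInstanceAs (AddCommGroup (FreeAbelianGroup (GamClass F G) ⧸ plusRel F G))

variable {F G}

/-- The element `[X, s]` of `F₊(G)`. -/
def FPlus.mk (S : Gam F G) : FPlus F G := QuotientAddGroup.mk S.free

theorem FPlus.induction {p : FPlus F G → Prop} (z : FPlus F G) (h0 : p 0)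
    (hmk : ∀ S, p (FPlus.mk S)) (hneg : ∀ x, p x → p (-x))
    (hadd : ∀ x y, p x → p y → p (x + y)) : p z := by
  obtain ⟨z⟩ := z
  induction z using FreeAbelianGroup.induction_on with
  | zero => exact h0
  | of z => obtain ⟨S⟩ := z; exact hmk S
  | neg z hz => exact hneg _ hz
  | add x y hx hy => exact hadd _ _ hx hy

theorem plusRel_sum (X Y : FSet A G.obj) (hX : X.InClass D) (hY : Y.InClass D) (s : Sec F X hX)
    (t : Sec F Y hY) : Gam.free ⟨X.sum Y, hX.sum hY, Sec.sum s t⟩ - Gam.free ⟨X, hX, s⟩ -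
      Gam.free ⟨Y, hY, t⟩ ∈ plusRel F G :=
  AddSubgroup.subset_closure (Or.inl ⟨X, Y, hX, hY, s, t, rfl⟩)

theorem plusRel_add (X : FSet A G.obj) (hX : X.InClass D) (s r : Sec F X hX) :
    Gam.free ⟨X, hX, s + r⟩ - Gam.free ⟨X, hX, s⟩ - Gam.free ⟨X, hX, r⟩ ∈ plusRel F G :=
  AddSubgroup.subset_closure (Or.inr ⟨X, hX, s, r, rfl⟩)

theorem FPlus.mk_add (X : FSet A G.obj) (hX : X.InClass D) (s r : Sec F X hX) :
    FPlus.mk ⟨X, hX, s + r⟩ = (FPlus.mk ⟨X, hX, s⟩ + FPlus.mk ⟨X, hX, r⟩ : FPlus F G) := by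
  have h := (QuotientAddGroup.eq_zero_iff _).2 (plusRel_add X hX s r)
  rw [QuotientAddGroup.mk_sub, QuotientAddGroup.mk_sub, sub_sub, sub_eq_zero] at h
  exact h

/-- `{X, s} ↦ {X, r s}`. -/
noncomputable def GamClass.smul (r : R) : GamClass F G → GamClass F G :=
  Quotient.map (Gam.smulFunctor r).obj (by
    rintro S T ⟨e⟩
    exact ⟨(Gam.smulFunctor r).mapIso e⟩)

theorem GamClass.map_smul_free (r : R) (S : Gam F G) :
    FreeAbelianGroup.map (GamClass.smul r) S.free = Gam.free ⟨S.set, S.mem, r • S.sec⟩ :=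
  FreeAbelianGroup.map_of_apply _

theorem GamClass.map_smul_sub (r : R) (S T W : Gam F G) :
    FreeAbelianGroup.map (GamClass.smul r) (S.free - T.free - W.free) =
      Gam.free ⟨S.set, S.mem, r • S.sec⟩ - Gam.free ⟨T.set, T.mem, r • T.sec⟩ -
        Gam.free ⟨W.set, W.mem, r • W.sec⟩ := by
  rw [map_sub, map_sub, GamClass.map_smul_free, GamClass.map_smul_free, GamClass.map_smul_free]

theorem plusRel_le_comap (r : R) :
    plusRel F G ≤ (plusRel F G).comap (FreeAbelianGroup.map (GamClass.smul r)) := by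
  rw [plusRel, AddSubgroup.closure_le]
  rintro z (⟨X, Y, hX, hY, s, t, rfl⟩ | ⟨X, hX, s, t, rfl⟩)
  · change FreeAbelianGroup.map (GamClass.smul r) _ ∈ plusRel F G
    have h1 := plusRel_sum X Y hX hY (r • s) (r • t)
    rw [GamClass.map_smul_sub, Sec.smul_sum]
    exact h1
  · change FreeAbelianGroup.map (GamClass.smul r) _ ∈ plusRel F G
    have h1 := plusRel_add X hX (r • s) (r • t)
    rw [GamClass.map_smul_sub, smul_add]
    exact h1

/-- Multiplication by `r` on `F₊(G)`, given by `r[X, s] = [X, r s]`. -/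
noncomputable def FPlus.smulHom (r : R) : FPlus F G →+ FPlus F G :=
  QuotientAddGroup.map (plusRel F G) (plusRel F G) (FreeAbelianGroup.map (GamClass.smul r))
    (plusRel_le_comap r)

theorem FPlus.smulHom_mk (r : R) (S : Gam F G) :
    FPlus.smulHom r (FPlus.mk S) = FPlus.mk ⟨S.set, S.mem, r • S.sec⟩ :=
  congrArg QuotientAddGroup.mk (FreeAbelianGroup.map_of_apply _)

noncomputable instance : SMul R (FPlus F G) := ⟨fun r => FPlus.smulHom r⟩

theorem FPlus.smul_def (r : R) (x : FPlus F G) : r • x = FPlus.smulHom r x := rfl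

theorem FPlus.smul_mk (r : R) (S : Gam F G) :
    r • FPlus.mk S = FPlus.mk ⟨S.set, S.mem, r • S.sec⟩ := FPlus.smulHom_mk r S

noncomputable instance : Module R (FPlus F G) where
  smul_zero r := map_zero (FPlus.smulHom r)
  smul_add r := map_add (FPlus.smulHom r)
  one_smul x := by
    induction x using FPlus.induction with
    | h0 => exact map_zero (FPlus.smulHom 1)
    | hmk S => rw [FPlus.smul_mk, one_smul]
    | hneg x hx => rw [FPlus.smul_def, map_neg, ← FPlus.smul_def, hx]
    | hadd x y hx hy => rw [FPlus.smul_def, map_add, ← FPlus.smul_def, ← FPlus.smul_def, hx, hy]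
  mul_smul r q x := by
    induction x using FPlus.induction with
    | h0 => simp only [FPlus.smul_def, map_zero]
    | hmk S => simp only [FPlus.smul_mk, mul_smul]
    | hneg x hx => simp only [FPlus.smul_def, map_neg] at hx ⊢; rw [hx]
    | hadd x y hx hy => simp only [FPlus.smul_def, map_add] at hx hy ⊢; rw [hx, hy]
  add_smul r q x := by
    induction x using FPlus.induction with
    | h0 => simp only [FPlus.smul_def, map_zero, add_zero]
    | hmk S => simp only [FPlus.smul_mk, add_smul, FPlus.mk_add]
    | hneg x hx => simp only [FPlus.smul_def, map_neg] at hx ⊢; rw [hx, neg_add]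
    | hadd x y hx hy =>
      simp only [FPlus.smul_def, map_add] at hx hy ⊢; rw [hx, hy]; exact add_add_add_comm _ _ _ _
  zero_smul x := by
    induction x using FPlus.induction with
    | h0 => simp only [FPlus.smul_def, map_zero]
    | hmk S =>
      rw [FPlus.smul_mk, zero_smul]
      have := FPlus.mk_add S.set S.mem (0 : Sec F S.set S.mem) 0
      rwa [add_zero, left_eq_add] at this
    | hneg x hx => simp only [FPlus.smul_def, map_neg] at hx ⊢; rw [hx, neg_zero]
    | hadd x y hx hy => simp only [FPlus.smul_def, map_add] at hx hy ⊢; rw [hx, hy, add_zero]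

/-- For a morphism `φ : F ⟶ F'` and a section `s` of `F` over `X`, the section `φ(s)` of `F'` with
`φ(s)(x) = φ_{G_x}(s(x))`. -/
noncomputable def Sec.map {F F' : FibFunctor.{u, v, w} R D} (φ : F ⟶ F') {X : FSet A G.obj}
    {hX : X.InClass D} (s : Sec F X hX) : Sec F' X hX :=
  ⟨fun x => φ.hom.app _ (s.1 x), fun g a x => by
    dsimp only
    rw [Sec.inv s, ← ConcreteCategory.comp_apply, φ.hom.naturality, ConcreteCategory.comp_apply]⟩

/-- An object of `𝒟 = 𝒞(𝒢, 𝒮)`, as an object of `𝒟₊ = 𝒞(𝒢, 𝒮₊)`. -/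
def DCat.plus (G : DCat R D) : DCat R D.plus := ⟨G.obj, G.mem⟩

end FPlus
end FiberedBiset

/-!
For a biset `U` whose stabilizing pairs lie in `𝒮₊(G, H)`, the functor `Γ_F(U)` preserves disjoint
unions and is linear in the section, so it induces a linear map `F₊([U]) : F₊(H) → F₊(G)`
(`FPlus.act`). Three properties of this map make `F₊` a functor.

* `F₊([U])` depends on the isomorphism class of `U` only and is additive in `U`
  (`FPlus.act_congr`, `FPlus.act_sum`).
* `F₊([U ⊗ V]) = F₊([U]) ∘ F₊([V])` (`FPlus.act_tensor`). On sets this is the associativity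
  `(U ⊗ V) ⊗ X ≅ U ⊗ (V ⊗ X)`. On sections it says that the morphism of `𝒟` attached to `u ⊗ v` is
  the composite of those attached to `v` and `u` (`DCat.actHom_comp_actHom`). This is a
  case of the Mackey formula with a single double coset, because the group `H_{v ⊗ x}` in the middle
  is the whole first projection of the pair attached to `v`.
* `F₊([G × G / (Δ(G), 1)])` is the identity (`FPlus.act_diag`).

The morphisms of `𝒟₊` form a span in `B^A_R(G, H)`, and `F₊` has to be defined on it linearly. Every
biset `U` has a largest part `U'` with stabilizing pairs in `𝒮₊(G, H)`, because `𝒮₊(G, H)` is closed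
under conjugation, and `U ↦ U'` respects isomorphisms and disjoint unions. Hence `[U] ↦ F₊([U'])`
extends to a linear map on all of `B^A_R(G, H)` (`BurnsideR.plusAct`), whose restriction to the span
is the one required. Functoriality is checked on the classes of transitive bisets, which generate
the span.

A morphism `φ : F ⟶ F'` induces `φ₊` by applying `φ` to the values of sections. It commutes with
`F₊([U])` since `U(φ(s)) = φ(U(s))` by naturality (`actSec_map`).

All isomorphisms of objects of `Γ_F(G)` that are needed come from one criterion,
`Gam.nonempty_iso_of_param`. The stabilizers of corresponding points are then equal, but not
definitionally, so the values of sections are compared along the identity morphisms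
`DCat.transport`.
-/

namespace FiberedBiset

/-! ### Isomorphisms in `Γ_F(G)` -/

section GamIso

variable {R : Type v} [CommRing R] {Ω A : Type u} [CommGroup A] {D : Datum Ω A}
  [hD : D.IsPlusCategorical] {F : FibFunctor.{u, v, w} R D} {G : DCat R D}

theorem FibFunctor.map_transport_trans (F : FibFunctor.{u, v, w} R D) {P Q L : Subgroup G.obj}
    (e : P = Q) (e' : Q = L) (hP : D.𝒢 (G.obj.sub P)) (hQ : D.𝒢 (G.obj.sub Q))
    (hL : D.𝒢 (G.obj.sub L)) (m : F.obj.obj (G.sub P hP)) :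
    F.obj.map (G.transport e' hQ hL) (F.obj.map (G.transport e hP hQ) m) =
      F.obj.map (G.transport (e.trans e') hP hL) m := by
  rw [← ConcreteCategory.comp_apply, ← F.obj.map_comp, G.transport_trans]

theorem FibFunctor.map_transport_self (F : FibFunctor.{u, v, w} R D) {P : Subgroup G.obj}
    (e : P = P) (hP hP' : D.𝒢 (G.obj.sub P)) (m : F.obj.obj (G.sub P hP)) :
    F.obj.map (G.transport e hP hP') m = m := by
  rw [G.transport_rfl, F.obj.map_id]
  rfl

theorem FSet.stab_eq_of_injective {Γ : Type u} [Group Γ] {X Y : FSet A Γ} (f : X → Y)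
    (hf : Function.Injective f) (h : ∀ (γ : Γ) x, f (γ • x) = γ • f x)
    (h' : ∀ (a : A) x, f (a • x) = a • f x) (x : X) : X.stab x = Y.stab (f x) := by
  apply FibPair.ext_rel
  intro γ a
  rw [FSet.rel_stab, FSet.rel_stab, ← h, ← h', hf.eq_iff]

/-- The values of a section at equal points agree, up to the identification of the stabilizers. -/
theorem Sec.val_congr {X : FSet A G.obj} {hX : X.InClass D} (s : Sec F X hX) {x y : X}
    (hxy : x = y) (e : X.stabilizer x = X.stabilizer y) :
    s.1 y = F.obj.map (G.transport e (hX x) (hX y)) (s.1 x) := by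
  subst hxy
  exact (F.map_transport_self _ _ _ _).symm

variable {X Y : FSet A G.obj} {hX : X.InClass D} {hY : Y.InClass D} {s : Sec F X hX}
  {t : Sec F Y hY}

/-- An equivariant bijection that is compatible with the sections is an isomorphism. -/
theorem Gam.nonempty_iso_of_bijective (f : X → Y)
    (hf : Function.Bijective f) (h : ∀ (g : G.obj) x, f (g • x) = g • f x)
    (h' : ∀ (a : A) x, f (a • x) = a • f x)
    (hv : ∀ x (e : X.stabilizer x = Y.stabilizer (f x)),
      t.1 (f x) = F.obj.map (G.transport e (hX x) (hY (f x))) (s.1 x)) :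
    Nonempty ((⟨X, hX, s⟩ : Gam F G) ≅ ⟨Y, hY, t⟩) := by
  have hs : ∀ x, X.stabilizer x = Y.stabilizer (f x) := fun x =>
    congrArg FibPair.sub (FSet.stab_eq_of_injective f hf.1 h h' x)
  let i := FSet.isoOf (Equiv.ofBijective f hf) h h'
  have hi : ∀ y, f (i.inv.toFun y) = y := (Equiv.ofBijective f hf).apply_symm_apply
  have hs' : ∀ y, Y.stabilizer y = X.stabilizer (i.inv.toFun y) := fun y => by
    rw [hs, hi]
  refine ⟨⟨⟨i.hom, hs, fun x => hv x _⟩, ⟨i.inv, hs', fun y => ?_⟩,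
    Gam.Hom.ext i.hom_inv_id, Gam.Hom.ext i.inv_hom_id⟩⟩
  dsimp only
  rw [Sec.val_congr t (hi y) (by rw [hi y]), hv _ (hs _), F.map_transport_trans,
    F.map_transport_trans, F.map_transport_self]

/-- Two surjections from one set that have the same fibres and are compatible with the actions and
with the sections yield an isomorphism. -/
theorem Gam.nonempty_iso_of_param {P : Type u} (f : P → X) (g : P → Y)
    (hf : Function.Surjective f) (hg : Function.Surjective g) (h : ∀ p q, f p = f q ↔ g p = g q)
    (hΓ : ∀ (γ : G.obj) p, ∃ q, f q = γ • f p ∧ g q = γ • g p)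
    (hA : ∀ (a : A) p, ∃ q, f q = a • f p ∧ g q = a • g p)
    (hv : ∀ p (e : X.stabilizer (f p) = Y.stabilizer (g p)),
      t.1 (g p) = F.obj.map (G.transport e (hX (f p)) (hY (g p))) (s.1 (f p))) :
    Nonempty ((⟨X, hX, s⟩ : Gam F G) ≅ ⟨Y, hY, t⟩) := by
  choose r hr using hf
  have key : ∀ p, g (r (f p)) = g p := fun p => (h _ _).1 (hr _)
  refine Gam.nonempty_iso_of_bijective (fun x => g (r x)) ⟨?_, ?_⟩ ?_ ?_ ?_
  · intro x y hxy
    rw [← hr x, ← hr y]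
    exact (h _ _).2 hxy
  · intro y
    obtain ⟨p, rfl⟩ := hg y
    exact ⟨f p, key p⟩
  · intro γ x
    obtain ⟨q, h1, h2⟩ := hΓ γ (r x)
    rw [hr] at h1
    rw [← h1, key, h2]
  · intro γ x
    obtain ⟨q, h1, h2⟩ := hA γ (r x)
    rw [hr] at h1
    rw [← h1, key, h2]
  · intro x e
    have e1 : X.stabilizer x = X.stabilizer (f (r x)) := by rw [hr]
    rw [hv (r x) (e1.symm.trans e), Sec.val_congr s (hr x).symm e1, F.map_transport_trans]

end GamIso

/-! ### Linear maps out of `F₊(G)` -/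

section Lift

variable {R : Type v} [CommRing R] {Ω A : Type u} [CommGroup A] {D : Datum Ω A}
  [hD : D.IsPlusCategorical] {F : FibFunctor.{u, v, w} R D} {G : DCat R D}

theorem FPlus.mk_congr {S T : Gam F G} (h : Nonempty (S ≅ T)) : FPlus.mk S = FPlus.mk T := by
  obtain ⟨e⟩ := h
  exact congrArg QuotientAddGroup.mk (Gam.free_congr e)

theorem FPlus.mk_sum {X Y : FSet A G.obj} (hX : X.InClass D) (hY : Y.InClass D) (s : Sec F X hX)
    (t : Sec F Y hY) : FPlus.mk ⟨X.sum Y, hX.sum hY, Sec.sum s t⟩ =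
      (FPlus.mk ⟨X, hX, s⟩ + FPlus.mk ⟨Y, hY, t⟩ : FPlus F G) := by
  have h := (QuotientAddGroup.eq_zero_iff _).2 (plusRel_sum X Y hX hY s t)
  rw [QuotientAddGroup.mk_sub, QuotientAddGroup.mk_sub, sub_sub, sub_eq_zero] at h
  exact h

theorem FPlus.hom_ext {M : Type*} [AddCommGroup M] [Module R M] {f g : FPlus F G →ₗ[R] M}
    (h : ∀ S, f (FPlus.mk S) = g (FPlus.mk S)) : f = g := by
  ext x
  induction x using FPlus.induction with
  | h0 => rw [map_zero, map_zero]
  | hmk S => exact h S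
  | hneg x hx => rw [map_neg, map_neg, hx]
  | hadd x y hx hy => rw [map_add, map_add, hx, hy]

/-- The linear map out of `F₊(G)` given by an isomorphism invariant that is additive for disjoint
unions and linear in the section. -/
noncomputable def FPlus.lift {M : Type*} [AddCommGroup M] [Module R M] (f : Gam F G → M)
    (hiso : ∀ S T, Nonempty (S ≅ T) → f S = f T)
    (hsum : ∀ (X Y : FSet A G.obj) (hX : X.InClass D) (hY : Y.InClass D) (s : Sec F X hX)
      (t : Sec F Y hY), f ⟨X.sum Y, hX.sum hY, Sec.sum s t⟩ = f ⟨X, hX, s⟩ + f ⟨Y, hY, t⟩)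
    (hadd : ∀ (X : FSet A G.obj) (hX : X.InClass D) (s t : Sec F X hX),
      f ⟨X, hX, s + t⟩ = f ⟨X, hX, s⟩ + f ⟨X, hX, t⟩)
    (hsmul : ∀ (r : R) (S : Gam F G), f ⟨S.set, S.mem, r • S.sec⟩ = r • f S) :
    FPlus F G →ₗ[R] M :=
  let φ : FreeAbelianGroup (GamClass F G) →+ M :=
    FreeAbelianGroup.lift (Quotient.lift f fun S T h => hiso S T h)
  have hφ : ∀ S : Gam F G, φ S.free = f S := fun _ => FreeAbelianGroup.lift_apply_of _ _
  let ψ : FPlus F G →+ M := QuotientAddGroup.lift (plusRel F G) φ (by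
    change plusRel F G ≤ φ.ker
    rw [plusRel, AddSubgroup.closure_le]
    rintro z (⟨X, Y, hX, hY, s, t, rfl⟩ | ⟨X, hX, s, t, rfl⟩)
    · change φ _ = 0
      rw [map_sub, map_sub, hφ, hφ, hφ, hsum, sub_sub, sub_self]
    · change φ _ = 0
      rw [map_sub, map_sub, hφ, hφ, hφ, hadd, sub_sub, sub_self])
  have hψ : ∀ S : Gam F G, ψ (FPlus.mk S) = f S := hφ
  { ψ with
    map_smul' := fun r x => by
      change ψ (r • x) = r • ψ x
      induction x using FPlus.induction with
      | h0 => simp only [smul_zero, map_zero]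
      | hmk S => rw [FPlus.smul_mk, hψ, hψ, hsmul]
      | hneg x hx => simp only [smul_neg, map_neg, hx]
      | hadd x y hx hy => simp only [smul_add, map_add, hx, hy] }

theorem FPlus.lift_mk {M : Type*} [AddCommGroup M] [Module R M] (f : Gam F G → M)
    (hiso hsum hadd hsmul) (S : Gam F G) :
    FPlus.lift f hiso hsum hadd hsmul (FPlus.mk S) = f S :=
  FreeAbelianGroup.lift_apply_of _ _

end Lift

/-! ### The linear map `F₊([U])` -/

section ActHom

variable {R : Type v} [CommRing R] {Ω A : Type u} [CommGroup A] {D : Datum Ω A}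
  [hD : D.IsPlusCategorical] {G H K : DCat R D}

/-- The morphism attached to `u` depends on the stabilizing pair of `u` only. -/
theorem DCat.transport_actHom_of_stab_eq {U U' : FSet A (G.obj × H.obj)} (hU : U.InPlus D)
    (hU' : U'.InPlus D) {u : U} {u' : U'} (hs : U.stab u = U'.stab u')
    {P P' : Subgroup G.obj} {K K' : Subgroup H.obj} (hP : D.𝒢 (G.obj.sub P))
    (hP' : D.𝒢 (G.obj.sub P')) (hK : D.𝒢 (H.obj.sub K)) (hK' : D.𝒢 (H.obj.sub K'))
    (e : P = (U.stab u).starSubgroup K) (e' : P' = (U'.stab u').starSubgroup K')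
    (eK : K = K') (eP : P = P') :
    H.transport eK hK hK' ≫ DCat.actHom hU' u' hP' hK' e' =
      DCat.actHom hU u hP hK e ≫ G.transport eP hP hP' := by
  subst eK eP
  rw [transport_rfl, transport_rfl, Category.id_comp, Category.comp_id]
  apply Subtype.ext
  change BurnsideR.tr R (FSet.actPair u' P K) = BurnsideR.tr R (FSet.actPair u P K)
  rw [FSet.actPair, FSet.actPair, hs]

theorem FibFunctor.map_actHom_transport (F : FibFunctor.{u, v, w} R D)
    {U U' : FSet A (G.obj × H.obj)} (hU : U.InPlus D)
    (hU' : U'.InPlus D) {u : U} {u' : U'} (hs : U.stab u = U'.stab u')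
    {P P' : Subgroup G.obj} {K K' : Subgroup H.obj} (hP : D.𝒢 (G.obj.sub P))
    (hP' : D.𝒢 (G.obj.sub P')) (hK : D.𝒢 (H.obj.sub K)) (hK' : D.𝒢 (H.obj.sub K'))
    (e : P = (U.stab u).starSubgroup K) (e' : P' = (U'.stab u').starSubgroup K')
    (eK : K = K') (eP : P = P') (m : F.obj.obj (H.sub K hK)) :
    F.obj.map (DCat.actHom hU' u' hP' hK' e') (F.obj.map (H.transport eK hK hK') m) =
      F.obj.map (G.transport eP hP hP') (F.obj.map (DCat.actHom hU u hP hK e) m) := by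
  rw [← ConcreteCategory.comp_apply, ← F.obj.map_comp, ← ConcreteCategory.comp_apply,
    ← F.obj.map_comp, DCat.transport_actHom_of_stab_eq hU hU' hs hP hP' hK hK' e e' eK eP]

/-- A point whose stabilizing pair is `(Δ(G), 1)` gives identity morphisms. -/
theorem DCat.actHom_of_stab_eq_diag {U : FSet A (G.obj × G.obj)} (hU : U.InPlus D) {u : U}
    (hs : U.stab u = FibPair.diag A G.obj) {P K : Subgroup G.obj} (hP : D.𝒢 (G.obj.sub P))
    (hK : D.𝒢 (G.obj.sub K)) (e : P = (U.stab u).starSubgroup K) (eK : K = P) :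
    DCat.actHom hU u hP hK e = G.transport eK hK hP := by
  subst eK
  rw [transport_rfl]
  apply Subtype.ext
  change BurnsideR.tr R (FSet.actPair u K K) = BurnsideR.tr R (FibPair.diag A (G.obj.sub K))
  congr 1
  apply FibPair.ext_rel
  rintro ⟨x, y⟩ a
  rw [FSet.rel_actPair, ← FSet.rel_stab, hs, FibPair.diag, FibPair.diag, FibPair.rel_graph,
    FibPair.rel_graph]
  exact and_congr_left fun _ => (G.obj.incl_injective K).eq_iff

theorem FSet.InPlus.tensor {U : FSet A (G.obj × H.obj)} {V : FSet A (H.obj × K.obj)}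
    (hU : U.InPlus D) (hV : V.InPlus D) : (U.tensor V).InPlus D := by
  intro z
  obtain ⟨u, v, h, rfl⟩ := FSet.exists_tmul z
  rw [FSet.stab_tensor]
  exact (Datum.IsPlusCategorical.plus (D := D)).star_mem _ _ _ G.mem H.mem K.mem _ (hU u) _ (hV v) _

/-- The morphism attached to `u ⊗ v` is the composite of those attached to `v` and `u`. Since the
subgroup in the middle is the first projection of the pair attached to `v`, there is only one
double coset in the Mackey formula. -/
theorem DCat.actHom_comp_actHom {U : FSet A (G.obj × H.obj)} {V : FSet A (H.obj × K.obj)}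
    (hU : U.InPlus D) (hV : V.InPlus D) (hUV : (U.tensor V).InPlus D) {u : U} {v : V}
    (h : FSet.IsFree U V (MonoidHom.inr G.obj H.obj) (MonoidHom.inl H.obj K.obj) u v)
    {P P' : Subgroup G.obj} {Q : Subgroup H.obj} {L : Subgroup K.obj} (hP : D.𝒢 (G.obj.sub P))
    (hP' : D.𝒢 (G.obj.sub P')) (hQ : D.𝒢 (H.obj.sub Q)) (hL : D.𝒢 (K.obj.sub L))
    (e : P = (U.stab u).starSubgroup Q) (e' : Q = (V.stab v).starSubgroup L)
    (e'' : P' = ((U.tensor V).stab (FSet.tmul u v h)).starSubgroup L) (eP : P' = P) :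
    DCat.actHom hV v hQ hL e' ≫ DCat.actHom hU u hP hQ e =
      DCat.actHom hUV (FSet.tmul u v h) hP' hL e'' ≫ G.transport eP hP' hP := by
  subst eP
  rw [transport_rfl, Category.comp_id]
  refine DCat.homTr_comp (G := G.obj.sub P') (H := H.obj.sub Q) (K := K.obj.sub L) hP hQ hL
    _ _ _ ?_ ?_ ?_
  · rw [FibPair.compat_iff]
    intro y a b ha hb
    rw [FSet.rel_actPair, map_one, ← FSet.rel_stab] at ha hb
    exact FSet.isFree_iff.1 h _ _ _ ha hb
  · intro x
    refine ⟨1, x, ⟨1, one_mem _⟩, ?_, one_mul _⟩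
    have hx : H.obj.incl Q x ∈ (V.stab v).starSubgroup L := e' ▸ H.obj.incl_mem Q x
    obtain ⟨k, hk, hxk⟩ := (FibPair.mem_starSubgroup _ _ _).1 hx
    refine ⟨K.obj.toSub k hk, ?_⟩
    obtain ⟨c, hc⟩ := hxk
    exact ((FSet.rel_actPair v Q L x (K.obj.toSub k hk) c).2 hc).1
  · intro x y a
    rw [FSet.rel_actPair, ← FSet.rel_stab, FSet.stab_tensor, FibPair.rel_star]
    simp only [FSet.rel_actPair, ← FSet.rel_stab]
    constructor
    · rintro ⟨k, b, c, hb, hc, rfl⟩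
      have hk : k ∈ Q := by
        rw [e', FibPair.mem_starSubgroup]
        exact ⟨_, K.obj.incl_mem L y, hc.1⟩
      exact ⟨H.obj.toSub k hk, b, c, hb, hc, rfl⟩
    · rintro ⟨k, b, c, hb, hc, rfl⟩
      exact ⟨_, b, c, hb, hc, rfl⟩

end ActHom

section ActPlus

variable {R : Type v} [CommRing R] {Ω A : Type u} [CommGroup A] {D : Datum Ω A}
  [hD : D.IsPlusCategorical] {F : FibFunctor.{u, v, w} R D} {G H K : DCat R D}

theorem actSec_add {U : FSet A (G.obj × H.obj)} (hU : U.InPlus D) {X : FSet A H.obj}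
    {hX : X.InClass D} (s t : Sec F X hX) :
    actSec F U hU (s + t) = actSec F U hU s + actSec F U hU t :=
  Subtype.ext (funext fun _ => map_add (F.obj.map _).hom _ _)

theorem actSec_smul {U : FSet A (G.obj × H.obj)} (hU : U.InPlus D) {X : FSet A H.obj}
    {hX : X.InClass D} (r : R) (s : Sec F X hX) :
    actSec F U hU (r • s) = r • actSec F U hU s :=
  Subtype.ext (funext fun _ => map_smul (F.obj.map _).hom _ _)

/-- `Γ_F(U)` takes `(X ⊔ Y, s ⊔ t)` to `(U ⊗ X ⊔ U ⊗ Y, U(s) ⊔ U(t))`. -/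
theorem nonempty_gammaFunctor_sum_iso {U : FSet A (G.obj × H.obj)} (hU : U.InPlus D)
    {X Y : FSet A H.obj} {hX : X.InClass D} {hY : Y.InClass D} (s : Sec F X hX)
    (t : Sec F Y hY) :
    Nonempty ((⟨(U.act X).sum (U.act Y), (hX.act H.mem hU).sum (hY.act H.mem hU),
        Sec.sum (actSec F U hU s) (actSec F U hU t)⟩ : Gam F G) ≅
      ⟨U.act (X.sum Y), (hX.sum hY).act H.mem hU, actSec F U hU (Sec.sum s t)⟩) := by
  have h1 : ∀ u x, FSet.ActFree U (X.sum Y) u (FSet.inl X Y x) ↔ FSet.ActFree U X u x := by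
    intro u x
    rw [FSet.ActFree, FSet.ActFree, FSet.isFree_iff, FSet.isFree_iff, FSet.stab_inl]
  have h2 : ∀ u y, FSet.ActFree U (X.sum Y) u (FSet.inr X Y y) ↔ FSet.ActFree U Y u y := by
    intro u x
    rw [FSet.ActFree, FSet.ActFree, FSet.isFree_iff, FSet.isFree_iff, FSet.stab_inr]
  refine Gam.nonempty_iso_of_param
    (P := {z : U.carrier × X.carrier // FSet.ActFree U X z.1 z.2} ⊕
      {z : U.carrier × Y.carrier // FSet.ActFree U Y z.1 z.2})
    (Sum.elim (fun z => FSet.inl (U.act X) (U.act Y) (FSet.tmul z.1.1 z.1.2 z.2))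
      (fun z => FSet.inr (U.act X) (U.act Y) (FSet.tmul z.1.1 z.1.2 z.2)))
    (Sum.elim (fun z => (FSet.tmul z.1.1 (FSet.inl X Y z.1.2) ((h1 _ _).2 z.2) : U.act (X.sum Y)))
      (fun z => (FSet.tmul z.1.1 (FSet.inr X Y z.1.2) ((h2 _ _).2 z.2) : U.act (X.sum Y))))
    ?_ ?_ ?_ ?_ ?_ ?_
  · intro z
    obtain ⟨z, rfl⟩ | ⟨z, rfl⟩ := FSet.sum_cases _ _ z
    · obtain ⟨x, y, h, rfl⟩ := FSet.exists_tmul z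
      exact ⟨Sum.inl ⟨(x, y), h⟩, rfl⟩
    · obtain ⟨x, y, h, rfl⟩ := FSet.exists_tmul z
      exact ⟨Sum.inr ⟨(x, y), h⟩, rfl⟩
  · intro z
    obtain ⟨x, y, h, rfl⟩ := FSet.exists_tmul z
    obtain ⟨y, rfl⟩ | ⟨y, rfl⟩ := FSet.sum_cases _ _ y
    · exact ⟨Sum.inl ⟨(x, y), (h1 _ _).1 h⟩, rfl⟩
    · exact ⟨Sum.inr ⟨(x, y), (h2 _ _).1 h⟩, rfl⟩
  · rintro (⟨⟨x, y⟩, h⟩ | ⟨⟨x, y⟩, h⟩) (⟨⟨x', y'⟩, h'⟩ | ⟨⟨x', y'⟩, h'⟩)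
    · simp only [Sum.elim_inl, (FSet.inl_injective _ _).eq_iff, FSet.tmul_eq_iff, FSet.smulA_inl,
        MonoidHom.id_apply, FSet.smul_inl]
    · simp only [Sum.elim_inl, Sum.elim_inr, FSet.tmul_eq_iff, FSet.smulA_inl, FSet.smul_inl,
        FSet.inl_ne_inr, (FSet.inl_ne_inr _ _ _ _).symm, and_false, exists_false]
    · simp only [Sum.elim_inl, Sum.elim_inr, FSet.tmul_eq_iff, FSet.smulA_inr, FSet.smul_inr,
        FSet.inl_ne_inr, (FSet.inl_ne_inr _ _ _ _).symm, and_false, exists_false]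
    · simp only [Sum.elim_inr, (FSet.inr_injective _ _).eq_iff, FSet.tmul_eq_iff, FSet.smulA_inr,
        MonoidHom.id_apply, FSet.smul_inr]
  · rintro g (⟨⟨x, y⟩, h⟩ | ⟨⟨x, y⟩, h⟩)
    · exact ⟨Sum.inl ⟨((g, (1 : H.obj)) • x, (1 : H.obj) • y),
        h.smul (by simp) (by simp)⟩, rfl, rfl⟩
    · exact ⟨Sum.inr ⟨((g, (1 : H.obj)) • x, (1 : H.obj) • y),
        h.smul (by simp) (by simp)⟩, rfl, rfl⟩
  · rintro a (⟨⟨x, y⟩, h⟩ | ⟨⟨x, y⟩, h⟩)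
    · exact ⟨Sum.inl ⟨(a • x, y), h.smulA a⟩, rfl, rfl⟩
    · exact ⟨Sum.inr ⟨(a • x, y), h.smulA a⟩, rfl, rfl⟩
  · rintro (⟨⟨x, y⟩, h⟩ | ⟨⟨x, y⟩, h⟩) e
    · refine (actSec_tmul F U hU (Sec.sum s t) x (FSet.inl X Y y) ((h1 _ _).2 h)).trans ?_
      refine (F.map_actHom_transport hU hU rfl (hX.act H.mem hU _) _ (hX y) _
        (FSet.stabilizer_act x y h) _ _
        ((congrArg FibPair.sub (FSet.stab_inl _ _ _)).symm.trans e) (s.1 y)).trans ?_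
      rw [← actSec_tmul F U hU s x y h]
      exact (F.map_transport_trans _ _ _ _ _ _).symm
    · refine (actSec_tmul F U hU (Sec.sum s t) x (FSet.inr X Y y) ((h2 _ _).2 h)).trans ?_
      refine (F.map_actHom_transport hU hU rfl (hY.act H.mem hU _) _ (hY y) _
        (FSet.stabilizer_act x y h) _ _
        ((congrArg FibPair.sub (FSet.stab_inr _ _ _)).symm.trans e) (t.1 y)).trans ?_
      rw [← actSec_tmul F U hU t x y h]
      exact (F.map_transport_trans _ _ _ _ _ _).symm

variable (F) in
/-- The linear map `F₊([U]) : F₊(H) → F₊(G)`, `[X, s] ↦ [U ⊗_{AH} X, U(s)]`. -/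
noncomputable def FPlus.act (U : FSet A (G.obj × H.obj)) (hU : U.InPlus D) :
    FPlus F H →ₗ[R] FPlus F G :=
  FPlus.lift (fun S => FPlus.mk ((gammaFunctor F U hU).obj S))
    (fun _ _ ⟨i⟩ => FPlus.mk_congr ⟨(gammaFunctor F U hU).mapIso i⟩)
    (fun _ _ hX hY s t => (FPlus.mk_congr (nonempty_gammaFunctor_sum_iso hU s t)).symm.trans
      (FPlus.mk_sum (hX.act H.mem hU) (hY.act H.mem hU) _ _))
    (fun X hX s t => by
      refine Eq.trans ?_ (FPlus.mk_add (U.act X) (hX.act H.mem hU) (actSec F U hU s)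
        (actSec F U hU t))
      exact congrArg (fun t => FPlus.mk ⟨U.act X, hX.act H.mem hU, t⟩) (actSec_add hU s t))
    (fun r S => by
      rw [FPlus.smul_mk]
      exact congrArg (fun t => FPlus.mk ⟨U.act S.set, S.mem.act H.mem hU, t⟩)
        (actSec_smul hU r S.sec))

theorem FPlus.act_mk (U : FSet A (G.obj × H.obj)) (hU : U.InPlus D) (S : Gam F H) :
    FPlus.act F U hU (FPlus.mk S) =
      FPlus.mk ⟨U.act S.set, S.mem.act H.mem hU, actSec F U hU S.sec⟩ :=
  FPlus.lift_mk _ _ _ _ _ S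

/-- Isomorphic bisets `U`, `U'` give isomorphic objects `Γ_F(U)(X, s)` and `Γ_F(U')(X, s)`. -/
theorem nonempty_gammaFunctor_iso {U U' : FSet A (G.obj × H.obj)} (hU : U.InPlus D)
    (hU' : U'.InPlus D) (i : U ≅ U') {X : FSet A H.obj} {hX : X.InClass D}
    (s : Sec F X hX) :
    Nonempty ((⟨U.act X, hX.act H.mem hU, actSec F U hU s⟩ : Gam F G) ≅
      ⟨U'.act X, hX.act H.mem hU', actSec F U' hU' s⟩) := by
  have hfree : ∀ u x, FSet.ActFree U X u x ↔
      FSet.ActFree U' X (FSet.isoEquiv i u) x := by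
    intro u x
    rw [FSet.ActFree, FSet.ActFree, FSet.isFree_iff, FSet.isFree_iff, FSet.stab_isoEquiv]
  refine Gam.nonempty_iso_of_param
    (P := {z : U.carrier × X.carrier // FSet.ActFree U X z.1 z.2})
    (fun z => (FSet.tmul z.1.1 z.1.2 z.2 : U.act X))
    (fun z => (FSet.tmul (FSet.isoEquiv i z.1.1) z.1.2 ((hfree _ _).1 z.2) : U'.act X))
    ?_ ?_ ?_ ?_ ?_ ?_
  · intro z
    obtain ⟨x, y, h, rfl⟩ := FSet.exists_tmul z
    exact ⟨⟨(x, y), h⟩, rfl⟩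
  · intro z
    obtain ⟨x, y, h, rfl⟩ := FSet.exists_tmul z
    obtain ⟨x, rfl⟩ := (FSet.isoEquiv i).surjective x
    exact ⟨⟨(x, y), (hfree _ _).2 h⟩, rfl⟩
  · rintro ⟨⟨x, y⟩, h⟩ ⟨⟨x', y'⟩, h'⟩
    rw [FSet.tmul_eq_iff, FSet.tmul_eq_iff]
    refine exists_congr fun k => exists_congr fun a => ?_
    rw [← (FSet.isoEquiv i).injective.eq_iff]
    simp only [FSet.isoEquiv_smul, FSet.isoEquiv_smulA]
  · rintro g ⟨⟨x, y⟩, h⟩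
    exact ⟨⟨((g, (1 : H.obj)) • x, (1 : H.obj) • y), h.smul (by simp) (by simp)⟩, rfl,
      FSet.tmul_congr _ (FSet.isoEquiv_smul _ _ _) rfl⟩
  · rintro a ⟨⟨x, y⟩, h⟩
    exact ⟨⟨(a • x, y), h.smulA a⟩, rfl, FSet.tmul_congr _ (FSet.isoEquiv_smulA _ _ _) rfl⟩
  · rintro ⟨⟨x, y⟩, h⟩ e
    refine (actSec_tmul F U' hU' s _ y ((hfree _ _).1 h)).trans ?_
    rw [← F.map_transport_self rfl (hX y) (hX y) (s.1 y)]
    refine (F.map_actHom_transport hU hU' (FSet.stab_isoEquiv i x).symm (hX.act H.mem hU _) _ _ _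
      (FSet.stabilizer_act x y h) _ _ e _).trans ?_
    exact congrArg _ (actSec_tmul F U hU s x y h).symm

theorem FPlus.act_congr {U U' : FSet A (G.obj × H.obj)} (hU : U.InPlus D) (hU' : U'.InPlus D)
    (i : Nonempty (U ≅ U')) : FPlus.act F U hU = FPlus.act F U' hU' := by
  obtain ⟨i⟩ := i
  refine FPlus.hom_ext fun S => ?_
  rw [FPlus.act_mk, FPlus.act_mk]
  exact FPlus.mk_congr (nonempty_gammaFunctor_iso hU hU' i S.sec)

theorem FSet.InPlus.sum {D : Datum Ω A} {G H : FinGroup Ω} {U V : FSet A (G × H)} (hU : U.InPlus D) (hV : V.InPlus D) :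
    (U.sum V).InPlus D := by
  intro z
  obtain ⟨x, rfl⟩ | ⟨x, rfl⟩ := FSet.sum_cases _ _ z
  · rw [FSet.stab_inl]; exact hU x
  · rw [FSet.stab_inr]; exact hV x

/-- `Γ_F(U ⊔ V)` takes `(X, s)` to `(U ⊗ X ⊔ V ⊗ X, U(s) ⊔ V(s))`. -/
theorem nonempty_gammaFunctor_biset_sum_iso {U V : FSet A (G.obj × H.obj)} (hU : U.InPlus D)
    (hV : V.InPlus D) {X : FSet A H.obj} {hX : X.InClass D} (s : Sec F X hX) :
    Nonempty ((⟨(U.act X).sum (V.act X), (hX.act H.mem hU).sum (hX.act H.mem hV),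
        Sec.sum (actSec F U hU s) (actSec F V hV s)⟩ : Gam F G) ≅
      ⟨(U.sum V).act X, hX.act H.mem (hU.sum hV), actSec F (U.sum V) (hU.sum hV) s⟩) := by
  have h1 : ∀ u x, FSet.ActFree (U.sum V) X (FSet.inl U V u) x ↔
      FSet.ActFree U X u x := by
    intro u x
    rw [FSet.ActFree, FSet.ActFree, FSet.isFree_iff, FSet.isFree_iff, FSet.stab_inl]
  have h2 : ∀ v x, FSet.ActFree (U.sum V) X (FSet.inr U V v) x ↔
      FSet.ActFree V X v x := by
    intro u x
    rw [FSet.ActFree, FSet.ActFree, FSet.isFree_iff, FSet.isFree_iff, FSet.stab_inr]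
  refine Gam.nonempty_iso_of_param
    (P := {z : U.carrier × X.carrier // FSet.ActFree U X z.1 z.2} ⊕
      {z : V.carrier × X.carrier // FSet.ActFree V X z.1 z.2})
    (Sum.elim (fun z => FSet.inl (U.act X) (V.act X) (FSet.tmul z.1.1 z.1.2 z.2))
      (fun z => FSet.inr (U.act X) (V.act X) (FSet.tmul z.1.1 z.1.2 z.2)))
    (Sum.elim
      (fun z => (FSet.tmul (FSet.inl U V z.1.1) z.1.2 ((h1 _ _).2 z.2) : (U.sum V).act X))
      (fun z => (FSet.tmul (FSet.inr U V z.1.1) z.1.2 ((h2 _ _).2 z.2) : (U.sum V).act X)))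
    ?_ ?_ ?_ ?_ ?_ ?_
  · intro z
    obtain ⟨z, rfl⟩ | ⟨z, rfl⟩ := FSet.sum_cases _ _ z
    · obtain ⟨x, y, h, rfl⟩ := FSet.exists_tmul z
      exact ⟨Sum.inl ⟨(x, y), h⟩, rfl⟩
    · obtain ⟨x, y, h, rfl⟩ := FSet.exists_tmul z
      exact ⟨Sum.inr ⟨(x, y), h⟩, rfl⟩
  · intro z
    obtain ⟨x, y, h, rfl⟩ := FSet.exists_tmul z
    obtain ⟨x, rfl⟩ | ⟨x, rfl⟩ := FSet.sum_cases _ _ x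
    · exact ⟨Sum.inl ⟨(x, y), (h1 _ _).1 h⟩, rfl⟩
    · exact ⟨Sum.inr ⟨(x, y), (h2 _ _).1 h⟩, rfl⟩
  · rintro (⟨⟨x, y⟩, h⟩ | ⟨⟨x, y⟩, h⟩) (⟨⟨x', y'⟩, h'⟩ | ⟨⟨x', y'⟩, h'⟩)
    · simp only [Sum.elim_inl, (FSet.inl_injective _ _).eq_iff, FSet.tmul_eq_iff, FSet.smulA_inl,
        FSet.smul_inl]
    · simp only [Sum.elim_inl, Sum.elim_inr, FSet.tmul_eq_iff, FSet.smulA_inl, FSet.smul_inl,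
        FSet.inl_ne_inr, (FSet.inl_ne_inr _ _ _ _).symm, false_and, exists_false]
    · simp only [Sum.elim_inl, Sum.elim_inr, FSet.tmul_eq_iff, FSet.smulA_inr, FSet.smul_inr,
        FSet.inl_ne_inr, (FSet.inl_ne_inr _ _ _ _).symm, false_and, exists_false]
    · simp only [Sum.elim_inr, (FSet.inr_injective _ _).eq_iff, FSet.tmul_eq_iff, FSet.smulA_inr,
        FSet.smul_inr]
  · rintro g (⟨⟨x, y⟩, h⟩ | ⟨⟨x, y⟩, h⟩)
    · exact ⟨Sum.inl ⟨((g, (1 : H.obj)) • x, (1 : H.obj) • y),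
        h.smul (by simp) (by simp)⟩, rfl, rfl⟩
    · exact ⟨Sum.inr ⟨((g, (1 : H.obj)) • x, (1 : H.obj) • y),
        h.smul (by simp) (by simp)⟩, rfl, rfl⟩
  · rintro a (⟨⟨x, y⟩, h⟩ | ⟨⟨x, y⟩, h⟩)
    · exact ⟨Sum.inl ⟨(a • x, y), h.smulA a⟩, rfl, rfl⟩
    · exact ⟨Sum.inr ⟨(a • x, y), h.smulA a⟩, rfl, rfl⟩
  · rintro (⟨⟨x, y⟩, h⟩ | ⟨⟨x, y⟩, h⟩) e
    · refine (actSec_tmul F (U.sum V) (hU.sum hV) s _ y ((h1 _ _).2 h)).trans ?_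
      rw [← F.map_transport_self rfl (hX y) (hX y) (s.1 y)]
      refine (F.map_actHom_transport hU (hU.sum hV) (FSet.stab_inl U V x).symm
        (hX.act H.mem hU _) _ _ _
        (FSet.stabilizer_act x y h) _ _
        ((congrArg FibPair.sub (FSet.stab_inl _ _ _)).symm.trans e) _).trans ?_
      rw [← actSec_tmul F U hU s x y h]
      exact (F.map_transport_trans _ _ _ _ _ _).symm
    · refine (actSec_tmul F (U.sum V) (hU.sum hV) s _ y ((h2 _ _).2 h)).trans ?_
      rw [← F.map_transport_self rfl (hX y) (hX y) (s.1 y)]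
      refine (F.map_actHom_transport hV (hU.sum hV) (FSet.stab_inr U V x).symm
        (hX.act H.mem hV _) _ _ _
        (FSet.stabilizer_act x y h) _ _
        ((congrArg FibPair.sub (FSet.stab_inr _ _ _)).symm.trans e) _).trans ?_
      rw [← actSec_tmul F V hV s x y h]
      exact (F.map_transport_trans _ _ _ _ _ _).symm

theorem FPlus.act_sum {U V : FSet A (G.obj × H.obj)} (hU : U.InPlus D) (hV : V.InPlus D)
    (hUV : (U.sum V).InPlus D) :
    FPlus.act F (U.sum V) hUV = FPlus.act F U hU + FPlus.act F V hV := by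
  refine FPlus.hom_ext fun S => ?_
  rw [LinearMap.add_apply, FPlus.act_mk, FPlus.act_mk, FPlus.act_mk]
  exact (FPlus.mk_congr (nonempty_gammaFunctor_biset_sum_iso hU hV S.sec)).symm.trans
    (FPlus.mk_sum _ _ _ _)

/-! ### Compatibility with tensor products and identities -/

/-- Freeness of the orbit of a triple `(u, v, x)` in `U × V × X`. It is equivalent to `u ⊗ v` and
`(u ⊗ v) ⊗ x` being elements of the tensor products, and likewise to `v ⊗ x` and `u ⊗ (v ⊗ x)`
being such. -/
def FSet.ActTFree {G H K : Type u} [Group G] [Group H] [Group K] {U : FSet A (G × H)}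
    {V : FSet A (H × K)} {X : FSet A K} (u : U) (v : V) (x : X) : Prop :=
  ∀ h k a b c, (U.stab u).Rel (1, h) a → (V.stab v).Rel (h, k) b → (X.stab x).Rel k c →
    a * b * c = 1

section Triple

variable {G H K : Type u} [Group G] [Group H] [Group K] {U : FSet A (G × H)}
  {V : FSet A (H × K)} {X : FSet A K}

theorem FSet.ActTFree.left {u : U} {v : V} {x : X} (h : FSet.ActTFree u v x) :
    FSet.IsFree U V (MonoidHom.inr G H) (MonoidHom.inl H K) u v := by
  rw [FSet.isFree_iff]
  intro k a b ha hb
  simpa using h k 1 a b 1 ha hb ((FSet.rel_stab _ _ _ _).2 (by simp))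

theorem FSet.ActTFree.right {u : U} {v : V} {x : X} (h : FSet.ActTFree u v x) :
    FSet.ActFree V X v x := by
  rw [FSet.ActFree, FSet.isFree_iff]
  intro k a b ha hb
  simpa using h 1 k 1 a b ((FSet.rel_stab _ _ _ _).2 (by simp [← Prod.one_eq_mk])) ha hb

theorem FSet.actTFree_iff_left {u : U} {v : V} {x : X}
    (h : FSet.IsFree U V (MonoidHom.inr G H) (MonoidHom.inl H K) u v) :
    FSet.ActTFree u v x ↔ FSet.ActFree (U.tensor V) X (FSet.tmul u v h) x := by
  rw [FSet.ActFree, FSet.isFree_iff, FSet.stab_tensor]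
  simp only [FibPair.rel_star]
  constructor
  · rintro ht k a b ⟨x, c, d, h1, h2, rfl⟩ h3
    exact ht _ _ _ _ _ h1 h2 h3
  · intro ht x k a b c h1 h2 h3
    exact ht k _ _ ⟨x, a, b, h1, h2, rfl⟩ h3

theorem FSet.actTFree_iff_right {u : U} {v : V} {x : X} (h : FSet.ActFree V X v x) :
    FSet.ActTFree u v x ↔ FSet.ActFree U (V.act X) u (FSet.tmul v x h) := by
  rw [FSet.ActFree, FSet.isFree_iff]
  constructor
  · rintro ht k a b h1 h2
    obtain ⟨l, c, d, h3, h4, rfl⟩ := (FSet.rel_stab_tmul v x h _ _).1 h2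
    rw [← mul_assoc]
    exact ht _ _ _ _ _ h1 (by simpa using h3) (by simpa using h4)
  · intro ht y k a b c h1 h2 h3
    rw [mul_assoc]
    exact ht y _ _ h1 ((FSet.rel_stab_tmul v x h _ _).2
      ⟨k, b, c, by simpa using h2, by simpa using h3, rfl⟩)

theorem FSet.ActTFree.smul {u : U} {v : V} {x : X} (h : FSet.ActTFree u v x) (g : G) :
    FSet.ActTFree ((g, (1 : H)) • u) v x := by
  intro y k a b c h1 h2 h3
  refine h y k a b c ?_ h2 h3
  rw [FSet.rel_stab] at h1 ⊢
  rw [smul_smul, show ((1 : G), y) * (g, 1) = (g, 1) * (1, y) by simp, mul_smul,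
    ← FSet.smul_commA] at h1
  exact MulAction.injective _ h1

theorem FSet.ActTFree.smulA {u : U} {v : V} {x : X} (h : FSet.ActTFree u v x) (a : A) :
    FSet.ActTFree (a • u) v x := by
  intro y k b c d h1 h2 h3
  refine h y k b c d ?_ h2 h3
  rw [FSet.rel_stab] at h1 ⊢
  rw [FSet.smul_commA, smul_comm b] at h1
  exact MulAction.injective _ h1

/-- Two triples have the same class in `(U ⊗ V) ⊗ X` iff they have the same class
in `U ⊗ (V ⊗ X)`. -/
theorem FSet.tmul_tmul_eq_iff {u u' : U} {v v' : V} {x x' : X} (h : FSet.ActTFree u v x)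
    (h' : FSet.ActTFree u' v' x') :
    (FSet.tmul (X := U.tensor V) (FSet.tmul u v h.left) x ((FSet.actTFree_iff_left h.left).1 h) :
        (U.tensor V).act X) = FSet.tmul (X := U.tensor V) (FSet.tmul u' v' h'.left) x'
          ((FSet.actTFree_iff_left h'.left).1 h') ↔
      (FSet.tmul (Y := V.act X) u (FSet.tmul v x h.right) ((FSet.actTFree_iff_right h.right).1 h) :
        U.act (V.act X)) = FSet.tmul (Y := V.act X) u' (FSet.tmul v' x' h'.right)
          ((FSet.actTFree_iff_right h'.right).1 h') := by
  simp only [FSet.tmul_eq_iff, FSet.smul_tmul, FSet.smulA_tmul, MonoidHom.inr_apply,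
    MonoidHom.inl_apply, MonoidHom.comp_apply, MonoidHom.coe_fst, MonoidHom.coe_snd,
    MonoidHom.id_apply, MonoidHom.one_apply, one_smul, FSet.one_smul']
  constructor
  · rintro ⟨k, b, ⟨y, a, h1, h2⟩, rfl⟩
    have e1 : u' = ((1 : G), y⁻¹) • (a⁻¹ * b)⁻¹ • u := by
      have := congrArg (fun z => ((1 : G), y⁻¹) • a • z) h1
      simp only [FSet.smul_commA, smul_smul, Prod.mk_mul_mk, inv_mul_cancel, one_mul,
        FSet.one_smul', mul_inv_cancel, one_smul] at this
      rw [← this]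
      simp only [FSet.smul_commA, mul_inv_rev, inv_inv, mul_comm]
    have e2 : v' = (y⁻¹, k) • a⁻¹ • v := by
      have := congrArg (fun z => (y⁻¹, (1 : K)) • a⁻¹ • z) h2
      simp only [FSet.smul_commA, smul_smul, Prod.mk_mul_mk, inv_mul_cancel, one_mul, mul_one,
        FSet.one_smul', one_smul] at this
      rw [← this]
      simp only [FSet.smul_commA]
    refine ⟨y⁻¹, a⁻¹ * b, e1, k⁻¹, b⁻¹, ?_, ?_⟩
    · rw [e2]
      simp only [FSet.smul_commA, smul_smul, Prod.mk_mul_mk, inv_mul_cancel, one_mul, inv_inv,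
        mul_comm]
    · simp only [FSet.smul_commA, smul_smul, inv_mul_cancel, one_smul]
  · rintro ⟨y, a, rfl, k, b, h1, h2⟩
    have e1 : v' = (y, k⁻¹) • b • a • v := by
      have := congrArg (fun z => ((1 : H), k⁻¹) • b • z) h1
      simp only [FSet.smul_commA, smul_smul, Prod.mk_mul_mk, inv_mul_cancel, one_mul, mul_one,
        FSet.one_smul', mul_inv_cancel, one_smul] at this
      rw [← this]
      simp only [FSet.smul_commA, smul_smul, mul_comm]
    subst h2 e1
    have ea : a⁻¹ * (b⁻¹ * (b * a)) = 1 := by simp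
    refine ⟨k⁻¹, b⁻¹, ⟨y⁻¹, a⁻¹ * b⁻¹, ?_, ?_⟩, ?_⟩
    · simp only [FSet.smul_commA, smul_smul, Prod.mk_mul_mk, inv_mul_cancel, one_mul,
        FSet.one_smul', inv_inv, mul_inv_rev]
      simp only [mul_assoc, mul_inv_cancel, mul_one]
    · simp only [FSet.smul_commA, smul_smul, Prod.mk_mul_mk, inv_mul_cancel, one_mul]
      simp only [mul_assoc, ea, one_smul]
    · simp only [FSet.smul_commA, smul_smul, inv_mul_cancel, one_smul]

end Triple

/-- Associativity `(U ⊗ V) ⊗ X ≅ U ⊗ (V ⊗ X)`, compatibly with the sections. Both sides are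
parametrized by the triples with free orbit. -/
theorem nonempty_gammaFunctor_tensor_iso {U : FSet A (G.obj × H.obj)}
    {V : FSet A (H.obj × K.obj)} (hU : U.InPlus D) (hV : V.InPlus D)
    (hUV : (U.tensor V).InPlus D) {X : FSet A K.obj} {hX : X.InClass D} (s : Sec F X hX) :
    Nonempty ((⟨(U.tensor V).act X, hX.act K.mem hUV, actSec F (U.tensor V) hUV s⟩ : Gam F G) ≅
      ⟨U.act (V.act X), (hX.act K.mem hV).act H.mem hU,
        actSec F U hU (actSec F V hV s)⟩) := by
  refine Gam.nonempty_iso_of_param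
    (P := {z : U.carrier × V.carrier × X.carrier // FSet.ActTFree z.1 z.2.1 z.2.2})
    (fun z => (FSet.tmul (X := U.tensor V) (FSet.tmul z.1.1 z.1.2.1 z.2.left) z.1.2.2
      ((FSet.actTFree_iff_left z.2.left).1 z.2) : (U.tensor V).act X))
    (fun z => (FSet.tmul (Y := V.act X) z.1.1 (FSet.tmul z.1.2.1 z.1.2.2 z.2.right)
      ((FSet.actTFree_iff_right z.2.right).1 z.2) : U.act (V.act X))) ?_ ?_ ?_ ?_ ?_ ?_
  · intro z
    obtain ⟨t, x, h, rfl⟩ := FSet.exists_tmul z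
    obtain ⟨u, v, h', rfl⟩ := FSet.exists_tmul t
    exact ⟨⟨(u, v, x), (FSet.actTFree_iff_left h').2 h⟩, rfl⟩
  · intro z
    obtain ⟨u, t, h, rfl⟩ := FSet.exists_tmul z
    obtain ⟨v, x, h', rfl⟩ := FSet.exists_tmul t
    exact ⟨⟨(u, v, x), (FSet.actTFree_iff_right h').2 h⟩, rfl⟩
  · rintro ⟨⟨u, v, x⟩, h⟩ ⟨⟨u', v', x'⟩, h'⟩
    exact FSet.tmul_tmul_eq_iff h h'
  · rintro g ⟨⟨u, v, x⟩, h⟩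
    refine ⟨⟨((g, (1 : H.obj)) • u, v, x), h.smul g⟩, ?_, ?_⟩
    · exact FSet.tmul_congr _ (FSet.tmul_congr _ rfl (FSet.one_smul' v).symm) (one_smul _ x).symm
    · exact FSet.tmul_congr _ rfl (one_smul _ _).symm
  · rintro a ⟨⟨u, v, x⟩, h⟩
    exact ⟨⟨(a • u, v, x), h.smulA a⟩, rfl, rfl⟩
  · rintro ⟨⟨u, v, x⟩, h⟩ e
    have h1 := (FSet.actTFree_iff_left h.left).1 h
    have h2 := (FSet.actTFree_iff_right h.right).1 h
    refine (actSec_tmul F U hU (actSec F V hV s) u (FSet.tmul v x h.right) h2).trans ?_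
    rw [actSec_tmul F V hV s v x h.right, ← ConcreteCategory.comp_apply, ← F.obj.map_comp,
      DCat.actHom_comp_actHom hU hV hUV h.left _ _ _ _ _ _ (FSet.stabilizer_act _ _ h1) e,
      F.obj.map_comp, ConcreteCategory.comp_apply]
    exact congrArg _ (actSec_tmul F (U.tensor V) hUV s _ x h1).symm

theorem FPlus.act_tensor {U : FSet A (G.obj × H.obj)}
    {V : FSet A (H.obj × K.obj)} (hU : U.InPlus D) (hV : V.InPlus D)
    (hUV : (U.tensor V).InPlus D) :
    FPlus.act F (U.tensor V) hUV = FPlus.act F U hU ∘ₗ FPlus.act F V hV := by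
  refine FPlus.hom_ext fun S => ?_
  rw [LinearMap.comp_apply, FPlus.act_mk, FPlus.act_mk, FPlus.act_mk]
  exact FPlus.mk_congr (nonempty_gammaFunctor_tensor_iso hU hV hUV S.sec)

/-- The biset `G × G / (Δ(G), 1)` acts trivially. The elements of the tensor product are parametrized
by `X`, through `x ↦ e ⊗ x` with `e` the class of `(1, 1)`. -/
theorem nonempty_gammaFunctor_diag_iso
    (hU : (FSet.transitive (FibPair.diag A G.obj)).InPlus D) {X : FSet A G.obj}
    {hX : X.InClass D} (s : Sec F X hX) :
    Nonempty ((⟨(FSet.transitive (FibPair.diag A G.obj)).act X, hX.act G.mem hU,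
      actSec F _ hU s⟩ : Gam F G) ≅ ⟨X, hX, s⟩) := by
  have hs : (FSet.transitive (FibPair.diag A G.obj)).stab
      (FSet.tmk (FibPair.diag A G.obj) (1, 1) 1) = FibPair.diag A G.obj := by
    rw [← Prod.one_eq_mk, FSet.stab_tmk]
    exact FibPair.ext_rel fun x a => by rw [FibPair.rel_conj]; simp
  have hfree : ∀ x : X, FSet.ActFree (FSet.transitive (FibPair.diag A G.obj)) X
      (FSet.tmk (FibPair.diag A G.obj) (1, 1) 1) x := by
    intro x
    rw [FSet.ActFree, FSet.isFree_iff, hs]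
    intro h a b h1 h2
    obtain ⟨h3, rfl⟩ := (FibPair.rel_graph _ _ _).1 h1
    obtain rfl : h = 1 := h3
    rw [one_mul]
    exact h2.unique ((FSet.rel_stab _ _ _ _).2 (by simp))
  refine Gam.nonempty_iso_of_param (P := X)
    (fun x => (FSet.tmul (FSet.tmk _ (1, 1) 1) x (hfree x) :
      (FSet.transitive (FibPair.diag A G.obj)).act X)) id ?_ Function.surjective_id ?_ ?_ ?_ ?_
  · intro z
    obtain ⟨t, x, h, rfl⟩ := FSet.exists_tmul z
    obtain ⟨g, a, rfl, -⟩ := FSet.one_tmk_diag t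
    refine ⟨g⁻¹ • a • x, ?_⟩
    dsimp only
    refine (FSet.tmul_eq_iff _ _).2 ⟨g, a⁻¹, ?_, ?_⟩
    · rw [MonoidHom.inr_apply, FSet.smulA_tmk, FSet.smul_tmk]; simp
    · rw [MonoidHom.id_apply]
      simp only [FSet.smul_commA, smul_smul]
      simp
  · intro x y
    dsimp only [id]
    refine (FSet.tmul_eq_iff _ _).trans ?_
    constructor
    · rintro ⟨h, a, h1, rfl⟩
      rw [MonoidHom.inr_apply, FSet.smulA_tmk, FSet.smul_tmk, Prod.mk_mul_mk,
        FSet.tmk_diag_eq_iff] at h1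
      obtain ⟨h3, h4⟩ := h1
      have h5 : h = 1 := by simpa using h3
      have h6 : a = 1 := by simpa using h4.symm
      subst h5 h6
      simp
    · rintro rfl
      exact ⟨1, 1, by simp [FSet.one_smul'], by simp⟩
  · intro g x
    refine ⟨g • x, ?_, rfl⟩
    refine (FSet.tmul_eq_iff _ _).2 ⟨g⁻¹, 1, ?_, ?_⟩
    · rw [MonoidHom.inr_apply, FSet.smulA_tmk, FSet.smul_tmk]
      simp only [MonoidHom.inl_apply]
      rw [FSet.smul_tmk, Prod.mk_mul_mk, Prod.mk_mul_mk, FSet.tmk_diag_eq_iff]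
      simp
    · simp
  · intro a x
    refine ⟨a • x, ?_, rfl⟩
    refine (FSet.tmul_eq_iff _ _).2 ⟨1, a⁻¹, ?_, ?_⟩
    · rw [FSet.smulA_tmk, FSet.smulA_tmk]
      simp [FSet.one_smul']
    · simp
  · intro x e
    refine (F.map_transport_self rfl (hX x) (hX x) (s.1 x)).symm.trans ?_
    refine Eq.trans ?_ (congrArg _ (actSec_tmul F _ hU s _ x (hfree x)).symm)
    rw [DCat.actHom_of_stab_eq_diag hU hs _ _ _ e.symm, F.map_transport_trans]

theorem FPlus.act_diag (hU : (FSet.transitive (FibPair.diag A G.obj)).InPlus D) :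
    FPlus.act F (FSet.transitive (FibPair.diag A G.obj)) hU = LinearMap.id := by
  refine FPlus.hom_ext fun S => ?_
  rw [FPlus.act_mk, LinearMap.id_apply]
  exact FPlus.mk_congr (nonempty_gammaFunctor_diag_iso hU S.sec)

end ActPlus

/-! ### Extension of `F₊` to all of `B^A_R(G, H)` -/

section Stab

variable {A Γ : Type u} [CommGroup A] [Group Γ]

theorem FSet.stab_smul (X : FSet A Γ) (γ : Γ) (x : X) : X.stab (γ • x) = (X.stab x).conj γ := by
  apply FibPair.ext_rel
  intro δ a
  rw [FSet.rel_stab, FibPair.rel_conj, FSet.rel_stab, mul_smul, mul_smul, inv_smul_eq_iff,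
    FSet.smul_commA]

theorem FSet.stab_smulA (X : FSet A Γ) (a : A) (x : X) : X.stab (a • x) = X.stab x := by
  apply FibPair.ext_rel
  intro δ b
  rw [FSet.rel_stab, FSet.rel_stab, FSet.smul_commA, smul_comm b a]
  exact (MulAction.injective a).eq_iff

theorem FSet.stab_subset (X : FSet A Γ) (O : Set X) (hΓ hA) (x : X.subset O hΓ hA) :
    (X.subset O hΓ hA).stab x = X.stab x.1 :=
  FSet.stab_eq_of_injective Subtype.val Subtype.val_injective (fun _ _ => rfl) (fun _ _ => rfl) x

theorem FSet.stab_mem_of_stab_eq {S : Set (FibPair A Γ)} {X Y : FSet A Γ} {x : X} {y : Y}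
    (h : X.stab x = Y.stab y) (hy : Y.stab y ∈ S) : X.stab x ∈ S := by
  rwa [h]

end Stab

section PlusPart

variable {R : Type v} [CommRing R] {Ω A : Type u} [CommGroup A] {D : Datum Ω A}
  [hD : D.IsPlusCategorical] {F : FibFunctor.{u, v, w} R D} {G H K : DCat R D}

/-- The part of a biset formed by the points whose stabilizing pair lies in `𝒮₊(G, H)`. -/
noncomputable def FSet.plusPart (U : FSet A (G.obj × H.obj)) : FSet A (G.obj × H.obj) :=
  U.subset {u | U.stab u ∈ D.plus.𝒮 G.obj H.obj}
    (fun γ x hx => by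
      rw [Set.mem_ofPred_eq, FSet.stab_smul]
      exact (Datum.IsPlusCategorical.plus (D := D)).conj_mem _ _ G.mem H.mem _ hx γ)
    (fun a x hx => by rwa [Set.mem_ofPred_eq, FSet.stab_smulA])

theorem FSet.plusPart_inPlus (U : FSet A (G.obj × H.obj)) :
    (FSet.plusPart U : FSet A (G.obj × H.obj)).InPlus D := by
  intro u
  exact Set.mem_of_eq_of_mem (FSet.stab_subset U _ _ _ u) u.2

theorem FSet.nonempty_plusPart_iso {U : FSet A (G.obj × H.obj)} (hU : U.InPlus D) :
    Nonempty (FSet.plusPart U ≅ U) :=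
  FSet.nonempty_iso_of_bijective (X := FSet.plusPart U) Subtype.val
    ⟨Subtype.val_injective, fun u => ⟨⟨u, hU u⟩, rfl⟩⟩ (fun _ _ => rfl) (fun _ _ => rfl)

theorem FSet.nonempty_plusPart_congr {U V : FSet A (G.obj × H.obj)} (i : U ≅ V) :
    Nonempty (FSet.plusPart U ≅ FSet.plusPart V) := by
  have key : ∀ u, V.stab (FSet.isoEquiv i u) = U.stab u := FSet.stab_isoEquiv i
  refine FSet.nonempty_iso_of_bijective (X := FSet.plusPart U) (Y := FSet.plusPart V)
    (fun u => ⟨FSet.isoEquiv i u.1, FSet.stab_mem_of_stab_eq (key u.1) u.2⟩) ⟨?_, ?_⟩ ?_ ?_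
  · intro x y h
    exact Subtype.ext ((FSet.isoEquiv i).injective (congrArg Subtype.val h))
  · rintro ⟨v, hv⟩
    obtain ⟨u, rfl⟩ := (FSet.isoEquiv i).surjective v
    exact ⟨⟨u, FSet.stab_mem_of_stab_eq (key u).symm hv⟩, rfl⟩
  · intro γ x
    exact Subtype.ext (FSet.isoEquiv_smul i γ x.1)
  · intro γ x
    exact Subtype.ext (FSet.isoEquiv_smulA i γ x.1)

theorem FSet.nonempty_plusPart_sum (U V : FSet A (G.obj × H.obj)) :
    Nonempty ((FSet.plusPart U).sum (FSet.plusPart V) ≅ FSet.plusPart (U.sum V)) := by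
  refine FSet.nonempty_iso_of_bijective (X := (FSet.plusPart U).sum (FSet.plusPart V))
    (Y := FSet.plusPart (U.sum V))
    (Sum.elim
      (fun u => ⟨FSet.inl U V u.1, FSet.stab_mem_of_stab_eq (FSet.stab_inl U V u.1) u.2⟩)
      (fun v => ⟨FSet.inr U V v.1, FSet.stab_mem_of_stab_eq (FSet.stab_inr U V v.1) v.2⟩))
    ⟨?_, ?_⟩ ?_ ?_
  · rintro (x | x) (y | y) h
    · exact congrArg Sum.inl (Subtype.ext (Sum.inl_injective (congrArg Subtype.val h)))
    · exact (Sum.inl_ne_inr (congrArg Subtype.val h)).elim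
    · exact (Sum.inr_ne_inl (congrArg Subtype.val h)).elim
    · exact congrArg Sum.inr (Subtype.ext (Sum.inr_injective (congrArg Subtype.val h)))
  · rintro ⟨z, hz⟩
    obtain ⟨x, rfl⟩ | ⟨x, rfl⟩ := FSet.sum_cases U V z
    · exact ⟨Sum.inl ⟨x, FSet.stab_mem_of_stab_eq (FSet.stab_inl U V x).symm hz⟩, rfl⟩
    · exact ⟨Sum.inr ⟨x, FSet.stab_mem_of_stab_eq (FSet.stab_inr U V x).symm hz⟩, rfl⟩
  · rintro γ (x | x) <;> rfl
  · rintro γ (x | x) <;> rfl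

variable (F)

/-- The additive map sending the class of a biset `U` to `F₊([U'])`, where `U'` is the part of `U`
with stabilizing pairs in `𝒮₊(G, H)`. -/
noncomputable def FClass.plusAct : FClass A (G.obj × H.obj) →+ (FPlus F H →ₗ[R] FPlus F G) :=
  AddMonoidHom.mk' (Quotient.lift (fun U => FPlus.act F (FSet.plusPart U) (FSet.plusPart_inPlus U))
    fun _ _ ⟨i⟩ => FPlus.act_congr _ _ (FSet.nonempty_plusPart_congr i)) fun x y => by
      obtain ⟨U, rfl⟩ := x.exists_mk
      obtain ⟨V, rfl⟩ := y.exists_mk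
      exact (FPlus.act_congr _ _ (FSet.nonempty_plusPart_sum U V)).symm.trans
        (FPlus.act_sum (FSet.plusPart_inPlus U) (FSet.plusPart_inPlus V)
          ((FSet.plusPart_inPlus U).sum (FSet.plusPart_inPlus V)))

/-- The linear extension to `B^A_R(G, H)` of `[U] ↦ F₊([U'])`, where `U'` is the part of `U` with
stabilizing pairs in `𝒮₊(G, H)`. Discarding the other points makes this map defined on all
of `B^A_R(G, H)`, so that its restriction to the morphisms of `𝒟₊` is well defined without any
statement about linear independence of the classes of transitive bisets. -/
noncomputable def BurnsideR.plusAct :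
    BurnsideR R A (G.obj × H.obj) →ₗ[R] (FPlus F H →ₗ[R] FPlus F G) :=
  LinearMap.liftBaseChange R
    (Algebra.GrothendieckAddGroup.lift (FClass.plusAct F)).toIntLinearMap

theorem BurnsideR.plusAct_cl (U : FSet A (G.obj × H.obj)) (hU : U.InPlus D) :
    BurnsideR.plusAct F (BurnsideR.cl R U) = FPlus.act F U hU := by
  rw [BurnsideR.cl_eq, BurnsideR.plusAct, LinearMap.liftBaseChange_tmul, one_smul]
  refine (lift_of (FClass.plusAct F) (FClass.mk U)).trans ?_
  exact FPlus.act_congr _ _ (FSet.nonempty_plusPart_iso hU)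

theorem FSet.transitive_inPlus {p : FibPair A (G.obj × H.obj)}
    (hp : p ∈ D.plus.𝒮 G.obj H.obj) : (FSet.transitive p).InPlus D := by
  intro u
  obtain ⟨γ, a, rfl⟩ := FSet.exists_tmk _ u
  rw [FSet.stab_tmk]
  exact (Datum.IsPlusCategorical.plus (D := D)).conj_mem _ _ G.mem H.mem _ hp γ

/-- Compatibility with composition. It holds on the spans of the classes with stabilizing pairs
in `𝒮₊` only, since passing to the part with stabilizing pairs in `𝒮₊` does not commute with tensor
products in general. -/
theorem BurnsideR.plusAct_comp {x : BurnsideR R A (G.obj × H.obj)}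
    {y : BurnsideR R A (H.obj × K.obj)} (hx : x ∈ BurnsideR.spanOf R (D.plus.𝒮 G.obj H.obj))
    (hy : y ∈ BurnsideR.spanOf R (D.plus.𝒮 H.obj K.obj)) :
    BurnsideR.plusAct F (BurnsideR.comp R x y) =
      (BurnsideR.plusAct F x ∘ₗ BurnsideR.plusAct F y : FPlus F K →ₗ[R] FPlus F G) := by
  induction hx using Submodule.span_induction with
  | zero => simp only [map_zero, LinearMap.zero_apply, LinearMap.zero_comp]
  | add x x' _ _ hx hx' => simp only [map_add, LinearMap.add_apply, hx, hx', LinearMap.add_comp]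
  | smul r x _ hx => simp only [map_smul, LinearMap.smul_apply, hx, LinearMap.smul_comp]
  | mem x hx =>
    obtain ⟨p, hp, rfl⟩ := hx
    induction hy using Submodule.span_induction with
    | zero => simp only [map_zero, LinearMap.comp_zero]
    | add x x' _ _ hx hx' => simp only [map_add, hx, hx', LinearMap.comp_add]
    | smul r x _ hx => simp only [map_smul, hx, LinearMap.comp_smul]
    | mem y hy =>
      obtain ⟨q, hq, rfl⟩ := hy
      have hU := FSet.transitive_inPlus hp
      have hV := FSet.transitive_inPlus hq
      rw [BurnsideR.tr, BurnsideR.tr, BurnsideR.comp_cl,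
        BurnsideR.plusAct_cl F _ (hU.tensor hV), BurnsideR.plusAct_cl F _ hU,
        BurnsideR.plusAct_cl F _ hV, FPlus.act_tensor hU hV]

theorem BurnsideR.plusAct_diag :
    BurnsideR.plusAct F (BurnsideR.tr R (FibPair.diag A G.obj)) =
      (LinearMap.id : FPlus F G →ₗ[R] FPlus F G) := by
  have hU := FSet.transitive_inPlus
    ((Datum.IsPlusCategorical.plus (D := D)).diag_mem G.obj G.mem)
  rw [BurnsideR.tr, BurnsideR.plusAct_cl F _ hU, FPlus.act_diag]

end PlusPart

/-! ### Functoriality in `F` -/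

section Map

variable {R : Type v} [CommRing R] {Ω A : Type u} [CommGroup A] {D : Datum Ω A}
  [hD : D.IsPlusCategorical] {F F' : FibFunctor.{u, v, w} R D} {G H : DCat R D}

theorem FibFunctor.app_map (φ : F ⟶ F') {P Q : DCat R D} (f : P ⟶ Q) (m : F.obj.obj P) :
    φ.hom.app Q (F.obj.map f m) = F'.obj.map f (φ.hom.app P m) := by
  rw [← ConcreteCategory.comp_apply, φ.hom.naturality, ConcreteCategory.comp_apply]

/-- The functor `Γ_F(G) ⥤ Γ_{F'}(G)`, `(X, s) ↦ (X, φ(s))`. -/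
noncomputable def Gam.mapFunctor (φ : F ⟶ F') : Gam F G ⥤ Gam F' G where
  obj S := ⟨S.set, S.mem, Sec.map φ S.sec⟩
  map {S T} f := ⟨f.hom, f.stab, fun x => by
    change φ.hom.app _ (T.sec.1 (f.hom.toFun x)) = F'.obj.map _ (φ.hom.app _ (S.sec.1 x))
    rw [f.val, FibFunctor.app_map]⟩

theorem Sec.map_sum (φ : F ⟶ F') {X Y : FSet A G.obj} {hX : X.InClass D} {hY : Y.InClass D}
    (s : Sec F X hX) (t : Sec F Y hY) :
    Sec.map φ (Sec.sum s t) = Sec.sum (Sec.map φ s) (Sec.map φ t) := by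
  apply Subtype.ext
  funext z
  rcases z with x | y
  · exact FibFunctor.app_map φ _ (s.1 x)
  · exact FibFunctor.app_map φ _ (t.1 y)

theorem Sec.map_add (φ : F ⟶ F') {X : FSet A G.obj} {hX : X.InClass D} (s t : Sec F X hX) :
    Sec.map φ (s + t) = Sec.map φ s + Sec.map φ t :=
  Subtype.ext (funext fun x => _root_.map_add (φ.hom.app _).hom (s.1 x) (t.1 x))

theorem Sec.map_smul (φ : F ⟶ F') {X : FSet A G.obj} {hX : X.InClass D} (r : R)
    (s : Sec F X hX) : Sec.map φ (r • s) = r • Sec.map φ s :=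
  Subtype.ext (funext fun x => _root_.map_smul (φ.hom.app _).hom r (s.1 x))

/-- `U(φ(s)) = φ(U(s))`: both sides come from the same morphism of `𝒟`, so this is the naturality
of `φ`. -/
theorem actSec_map (φ : F ⟶ F') (U : FSet A (G.obj × H.obj)) (hU : U.InPlus D)
    {X : FSet A H.obj} {hX : X.InClass D} (s : Sec F X hX) :
    actSec F' U hU (Sec.map φ s) = Sec.map φ (actSec F U hU s) :=
  Subtype.ext (funext fun _ => (FibFunctor.app_map φ _ _).symm)

/-- The linear map `(φ₊)_G : F₊(G) → F'₊(G)`, `[X, s] ↦ [X, φ(s)]`. -/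
noncomputable def FPlus.map (φ : F ⟶ F') : FPlus F G →ₗ[R] FPlus F' G :=
  FPlus.lift (fun S => FPlus.mk ⟨S.set, S.mem, Sec.map φ S.sec⟩)
    (fun _ _ ⟨i⟩ => FPlus.mk_congr ⟨(Gam.mapFunctor φ).mapIso i⟩)
    (fun X Y hX hY s t => by rw [Sec.map_sum, FPlus.mk_sum])
    (fun X hX s t => by rw [Sec.map_add, FPlus.mk_add])
    (fun r S => by rw [Sec.map_smul, FPlus.smul_mk])

theorem FPlus.map_mk (φ : F ⟶ F') (S : Gam F G) :
    FPlus.map φ (FPlus.mk S) = FPlus.mk ⟨S.set, S.mem, Sec.map φ S.sec⟩ :=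
  FPlus.lift_mk _ _ _ _ _ S

theorem FPlus.map_comp_act (φ : F ⟶ F') (U : FSet A (G.obj × H.obj)) (hU : U.InPlus D) :
    FPlus.map φ ∘ₗ FPlus.act F U hU = FPlus.act F' U hU ∘ₗ FPlus.map φ := by
  refine FPlus.hom_ext fun S => ?_
  rw [LinearMap.comp_apply, LinearMap.comp_apply, FPlus.act_mk, FPlus.map_mk, FPlus.map_mk,
    FPlus.act_mk, actSec_map]

theorem FPlus.map_comp_plusAct (φ : F ⟶ F') {x : BurnsideR R A (G.obj × H.obj)}
    (hx : x ∈ BurnsideR.spanOf R (D.plus.𝒮 G.obj H.obj)) :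
    (FPlus.map φ ∘ₗ BurnsideR.plusAct F x : FPlus F H →ₗ[R] FPlus F' G) =
      BurnsideR.plusAct F' x ∘ₗ FPlus.map φ := by
  induction hx using Submodule.span_induction with
  | zero => simp only [_root_.map_zero, LinearMap.zero_comp, LinearMap.comp_zero]
  | add x x' _ _ hx hx' =>
    simp only [_root_.map_add, hx, hx', LinearMap.add_comp, LinearMap.comp_add]
  | smul r x _ hx => simp only [_root_.map_smul, hx, LinearMap.smul_comp, LinearMap.comp_smul]
  | mem x hx =>
    obtain ⟨p, hp, rfl⟩ := hx
    have hU := FSet.transitive_inPlus hp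
    rw [BurnsideR.tr, BurnsideR.plusAct_cl F _ hU, BurnsideR.plusAct_cl F' _ hU,
      FPlus.map_comp_act]

end Map

/-! ### The functor `F ↦ F₊` -/

section Functor

variable {R : Type v} [CommRing R] {Ω A : Type u} [CommGroup A] {D : Datum Ω A}
  [hD : D.IsPlusCategorical]

/-- An object of `𝒟₊`, as an object of `𝒟`. -/
def DCat.ofPlus (G : DCat R D.plus) : DCat R D := ⟨G.obj, G.mem⟩

/-- The functor `F₊` on `𝒟₊`, not yet bundled with its linearity. -/
noncomputable def plusFunctor (F : FibFunctor.{u, v, w} R D) :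
    DCat R D.plus ⥤ ModuleCat.{max (u + 1) w} R where
  obj G := ModuleCat.of R (FPlus F G.ofPlus)
  map {H G} x := ModuleCat.ofHom (BurnsideR.plusAct F (G := G.ofPlus) (H := H.ofPlus) x.1)
  map_id G := congrArg ModuleCat.ofHom (BurnsideR.plusAct_diag F (G := G.ofPlus))
  map_comp {K H G} y x := congrArg ModuleCat.ofHom
    (BurnsideR.plusAct_comp F (G := G.ofPlus) (H := H.ofPlus) (K := K.ofPlus) x.2 y.2)

/-- The object `F₊` of `𝓕^A_{𝒟₊,R}`. -/
noncomputable def FibFunctor.plus (F : FibFunctor.{u, v, w} R D) :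
    FibFunctor.{u, v, max (u + 1) w} R D.plus where
  obj := plusFunctor F
  property := ⟨⟨fun {H G x y} => congrArg ModuleCat.ofHom
      (map_add (BurnsideR.plusAct F (G := G.ofPlus) (H := H.ofPlus)) x.1 y.1)⟩,
    ⟨fun {H G} x r => congrArg ModuleCat.ofHom
      (map_smul (BurnsideR.plusAct F (G := G.ofPlus) (H := H.ofPlus)) r x.1)⟩⟩

variable (R D) in
/-- The functor `F ↦ F₊`. -/
noncomputable def lowerPlus :
    FibFunctor.{u, v, w} R D ⥤ FibFunctor.{u, v, max (u + 1) w} R D.plus where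
  obj F := F.plus
  map {F F'} φ := ObjectProperty.homMk
    { app := fun G => ModuleCat.ofHom (FPlus.map φ (G := G.ofPlus))
      naturality := fun H G x => congrArg ModuleCat.ofHom
        (FPlus.map_comp_plusAct φ (G := G.ofPlus) (H := H.ofPlus) x.2) }
  map_id F := by
    ext G : 3
    refine ModuleCat.hom_ext (FPlus.hom_ext fun S => ?_)
    exact FPlus.map_mk (𝟙 F) S
  map_comp φ ψ := by
    ext G : 3
    refine ModuleCat.hom_ext (FPlus.hom_ext fun S => ?_)
    refine (FPlus.map_mk (φ ≫ ψ) S).trans ?_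
    refine ((congrArg (FPlus.map ψ) (FPlus.map_mk φ S)).trans (FPlus.map_mk ψ _)).symm

end Functor

end FiberedBiset

theorem mainTheorem1 {Ω A : Type u} [CommGroup A] (R : Type v) [CommRing R]
    (D : FiberedBiset.Datum Ω A) [D.IsPlusCategorical] :
    ∃ (Φ : FiberedBiset.FibFunctor.{u, v, w} R D ⥤
          FiberedBiset.FibFunctor.{u, v, max (u + 1) w} R D.plus)
      (e : ∀ (F : FiberedBiset.FibFunctor.{u, v, w} R D) (G : FiberedBiset.DCat R D),
        FiberedBiset.FPlus F G ≃ₗ[R] (Φ.obj F).obj.obj G.plus),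
      (∀ (F : FiberedBiset.FibFunctor.{u, v, w} R D) (G H : FiberedBiset.DCat R D)
        (U : FiberedBiset.FSet A (G.obj × H.obj)) (hU : U.InPlus D)
        (S : FiberedBiset.Gam F H),
        (Φ.obj F).obj.map
            (FiberedBiset.DCat.homOf (D := D.plus) (G := G.plus) (H := H.plus) U hU)
            (e F H (FiberedBiset.FPlus.mk S)) =
          e F G (FiberedBiset.FPlus.mk ((FiberedBiset.gammaFunctor F U hU).obj S))) ∧
      (∀ (F F' : FiberedBiset.FibFunctor.{u, v, w} R D) (φ : F ⟶ F')
        (G : FiberedBiset.DCat R D) (S : FiberedBiset.Gam F G),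
        (Φ.map φ).hom.app G.plus (e F G (FiberedBiset.FPlus.mk S)) =
          e F' G (FiberedBiset.FPlus.mk ⟨S.set, S.mem, FiberedBiset.Sec.map φ S.sec⟩)) ∧
      Φ.Additive ∧ Φ.Linear R := by
  -- `F₊` has the value `F₊(G)` at `G`, so the comparison maps are identities.
  refine ⟨FiberedBiset.lowerPlus R D, fun F G => LinearEquiv.refl R (FiberedBiset.FPlus F G),
    fun F G H U hU S => ?_, fun F F' φ G S => FiberedBiset.FPlus.map_mk φ S, ⟨?_⟩, ⟨?_⟩⟩
  · exact (LinearMap.congr_fun (FiberedBiset.BurnsideR.plusAct_cl F U hU) _).trans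
      (FiberedBiset.FPlus.act_mk U hU S)
  · intro F F' φ ψ
    ext G : 3
    refine ModuleCat.hom_ext (FiberedBiset.FPlus.hom_ext fun S => ?_)
    refine (FiberedBiset.FPlus.map_mk (φ + ψ) S).trans ?_
    refine (FiberedBiset.FPlus.mk_add S.set S.mem (FiberedBiset.Sec.map φ S.sec)
      (FiberedBiset.Sec.map ψ S.sec)).trans ?_
    exact (congrArg₂ (· + ·) (FiberedBiset.FPlus.map_mk φ S)
      (FiberedBiset.FPlus.map_mk ψ S)).symm
  · intro F F' φ r
    ext G : 3
    refine ModuleCat.hom_ext (FiberedBiset.FPlus.hom_ext fun S => ?_)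
    refine (FiberedBiset.FPlus.map_mk (r • φ) S).trans ?_
    refine (FiberedBiset.FPlus.smul_mk r ⟨S.set, S.mem, FiberedBiset.Sec.map φ S.sec⟩).symm.trans ?_
    exact (congrArg (r • ·) (FiberedBiset.FPlus.map_mk φ S)).symm
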